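/- **Conventions.** A graph $G=(V,E)$ has a finite vertex set $V$, no loops, and any two distinct vertices are joined by at most one edge, which is an arrow $a\to b$ or a line $a-b$; two vertices are adjacent if they are joined by an edge. The skeleton is the underlying undirected graph; $G_W$ is the subgraph induced by $W\subseteq V$. A cycle is a sequence $(v_0,\dots,v_k=v_0)$, $k\ge 3$, with $v_0,\dots,v_{k-1}$ distinct and $v_{i-1}\to v_i$ or $v_{i-1}-v_i$ for each $i$; it is semi-directed if at least one of these edges is an arrow, undirected if all are lines, and an undirected cycle is chordless if $k\ge4$ and no two vertices nonconsecutive mod $k$ are adjacent. $G$ is a chain graph if it has no semi-directed cycle. A flag is an induced subgraph $a\to b-c$, an immorality is an induced subgraph $a\to b\leftarrow c$; a triplex $(\{a,c\},b)$ is an induced subgraph $a\to b-c$, $a-b\leftarrow c$ or $a\to b\leftarrow c$; a 2-biflag $[a,b;c,d]$ consists of $a\to c-d\leftarrow b$ with $a,d$ nonadjacent and $b,c$ nonadjacent. The chain components of $G$ are the connected components of the graph left after removing all arrows; a component is nontrivial if it has at least two vertices. **AMP essential graphs.** For $A\subseteq V$ let $\mathrm{An}(A)$ be the smallest set containing $A$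 and closed under parents, and $\mathrm{Co}(A)$ the smallest set containing $A$ and closed under neighbours ($u$ is a neighbour of $v$ if $u-v$). The extended subgraph $G[A]$ has vertex set $\mathrm{Co}(\mathrm{An}(A))$, and its edges are the edges of $G$ within $\mathrm{An}(A)$ and the lines of $G$ within $\mathrm{Co}(\mathrm{An}(A))$. The augmented graph $H^a$ of a graph $H$ is the undirected graph obtained by joining $a,b$ for every triplex $(\{a,b\},c)$ and every 2-biflag $[a,b;c,d]$ of $H$ and replacing all arrows by lines. A probability distribution on a product $\prod_{v\in V}X_v$ of standard Borel spaces satisfies the AMP Markov property of $G$ if $A\perp B\mid S$ whenever $A,B,S\subseteq V$ are pairwise disjoint and $S$ separates $A$ from $B$ in $(G[A\cup B\cup S])^a$. Two chain graphs on $V$ are AMP Markov equivalent if, for every choice of the spaces $X_v$, the same distributions satisfy their AMP Markov properties. The AMP essential graph of the AMP Markov equivalence class $\mathcal G$ of a chain graph $G_0$ is the graph $\mathcal G^*$ with the same skeleton as $G_0$ in which $a\to b$ occurs iff $a\to b$ occurs in some $H\in\mathcal G$ and $a\leftarrow b$ occurs in no $H'\in\mathcal G$, and $a-b$ occurs iff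 either $a-b$ occurs in every $H\in\mathcal G$, or $a\to b$ occurs in some $H\in\mathcal G$ and $a\leftarrow b$ occurs in some $H'\in\mathcal G$. **Conditions.** For $A\subseteq V$ nonempty, $\mathrm{nb}_G(A)$ and $\mathrm{pa}_G(A)$ are the sets of $v\notin A$ that are a neighbour, respectively a parent, of at least one $a\in A$; $\mathrm{cnb}_G(A)$ and $\mathrm{cpa}_G(A)$ are the sets of $v\notin A$ that are a neighbour, respectively a parent, of every $a\in A$; $\mathrm{ncnb}_G(A)=\mathrm{nb}_G(A)\setminus\mathrm{cnb}_G(A)$. For a chain component $\xi$ put $\bar\xi=\xi\cup\mathrm{pa}_G(\xi)$. Let $\Xi_s(G)$ be the set of nontrivial chain components $\xi$ such that $G_{\bar\xi}$ contains a chordless undirected cycle with all vertices in $\xi$ or a flag $a\to b-c$ with $b,c\in\xi$. A line of $G$ is strong if both its end points lie in some $\xi\in\Xi_s(G)$. Property S of $G_{\bar\xi}$: for every nonempty complete $\alpha\subsetneq\xi$ such that $\kappa=\mathrm{cnb}_{G_\xi}(\alpha)\ne\emptyset$ and every connected component $\kappa_q$ of $G_\kappa$, either $\mathrm{nb}_{G_\xi}(\kappa_q)\setminus\alpha\neq\emptyset$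 or $\mathrm{pa}_{G_{\bar\xi}}(\alpha)\setminus\mathrm{cpa}_{G_{\bar\xi}}(\kappa_q)\ne\emptyset$. Property S$'$ of $G_{\bar\xi}$: for every nonempty connected $\kappa\subsetneq\xi$ such that $\alpha=\mathrm{cnb}_{G_\xi}(\kappa)$ is nonempty and complete, either $\mathrm{ncnb}_{G_\xi}(\kappa)\ne\emptyset$ or $\mathrm{pa}_{G_{\bar\xi}}(\alpha)\setminus\mathrm{cpa}_{G_{\bar\xi}}(\kappa)\neq\emptyset$. An arrow $a\to b$ is well protected in $G$ if there is a vertex $c$ (and, in (iv), a vertex $d\neq c$) such that one of the following holds: (i) $c\to a$ and $c,b$ are nonadjacent; (ii) $c\ne a$, $c\to b$ and $a,c$ are nonadjacent; (iii) $a\to c\to b$; (iv) $a-c$, $a-d$, $c\to b$, $d\to b$ and $c,d$ are nonadjacent; (v) $a-c$ is a strong line and $c\to b$; (vi) $a-c$ is a strong line and $c,b$ are nonadjacent; (vii) $b-c$ is a strong line and $a,c$ are nonadjacent; (viii) $b-c$ is a strong line and $a\to c$. **Theorem.** A graph $G=(V,E)$ is an AMP essential graph, i.e. $G=\mathcal G^*$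 for some AMP Markov equivalence class $\mathcal G$, if and only if - (G1) $G$ is a chain graph; - (G2) for each $\xi\in\Xi_s(G)$, $G_{\bar\xi}$ satisfies property S; - (G3) each arrow of $G$ is well protected in $G$. The same equivalence holds with S$'$ in place of S in (G2). -/

import Mathlib

open MeasureTheory ProbabilityTheory

universe u

/-- A graph `(V, E)` with directed and undirected edges and no loops, `E ⊆ V × V`.  The pair `a, b`
carries the line `a - b` if both `(a, b)` and `(b, a)` are in `E`, and the arrow `a → b` if only
`(a, b)` is in `E`; so any two vertices are joined by at most one edge. -/
@[ext]
structure MixedGraph (V : Type u) where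
  /-- `Edge a b`: `a → b` or `a - b`. -/
  Edge : V → V → Prop
  irrefl : ∀ a, ¬ Edge a a

namespace MixedGraph

variable {V : Type u}

/-! ### Graphical terminology -/

/-- `a → b`. -/
def Arrow (G : MixedGraph V) (a b : V) : Prop := G.Edge a b ∧ ¬ G.Edge b a

/-- `a - b`. -/
def Line (G : MixedGraph V) (a b : V) : Prop := G.Edge a b ∧ G.Edge b a

/-- `a` and `b` are joined by an arrow (in either direction) or a line. -/
def Adj (G : MixedGraph V) (a b : V) : Prop := G.Edge a b ∨ G.Edge b a

/-- The skeleton: the underlying undirected graph. -/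
def skeleton (G : MixedGraph V) : SimpleGraph V where
  Adj := G.Adj
  symm := ⟨fun _ _ h => Or.symm h⟩
  loopless := ⟨fun a h => G.irrefl a (h.elim id id)⟩

/-- The undirected graph obtained by removing all arrows. -/
def lineGraph (G : MixedGraph V) : SimpleGraph V where
  Adj := G.Line
  symm := ⟨fun _ _ h => And.symm h⟩
  loopless := ⟨fun a h => G.irrefl a h.1⟩

/-- The induced subgraph `G_W`.  The vertex type is kept; vertices outside `W` become isolated. -/
def restrict (G : MixedGraph V) (W : Set V) : MixedGraph V where
  Edge a b := G.Edge a b ∧ a ∈ W ∧ b ∈ W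
  irrefl a h := G.irrefl a h.1

/-- `(v 0, …, v k)` is a `k`-cycle: `k ≥ 3`, `v k = v 0`, the vertices `v 0, …, v (k-1)` are
distinct, and each `v i`, `v (i+1)` is joined by `v i → v (i+1)` or `v i - v (i+1)`. -/
def IsCycle (G : MixedGraph V) (k : ℕ) (v : ℕ → V) : Prop :=
  3 ≤ k ∧ v k = v 0 ∧ Set.InjOn v (Set.Iio k) ∧ ∀ i < k, G.Edge (v i) (v (i + 1))

/-- A cycle with at least one arrow. -/
def IsSemidirectedCycle (G : MixedGraph V) (k : ℕ) (v : ℕ → V) : Prop :=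
  G.IsCycle k v ∧ ∃ i < k, G.Arrow (v i) (v (i + 1))

/-- A cycle of length at least `4` all of whose edges are lines and in which no two vertices that
are nonconsecutive modulo `k` are adjacent. -/
def IsChordlessUndirectedCycle (G : MixedGraph V) (k : ℕ) (v : ℕ → V) : Prop :=
  G.IsCycle k v ∧ 4 ≤ k ∧ (∀ i < k, G.Line (v i) (v (i + 1))) ∧
    ∀ i j, i < j → j < k → j ≠ i + 1 → ¬ (i = 0 ∧ j + 1 = k) → ¬ G.Adj (v i) (v j)

/-- Chain graph (adicyclic graph): no semi-directed cycles. -/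
def IsChainGraph (G : MixedGraph V) : Prop :=
  ∀ k v, ¬ G.IsSemidirectedCycle k v

/-- The flag `a → b - c` (an induced subgraph). -/
def IsFlag (G : MixedGraph V) (a b c : V) : Prop :=
  G.Arrow a b ∧ G.Line b c ∧ ¬ G.Adj a c

/-- The immorality `a → b ← c` (an induced subgraph). -/
def IsImmorality (G : MixedGraph V) (a b c : V) : Prop :=
  a ≠ c ∧ G.Arrow a b ∧ G.Arrow c b ∧ ¬ G.Adj a c

/-- The triplex `({a, c}, b)`: one of `a → b - c`, `a - b ← c`, `a → b ← c` is an induced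
subgraph. -/
def IsTriplex (G : MixedGraph V) (a b c : V) : Prop :=
  G.IsFlag a b c ∨ G.IsFlag c b a ∨ G.IsImmorality a b c

/-- The 2-biflag `[a, b; c, d]`: `a → c - d ← b` with `a, d` nonadjacent and `b, c` nonadjacent
(`a` and `b` may or may not be adjacent). -/
def IsBiflag (G : MixedGraph V) (a b c d : V) : Prop :=
  G.Arrow a c ∧ G.Line c d ∧ G.Arrow b d ∧ ¬ G.Adj a d ∧ ¬ G.Adj b c

/-! ### The AMP Markov property -/

/-- The smallest ancestral set (closed under parents) that contains `A`. -/
def An (G : MixedGraph V) (A : Set V) : Set V :=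
  {v | ∃ a ∈ A, Relation.ReflTransGen G.Arrow v a}

/-- The smallest coherent set (closed under neighbours) that contains `A`. -/
def Co (G : MixedGraph V) (A : Set V) : Set V :=
  {v | ∃ a ∈ A, Relation.ReflTransGen G.Line v a}

/-- The extended subgraph `G[A]`: the edges of `G` inside `An A` together with the lines of `G`
inside `Co (An A)`. -/
def extended (G : MixedGraph V) (A : Set V) : MixedGraph V where
  Edge a b := (G.Edge a b ∧ a ∈ G.An A ∧ b ∈ G.An A) ∨
    (G.Line a b ∧ a ∈ G.Co (G.An A) ∧ b ∈ G.Co (G.An A))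
  irrefl a h := h.elim (fun h => G.irrefl a h.1) (fun h => G.irrefl a h.1.1)

/-- The augmented graph `Gᵃ`: the undirected graph obtained by joining `a, b` for each triplex
`({a, b}, c)` and each 2-biflag `[a, b; c, d]`, and replacing all arrows by lines. -/
def augmented (G : MixedGraph V) : SimpleGraph V :=
  SimpleGraph.fromRel fun a b =>
    G.Adj a b ∨ (∃ c, G.IsTriplex a c b) ∨ ∃ c d, G.IsBiflag a b c d

/-- `S` separates `A` and `B` in the undirected graph `H`. -/
def Separates (H : SimpleGraph V) (A B S : Set V) : Prop :=
  ∀ a ∈ A, ∀ b ∈ B, ∀ p : H.Walk a b, ∃ s ∈ S, s ∈ p.support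

/-- The σ-algebra on the product space generated by the coordinates in `A`. -/
@[reducible]
def coordSigma (X : V → Type) [∀ v, MeasurableSpace (X v)] (A : Set V) :
    MeasurableSpace (∀ v, X v) :=
  MeasurableSpace.comap A.domRestrict MeasurableSpace.pi

theorem coordSigma_le (X : V → Type) [∀ v, MeasurableSpace (X v)] (A : Set V) :
    coordSigma X A ≤ MeasurableSpace.pi :=
  (measurable_pi_lambda _ fun _ => measurable_pi_apply _).comap_le

/-- `𝒫(G)` on the product space `∏ X v`: the probability distributions `P` that satisfy the
(global) AMP Markov property of `G`, that is, `A ⊥ B | S` under `P` for all pairwise disjoint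
`A, B, S` such that `S` separates `A` and `B` in `(G[A ∪ B ∪ S])ᵃ`. -/
def ampModel [Finite V] (G : MixedGraph V) (X : V → Type) [∀ v, MeasurableSpace (X v)]
    [∀ v, StandardBorelSpace (X v)] : Set (ProbabilityMeasure (∀ v, X v)) :=
  {P | ∀ A B S : Set V, Disjoint A B → Disjoint A S → Disjoint B S →
    Separates (G.extended (A ∪ B ∪ S)).augmented A B S →
      CondIndep (coordSigma X S) (coordSigma X A) (coordSigma X B) (coordSigma_le X S)
        (P : Measure (∀ v, X v))}

/-- AMP Markov equivalence: `𝒫(G) = 𝒫(H)`, for every choice of the state spaces of the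
variables. -/
def MarkovEquiv [Finite V] (G H : MixedGraph V) : Prop :=
  ∀ (X : V → Type) [∀ v, MeasurableSpace (X v)] [∀ v, StandardBorelSpace (X v)],
    G.ampModel X = H.ampModel X

/-- The AMP Markov equivalence class of `G₀`: all chain graphs that are AMP Markov equivalent
to `G₀`. -/
def ampClass [Finite V] (G₀ : MixedGraph V) : Set (MixedGraph V) :=
  {G | G.IsChainGraph ∧ MarkovEquiv G G₀}

/-- `G` is the AMP essential graph determined by the AMP Markov equivalence class of `G₀`. -/
structure IsEssentialGraphOf [Finite V] (G G₀ : MixedGraph V) : Prop where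
  skeleton_eq : G.skeleton = G₀.skeleton
  arrow_iff : ∀ a b, G.Arrow a b ↔
    (∃ H ∈ ampClass G₀, H.Arrow a b) ∧ ¬ ∃ H ∈ ampClass G₀, H.Arrow b a
  line_iff : ∀ a b, G.Line a b ↔
    (∀ H ∈ ampClass G₀, H.Line a b) ∨
      ((∃ H ∈ ampClass G₀, H.Arrow a b) ∧ ∃ H ∈ ampClass G₀, H.Arrow b a)

/-- `G` is the AMP essential graph of some AMP Markov equivalence class. -/
def IsAMPEssentialGraph [Finite V] (G : MixedGraph V) : Prop :=
  ∃ G₀ : MixedGraph V, G₀.IsChainGraph ∧ G.IsEssentialGraphOf G₀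

/-! ### The conditions of the characterization -/

/-- Neighbours of the set `A`. -/
def nb (G : MixedGraph V) (A : Set V) : Set V := {v | v ∉ A ∧ ∃ a ∈ A, G.Line v a}

/-- Covering neighbours of `A`. -/
def cnb (G : MixedGraph V) (A : Set V) : Set V := {v | v ∉ A ∧ ∀ a ∈ A, G.Line v a}

/-- Noncovering neighbours of `A`. -/
def ncnb (G : MixedGraph V) (A : Set V) : Set V :=
  {v | v ∉ A ∧ (∃ a ∈ A, G.Line v a) ∧ ∃ a ∈ A, ¬ G.Line v a}

/-- Parents of the set `A`. -/
def pa (G : MixedGraph V) (A : Set V) : Set V := {v | v ∉ A ∧ ∃ a ∈ A, G.Arrow v a}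

/-- Covering parents of `A`. -/
def cpa (G : MixedGraph V) (A : Set V) : Set V := {v | v ∉ A ∧ ∀ a ∈ A, G.Arrow v a}

/-- The closure `ξ ∪ pa(ξ)`. -/
def cl (G : MixedGraph V) (ξ : Set V) : Set V := ξ ∪ G.pa ξ

/-- `K` is a connected component of the induced subgraph `G_W`. -/
def IsComponentOf (G : MixedGraph V) (W K : Set V) : Prop :=
  ∃ c : (G.skeleton.induce W).ConnectedComponent, K = Subtype.val '' c.supp

/-- The chain components: the connected components of the graph that remains when all arrows are
removed. -/
def chainComponents (G : MixedGraph V) : Set (Set V) :=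
  {ξ | ∃ c : G.lineGraph.ConnectedComponent, ξ = c.supp}

/-- `Ξ_s(G)`: the nontrivial chain components `ξ` such that the induced subgraph on the closure of
`ξ` contains a chordless undirected cycle in `ξ` or a flag `a → b - c` whose line lies in `ξ`. -/
def strongComponents (G : MixedGraph V) : Set (Set V) :=
  {ξ | ξ ∈ G.chainComponents ∧ ξ.Nontrivial ∧
    ((∃ k v, (G.restrict (G.cl ξ)).IsChordlessUndirectedCycle k v ∧ ∀ i ≤ k, v i ∈ ξ) ∨
      ∃ a b c, (G.restrict (G.cl ξ)).IsFlag a b c ∧ b ∈ ξ ∧ c ∈ ξ)}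

/-- The line `a - b` is strong in `G`. -/
def StrongLine (G : MixedGraph V) (a b : V) : Prop :=
  G.Line a b ∧ ∃ ξ ∈ G.strongComponents, a ∈ ξ ∧ b ∈ ξ

/-- Property `S` of the induced subgraph on the closure of `ξ`. -/
def PropertyS (G : MixedGraph V) (ξ : Set V) : Prop :=
  ∀ α : Set V, α ⊂ ξ → α.Nonempty → (G.restrict ξ).skeleton.IsClique α →
    ((G.restrict ξ).cnb α).Nonempty →
      ∀ K, G.IsComponentOf ((G.restrict ξ).cnb α) K →
        ((G.restrict ξ).nb K \ α).Nonempty ∨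
        ((G.restrict (G.cl ξ)).pa α \ (G.restrict (G.cl ξ)).cpa K).Nonempty

/-- Property `S'` of the induced subgraph on the closure of `ξ`. -/
def PropertyS' (G : MixedGraph V) (ξ : Set V) : Prop :=
  ∀ κ : Set V, κ ⊂ ξ → κ.Nonempty → (G.skeleton.induce κ).Connected →
    ((G.restrict ξ).cnb κ).Nonempty →
    (G.restrict ξ).skeleton.IsClique ((G.restrict ξ).cnb κ) →
      ((G.restrict ξ).ncnb κ).Nonempty ∨
      ((G.restrict (G.cl ξ)).pa ((G.restrict ξ).cnb κ) \
        (G.restrict (G.cl ξ)).cpa κ).Nonempty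

/-- The arrow `a → b` of `G` is well protected: it occurs in one of the following eight
configurations as an induced subgraph.
(i) `c → a → b`, `c, b` nonadjacent; (ii) `a → b ← c`, `a, c` nonadjacent;
(iii) `a → c → b`; (iv) `a - c → b`, `a - d → b`, `c, d` distinct and nonadjacent;
(v) `a - c → b`, `a - c` strong; (vi) `c - a → b`, `c - a` strong, `c, b` nonadjacent;
(vii) `a → b - c`, `b - c` strong, `a, c` nonadjacent; (viii) `a → c - b`, `c - b` strong. -/
def WellProtected (G : MixedGraph V) (a b : V) : Prop :=
  G.Arrow a b ∧
  ((∃ c, G.Arrow c a ∧ ¬ G.Adj c b) ∨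
   (∃ c, G.IsImmorality a b c) ∨
   (∃ c, G.Arrow a c ∧ G.Arrow c b) ∨
   (∃ c d, G.Line a c ∧ G.Line a d ∧ G.IsImmorality c b d) ∨
   (∃ c, G.StrongLine a c ∧ G.Arrow c b) ∨
   (∃ c, G.StrongLine c a ∧ ¬ G.Adj c b) ∨
   (∃ c, G.StrongLine b c ∧ ¬ G.Adj a c) ∨
   (∃ c, G.StrongLine b c ∧ G.Arrow a c))

end MixedGraph

/-! Everything rests on one move. Suppose that κ is connected by lines, that its outside
line-neighbours are pairwise joined by lines and each joined by a line to all of κ, and that every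
parent of such a neighbour is a parent of all of κ. Then the lines on the border of κ may be
directed into κ (`split`) without changing the Markov property; `merge` undoes such a move.
Properties S and S' both say that no nonempty proper part of the component admits the move
(`propertyS_iff`, `propertyS'_iff`), so either form of (G2) becomes `Unsplittable`.

Markov equivalence is used in two directions. Separation in augmented extended subgraphs is the
absence of active walks (`separates_iff_active`), and active walks can be rerouted between a graph
and its split, which gives `IsSplittable.markovEquiv`. Conversely, binary distributions built on two
fair coins show that equivalent chain graphs have the same skeleton and triplexes
(`MarkovEquiv.sameTriplexes`). That equal skeleton and triplexes imply equivalence is never needed: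
all equivalences that must be produced come from splits.

A graph with the three conditions is the essential graph of its own class
(`IsWellProtectedChainGraph.isEssentialGraphOf`). Strong lines are lines in every equivalent graph
(`Unsplittable.line`); a well protected arrow is never reversed, by an extremal choice among the
reversed arrows (`not_arrow_of_wellProtected`); any other line lies in a component without holes and
flags, where simplicial vertices can be split off until that line is directed either way.

Every class contains such a graph. A member with the fewest edge pairs is unsplittable. Among the
members whose strong components are unsplittable, take one with the most edge pairs: an arrow that
is not well protected would permit a merge and so a larger member
(`exists_isWellProtectedChainGraph`). Since the essential graph depends only on the class, it is
this graph. -/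

namespace MixedGraph

variable {V : Type u}

/-! ### Elementary facts on chain graphs -/

section ChainGraph

variable {G H : MixedGraph V} {a b c p x y : V}

/-- `b` can be reached from `a` along arrows and lines. -/
def Reach (G : MixedGraph V) (a b : V) : Prop := Relation.ReflTransGen G.Edge a b

theorem Reach.refl (a : V) : G.Reach a a := Relation.ReflTransGen.refl

theorem Reach.trans (h : G.Reach a b) (h' : G.Reach b c) : G.Reach a c :=
  Relation.ReflTransGen.trans h h'

theorem Arrow.reach (h : G.Arrow a b) : G.Reach a b := Relation.ReflTransGen.single h.1

theorem Line.reach (h : G.Line a b) : G.Reach a b := Relation.ReflTransGen.single h.1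

theorem Line.symm (h : G.Line a b) : G.Line b a := And.symm h

theorem Arrow.adj (h : G.Arrow a b) : G.Adj a b := Or.inl h.1

theorem Line.adj (h : G.Line a b) : G.Adj a b := Or.inl h.1

theorem Adj.symm (h : G.Adj a b) : G.Adj b a := Or.symm h

theorem Arrow.ne (h : G.Arrow a b) : a ≠ b := fun e => G.irrefl a (by simpa [e] using h.1)

theorem Line.ne (h : G.Line a b) : a ≠ b := fun e => G.irrefl a (by simpa [e] using h.1)

theorem adj_iff : G.Adj a b ↔ G.Line a b ∨ G.Arrow a b ∨ G.Arrow b a := by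
  unfold Adj Line Arrow; tauto

theorem edge_iff : G.Edge a b ↔ G.Line a b ∨ G.Arrow a b := by
  unfold Line Arrow; tauto

theorem eq_of_arrow_of_line (hA : ∀ a b, G.Arrow a b ↔ H.Arrow a b)
    (hL : ∀ a b, G.Line a b ↔ H.Line a b) : G = H := by
  ext a b
  rw [edge_iff, edge_iff, hA, hL]

theorem reach_of_reflTransGen_arrow (h : Relation.ReflTransGen G.Arrow a b) : G.Reach a b :=
  Relation.ReflTransGen.mono (fun _ _ h => h.1) _ _ h

theorem reach_of_reflTransGen_line (h : Relation.ReflTransGen G.Line a b) : G.Reach a b :=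
  Relation.ReflTransGen.mono (fun _ _ h => h.1) _ _ h

theorem reflTransGen_line_symm (h : Relation.ReflTransGen G.Line a b) :
    Relation.ReflTransGen G.Line b a := by
  induction h with
  | refl => exact .refl
  | tail _ h ih => exact .head h.symm ih

theorem exists_seq_of_reflTransGen {α : Type*} {r : α → α → Prop} {a b : α}
    (h : Relation.ReflTransGen r a b) :
    ∃ (n : ℕ) (v : ℕ → α), v 0 = a ∧ v n = b ∧ ∀ i < n, r (v i) (v (i + 1)) := by
  induction h with
  | refl => exact ⟨0, fun _ => a, rfl, rfl, by simp⟩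
  | @tail b c _ hbc ih =>
    obtain ⟨n, v, h0, hn, hv⟩ := ih
    refine ⟨n + 1, fun i => if i ≤ n then v i else c, by simpa using h0, by simp, ?_⟩
    intro i hi
    rcases Nat.lt_succ_iff_lt_or_eq.mp hi with h | rfl
    · simpa [h.le, Nat.succ_le_of_lt h] using hv i h
    · simpa [hn] using hbc

/-- A shortest sequence from `a` to `b` of `r`-steps: it is injective, and two terms that are not
consecutive are not `r`-related in increasing order. -/
theorem exists_shortest_seq {α : Type*} {r : α → α → Prop} {a b : α}
    (h : Relation.ReflTransGen r a b) :
    ∃ (n : ℕ) (v : ℕ → α), v 0 = a ∧ v n = b ∧ (∀ i < n, r (v i) (v (i + 1))) ∧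
      (∀ i j, i < j → j ≤ n → v i ≠ v j) ∧ ∀ i j, i + 1 < j → j ≤ n → ¬ r (v i) (v j) := by
  classical
  let P : ℕ → Prop := fun n => ∃ v : ℕ → α, v 0 = a ∧ v n = b ∧ ∀ i < n, r (v i) (v (i + 1))
  have hP : ∃ n, P n := exists_seq_of_reflTransGen h
  obtain ⟨v, h0, hn, hv⟩ := Nat.find_spec hP
  have hmin : ∀ m, P m → Nat.find hP ≤ m := fun m hm => Nat.find_min' hP hm
  generalize Nat.find hP = n at *
  refine ⟨n, v, h0, hn, hv, ?_, ?_⟩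
  · intro i j hij hj he
    -- A repeated vertex lets the stretch from `i` to `j` be cut out, contradicting minimality. The
    -- shortened sequence ends at index `i` exactly when `j = n`.
    have := hmin (n - (j - i)) ⟨fun m => if m ≤ i then v m else v (m + (j - i)), by simpa using h0,
      by
        by_cases h : n - (j - i) ≤ i
        · have h1 : n - (j - i) = i := by omega
          have h2 : j = n := by omega
          simp only [h1, le_refl, if_true]
          rw [he, h2, hn]
        · have h1 : n - (j - i) + (j - i) = n := by omega
          simp [h, h1, hn], ?_⟩
    · omega
    · intro m hm
      rcases lt_trichotomy m i with h | rfl | h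
      · simpa [h.le, Nat.succ_le_of_lt h] using hv m (by omega)
      · have h1 : m + 1 + (j - m) = j + 1 := by omega
        simpa [h1, he] using hv j (by omega)
      · have h1 : ¬ m ≤ i := by omega
        have h2 : ¬ m + 1 ≤ i := by omega
        have h3 : m + 1 + (j - i) = m + (j - i) + 1 := by omega
        simpa [h1, h2, h3] using hv (m + (j - i)) (by omega)
  · intro i j hij hj he
    have := hmin (n - (j - i - 1)) ⟨fun m => if m ≤ i then v m else v (m + (j - i - 1)),
      by simpa using h0,
      by
        have h : ¬ n - (j - i - 1) ≤ i := by omega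
        have h1 : n - (j - i - 1) + (j - i - 1) = n := by omega
        simp [h, h1, hn], ?_⟩
    · omega
    · intro m hm
      rcases lt_trichotomy m i with h | rfl | h
      · simpa [h.le, Nat.succ_le_of_lt h] using hv m (by omega)
      · have h1 : m + 1 + (j - m - 1) = j := by omega
        simpa [h1] using he
      · have h1 : ¬ m ≤ i := by omega
        have h2 : ¬ m + 1 ≤ i := by omega
        have h3 : m + 1 + (j - i - 1) = m + (j - i - 1) + 1 := by omega
        simpa [h1, h2, h3] using hv (m + (j - i - 1)) (by omega)

/-- A shortest walk from `b` back to `a` closes up with `a → b` to a semi-directed cycle. It has at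
least two steps because `b, a` carries neither a line nor an arrow `b → a`, so the cycle has length
at least 3. -/
theorem IsChainGraph.not_reach (hG : G.IsChainGraph) (hab : G.Arrow a b) : ¬ G.Reach b a := by
  intro h
  obtain ⟨n, v, h0, hn, hv, hinj, -⟩ := exists_shortest_seq h
  have hn2 : 2 ≤ n := by
    rcases n with _ | _ | n
    · exact absurd (hn.symm.trans h0) hab.ne
    · have := hv 0 (by norm_num)
      rw [h0, zero_add, hn] at this
      exact absurd this hab.2
    · omega
  -- The closing arrow sits at index `n`; beyond `n` the sequence takes the value `b = v 0`.
  refine hG (n + 1) (fun i => if i ≤ n then v i else b)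
    ⟨⟨by omega, by simp [h0], ?_, ?_⟩, n, by omega, ?_⟩
  · intro i hi j hj hij
    have hi' : i ≤ n := Nat.lt_succ_iff.mp hi
    have hj' : j ≤ n := Nat.lt_succ_iff.mp hj
    simp only [hi', hj', if_true] at hij
    rcases lt_trichotomy i j with h | h | h
    · exact absurd hij (hinj i j h hj')
    · exact h
    · exact absurd hij.symm (hinj j i h hi')
  · intro i hi
    rcases Nat.lt_succ_iff_lt_or_eq.mp hi with h | rfl
    · simpa [h.le, Nat.succ_le_of_lt h] using hv i h
    · simpa [hn] using hab.1
  · simpa [hn] using hab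

theorem isChainGraph_of_not_reach (h : ∀ a b, G.Arrow a b → ¬ G.Reach b a) : G.IsChainGraph := by
  rintro k v ⟨⟨-, h0, -, hv⟩, i, hi, hA⟩
  have key : ∀ m n, m ≤ n → n ≤ k → G.Reach (v m) (v n) := by
    intro m n hmn
    induction n, hmn using Nat.le_induction with
    | base => exact fun _ => Reach.refl _
    | succ n _ ih => exact fun hk => (ih (by omega)).tail (hv n (by omega))
  have h1 := key (i + 1) k (by omega) le_rfl
  rw [h0] at h1
  exact h _ _ hA (h1.trans (key 0 i (by omega) (by omega)))

theorem IsChainGraph.line_of_adj (hG : G.IsChainGraph) (h : G.Adj a b) (h1 : G.Reach a b)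
    (h2 : G.Reach b a) : G.Line a b := by
  rcases adj_iff.mp h with h | h | h
  · exact h
  · exact absurd h2 (hG.not_reach h)
  · exact absurd h1 (hG.not_reach h)

theorem arrow_of_adj (h : G.Adj a b) (h1 : ¬ G.Reach b a) :
    G.Arrow a b := by
  rcases adj_iff.mp h with h | h | h
  · exact absurd h.symm.reach h1
  · exact h
  · exact absurd h.reach h1

theorem IsChainGraph.reflTransGen_line (hG : G.IsChainGraph) (h1 : G.Reach a b)
    (h2 : G.Reach b a) : Relation.ReflTransGen G.Line a b := by
  induction h1 with
  | refl => exact .refl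
  | @tail b c hab hbc ih =>
    have hcb : G.Reach c b := h2.trans hab
    have : G.Line b c := hG.line_of_adj (Or.inl hbc) (Relation.ReflTransGen.single hbc) hcb
    exact (ih (this.reach.trans h2)).tail this

/-- The vertex set ordered by reachability has a height function. -/
theorem IsChainGraph.exists_height [Finite V] (hG : G.IsChainGraph) :
    ∃ r : V → ℕ, (∀ a b, G.Arrow a b → r a < r b) ∧ ∀ a b, G.Line a b → r a = r b := by
  have mono : ∀ a b, G.Reach a b → {y | G.Reach y a} ⊆ {y | G.Reach y b} :=
    fun a b h y hy => Reach.trans hy h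
  refine ⟨fun a => {y | G.Reach y a}.ncard, fun a b h => ?_, fun a b h => ?_⟩
  · refine Set.ncard_lt_ncard ⟨mono a b h.reach, fun hs => ?_⟩ (Set.toFinite _)
    exact hG.not_reach h (hs (Reach.refl b))
  · exact le_antisymm (Set.ncard_le_ncard (mono a b h.reach) (Set.toFinite _))
      (Set.ncard_le_ncard (mono b a h.symm.reach) (Set.toFinite _))

theorem IsTriplex.symm (h : G.IsTriplex a b c) : G.IsTriplex c b a := by
  unfold IsTriplex IsImmorality at *
  rcases h with h | h | ⟨h1, h2, h3, h4⟩
  · exact Or.inr (Or.inl h)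
  · exact Or.inl h
  · exact Or.inr (Or.inr ⟨h1.symm, h3, h2, fun h => h4 h.symm⟩)

theorem IsTriplex.not_arrow_left (h : G.IsTriplex a b c) : ¬ G.Arrow b a := by
  rintro ⟨h1, h2⟩
  rcases h with h | h | h
  · exact h2 h.1.1
  · exact h2 h.2.1.2
  · exact h2 h.2.1.1

theorem IsTriplex.not_arrow_right (h : G.IsTriplex a b c) : ¬ G.Arrow b c :=
  h.symm.not_arrow_left

theorem IsTriplex.not_line_line (h : G.IsTriplex a b c) (h1 : G.Line a b) : ¬ G.Line b c := by
  rintro h2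
  rcases h with h | h | h
  · exact h.1.2 h1.2
  · exact h.1.2 h2.1
  · exact h.2.1.2 h1.2

/-- A vertex `b` between nonadjacent `a, c` with an arrow `a → b` and no arrow out of `b`. -/
theorem isTriplex_of_arrow (hne : a ≠ c) (hab : G.Arrow a b) (hac : ¬ G.Adj a c)
    (hbc : G.Adj b c) (hbc' : ¬ G.Arrow b c) : G.IsTriplex a b c := by
  rcases adj_iff.mp hbc with h | h | h
  · exact Or.inl ⟨hab, h, hac⟩
  · exact absurd h hbc'
  · exact Or.inr (Or.inr ⟨hne, hab, h, hac⟩)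

end ChainGraph

/-! ### Separation in augmented extended subgraphs -/

section Separation

variable {G : MixedGraph V} {a b c d x y s v w : V} {A B D S N : Set V}

theorem subset_An : D ⊆ G.An D := fun v hv => ⟨v, hv, .refl⟩

theorem subset_Co : D ⊆ G.Co D := fun v hv => ⟨v, hv, .refl⟩

theorem mem_An_of_arrow (h : G.Arrow v w) (hw : w ∈ G.An D) : v ∈ G.An D := by
  obtain ⟨d, hd, h'⟩ := hw
  exact ⟨d, hd, .head h h'⟩

theorem mem_Co_of_line (h : G.Line v w) (hw : w ∈ G.Co D) : v ∈ G.Co D := by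
  obtain ⟨d, hd, h'⟩ := hw
  exact ⟨d, hd, .head h h'⟩

theorem extended_arrow : (G.extended D).Arrow x y ↔ G.Arrow x y ∧ y ∈ G.An D := by
  constructor
  · rintro ⟨h | h, h'⟩
    · exact ⟨⟨h.1, fun e => h' (Or.inl ⟨e, h.2.2, h.2.1⟩)⟩, h.2.2⟩
    · exact absurd (Or.inr ⟨h.1.symm, h.2.2, h.2.1⟩) h'
  · rintro ⟨h, hy⟩
    refine ⟨Or.inl ⟨h.1, mem_An_of_arrow h hy, hy⟩, ?_⟩
    rintro (h' | h')
    · exact h.2 h'.1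
    · exact h.2 h'.1.1

theorem extended_line : (G.extended D).Line x y ↔ G.Line x y ∧ y ∈ G.Co (G.An D) := by
  constructor
  · rintro ⟨h | h, h' | h'⟩
    · exact ⟨⟨h.1, h'.1⟩, subset_Co h.2.2⟩
    · exact ⟨h'.1.symm, h'.2.1⟩
    · exact ⟨h.1, h.2.2⟩
    · exact ⟨h.1, h.2.2⟩
  · rintro ⟨h, hy⟩
    exact ⟨Or.inr ⟨h, mem_Co_of_line h hy, hy⟩, Or.inr ⟨h.symm, hy, mem_Co_of_line h hy⟩⟩

/-- `x` is `u`, or a parent of `u` with `u ∈ N`. -/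
def Touches (G : MixedGraph V) (N : Set V) (x u : V) : Prop := x = u ∨ (G.Arrow x u ∧ u ∈ N)

/-- The augmentation rules cover exactly these patterns: `x → u - w ← y` is a biflag unless a chord
from `x` to `w` or from `y` to `u` turns it into a flag or an immorality. A chord in the opposite
direction would close a semi-directed cycle. -/
theorem augmented_adj_of_touches (hG : G.IsChainGraph) {u w : V} (hxy : x ≠ y)
    (hx : G.Touches (G.An D) x u) (hy : G.Touches (G.An D) y w) (huw : u = w ∨ G.Line u w)
    (hw : w ∈ G.Co (G.An D)) : (G.extended D).augmented.Adj x y := by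
  set E := G.extended D with hE
  have hu : u ∈ G.Co (G.An D) := by
    rcases huw with rfl | h
    · exact hw
    · exact mem_Co_of_line h hw
  rw [augmented, SimpleGraph.fromRel_adj]
  refine ⟨hxy, Or.inl ?_⟩
  by_cases hadj : E.Adj x y
  · exact Or.inl hadj
  right
  have arr : ∀ {p q}, G.Arrow p q → q ∈ G.An D → E.Arrow p q :=
    fun h h' => extended_arrow.mpr ⟨h, h'⟩
  have imm : ∀ {q}, E.Arrow x q → E.Arrow y q → E.IsTriplex x q y :=
    fun h h' => Or.inr (Or.inr ⟨hxy, h, h', hadj⟩)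
  have hline : ∀ {q}, G.Line u q → q ∈ G.Co (G.An D) → E.Line u q :=
    fun h h' => extended_line.mpr ⟨h, h'⟩
  rcases hx with rfl | ⟨hx, hxN⟩
  · rcases hy with rfl | ⟨hy, hyN⟩
    · rcases huw with h | h
      · exact absurd h hxy
      · exact absurd (hline h hw).adj hadj
    · rcases huw with rfl | h
      · exact absurd (arr hy hyN).adj.symm hadj
      · exact Or.inl ⟨w, Or.inr (Or.inl ⟨arr hy hyN, (hline h hw).symm, fun h => hadj h.symm⟩)⟩
  · rcases hy with rfl | ⟨hy, hyN⟩
    · rcases huw with rfl | h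
      · exact absurd (arr hx hxN).adj hadj
      · exact Or.inl ⟨u, Or.inl ⟨arr hx hxN, hline h hw, hadj⟩⟩
    · rcases huw with rfl | h
      · exact Or.inl ⟨u, imm (arr hx hxN) (arr hy hyN)⟩
      · by_cases h1 : E.Adj x w
        · rcases adj_iff.mp h1 with h1 | h1 | h1
          · exact Or.inl ⟨w, Or.inr (Or.inl ⟨arr hy hyN, h1.symm, fun h => hadj h.symm⟩)⟩
          · exact Or.inl ⟨w, imm h1 (arr hy hyN)⟩
          · exact absurd (h.reach.trans (extended_arrow.mp h1).1.reach) (hG.not_reach hx)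
        by_cases h2 : E.Adj y u
        · rcases adj_iff.mp h2 with h2 | h2 | h2
          · exact Or.inl ⟨u, Or.inl ⟨arr hx hxN, h2.symm, hadj⟩⟩
          · exact Or.inl ⟨u, imm (arr hx hxN) h2⟩
          · exact absurd (h.symm.reach.trans (extended_arrow.mp h2).1.reach) (hG.not_reach hy)
        exact Or.inr ⟨u, w, arr hx hxN, hline h hw, arr hy hyN, h1, h2⟩

/-- `v` lies outside `S` or has a parent outside `S`. -/
def Open (G : MixedGraph V) (S : Set V) (v : V) : Prop := v ∉ S ∨ ∃ p, p ∉ S ∧ G.Arrow p v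

/-- The steps of active walks given `S`, where `N` is the ancestral set under consideration. -/
def Active (G : MixedGraph V) (N S : Set V) (u v : V) : Prop :=
  G.Open S u ∧ G.Open S v ∧
    (G.Line u v ∨ (G.Arrow u v ∧ u ∉ S ∧ v ∈ N) ∨ (G.Arrow v u ∧ v ∉ S ∧ u ∈ N))

theorem Active.symm (h : G.Active N S v w) : G.Active N S w v :=
  ⟨h.2.1, h.1, h.2.2.elim (fun h => Or.inl h.symm) (fun h => Or.inr h.symm)⟩

theorem reflTransGen_active_symm (h : Relation.ReflTransGen (G.Active N S) v w) :
    Relation.ReflTransGen (G.Active N S) w v := by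
  induction h with
  | refl => exact .refl
  | tail _ h ih => exact .head h.symm ih

/-- An augmented edge stems from an adjacency, a flag, an immorality or a biflag. The head of each
arrow involved has a parent outside `S`, so every intermediate vertex is open and the underlying
path is active. -/
theorem reflTransGen_active_of_augmented_adj (h : (G.extended D).augmented.Adj x y) (hx : x ∉ S)
    (hy : y ∉ S) : Relation.ReflTransGen (G.Active (G.An D) S) x y := by
  set E := G.extended D
  have hl : ∀ {p q}, E.Line p q → G.Open S p → G.Open S q → G.Active (G.An D) S p q :=
    fun h h1 h2 => ⟨h1, h2, Or.inl (extended_line.mp h).1⟩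
  have ha : ∀ {p q}, E.Arrow p q → p ∉ S → G.Active (G.An D) S p q := fun h h1 =>
    ⟨Or.inl h1, Or.inr ⟨_, h1, (extended_arrow.mp h).1⟩,
      Or.inr (Or.inl ⟨(extended_arrow.mp h).1, h1, (extended_arrow.mp h).2⟩)⟩
  have ho : ∀ {p q}, E.Arrow p q → p ∉ S → G.Open S q := fun h h1 => (ha h h1).2.1
  have adj : ∀ {p q}, E.Adj p q → p ∉ S → q ∉ S → G.Active (G.An D) S p q := by
    intro p q h h1 h2
    rcases adj_iff.mp h with h | h | h
    · exact hl h (Or.inl h1) (Or.inl h2)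
    · exact ha h h1
    · exact (ha h h2).symm
  have flag : ∀ {p q r}, E.IsFlag p q r → p ∉ S → r ∉ S →
      Relation.ReflTransGen (G.Active (G.An D) S) p r := fun h h1 h2 =>
    (Relation.ReflTransGen.single (ha h.1 h1)).tail (hl h.2.1 (ho h.1 h1) (Or.inl h2))
  have main : ∀ {p q}, p ∉ S → q ∉ S →
      (E.Adj p q ∨ (∃ c, E.IsTriplex p c q) ∨ ∃ c d, E.IsBiflag p q c d) →
      Relation.ReflTransGen (G.Active (G.An D) S) p q := by
    rintro p q hp hq (h | ⟨c, h | h | h⟩ | ⟨c, d, h⟩)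
    · exact .single (adj h hp hq)
    · exact flag h hp hq
    · exact reflTransGen_active_symm (flag h hq hp)
    · exact (Relation.ReflTransGen.single (ha h.2.1 hp)).tail (ha h.2.2.1 hq).symm
    · exact ((Relation.ReflTransGen.single (ha h.1 hp)).tail
        (hl h.2.1 (ho h.1 hp) (ho h.2.2.1 hq))).tail (ha h.2.2.1 hq).symm
  rw [augmented, SimpleGraph.fromRel_adj] at h
  rcases h.2 with h | h
  · exact main hx hy h
  · exact reflTransGen_active_symm (main hy hx h)

theorem exists_walk_avoiding {K : SimpleGraph V}
    (h : Relation.ReflTransGen (fun x y => K.Adj x y ∧ y ∉ S) a b) (ha : a ∉ S) :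
    ∃ p : K.Walk a b, ∀ s ∈ S, s ∉ p.support := by
  induction h with
  | refl => exact ⟨.nil, fun s hs h => ha (by simpa using (List.mem_singleton.mp h) ▸ hs)⟩
  | @tail b c _ hbc ih =>
    obtain ⟨p, hp⟩ := ih
    refine ⟨p.concat hbc.1, fun s hs h => ?_⟩
    rw [SimpleGraph.Walk.support_concat, List.mem_append] at h
    rcases h with h | h
    · exact hp s hs h
    · exact hbc.2 (List.mem_singleton.mp h ▸ hs)

/-- An active walk may run through vertices of `S`, but each of these has a parent outside `S`, and
such parents form the walk in the augmented graph. Since `S ⊆ D`, the arrows from these parents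
survive in the extended subgraph. -/
theorem separates_iff_active (hG : G.IsChainGraph) (hAD : A ⊆ D) (hSD : S ⊆ D)
    (hAS : Disjoint A S) (hBS : Disjoint B S) :
    Separates (G.extended D).augmented A B S ↔
      ∀ a ∈ A, ∀ b ∈ B, ¬ Relation.ReflTransGen (G.Active (G.An D) S) a b := by
  constructor
  · intro h a ha b hb hab
    have haS : a ∉ S := Set.disjoint_left.mp hAS ha
    have hbS : b ∉ S := Set.disjoint_left.mp hBS hb
    -- Invariant: every `y` outside `S` that touches the current vertex is already reachable from
    -- `a` off `S`. Quantifying over all such `y` leaves the choice of stand-in parent to the next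
    -- step.
    have key : ∀ u, Relation.ReflTransGen (G.Active (G.An D) S) a u → u ∈ G.Co (G.An D) ∧
        ∀ y, y ∉ S → G.Touches (G.An D) y u →
          Relation.ReflTransGen (fun x y => (G.extended D).augmented.Adj x y ∧ y ∉ S) a y := by
      intro u hu
      induction hu with
      | refl =>
        have haC : a ∈ G.Co (G.An D) := subset_Co (subset_An (hAD ha))
        refine ⟨haC, fun y hy ht => ?_⟩
        by_cases hay : a = y
        · rw [hay]
        · exact .single ⟨augmented_adj_of_touches hG hay (Or.inl rfl) ht (Or.inl rfl) haC, hy⟩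
      | @tail u w _ huw ih =>
        obtain ⟨huC, ih⟩ := ih
        have step : ∀ {x y u'}, x ∉ S → y ∉ S → G.Touches (G.An D) x u →
            G.Touches (G.An D) x u' → G.Touches (G.An D) y w → (u' = w ∨ G.Line u' w) →
            w ∈ G.Co (G.An D) →
            Relation.ReflTransGen (fun x y => (G.extended D).augmented.Adj x y ∧ y ∉ S) a y := by
          intro x y u' hx hy ht ht' hty he hw
          by_cases hxy : x = y
          · exact hxy ▸ ih x hx ht
          · exact (ih x hx ht).tail ⟨augmented_adj_of_touches hG hxy ht' hty he hw, hy⟩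
        rcases huw with ⟨hou, how, hl | ⟨hl, huS, hwN⟩ | ⟨hl, hwS, huN⟩⟩
        · have hw := mem_Co_of_line hl.symm huC
          obtain ⟨x, hx, hxu⟩ : ∃ x, x ∉ S ∧ G.Touches (G.An D) x u := by
            by_cases huS : u ∈ S
            · rcases hou with h | ⟨p, hp, hpu⟩
              · exact absurd huS h
              · exact ⟨p, hp, Or.inr ⟨hpu, subset_An (hSD huS)⟩⟩
            · exact ⟨u, huS, Or.inl rfl⟩
          exact ⟨hw, fun y hy hty => step hx hy hxu hxu hty (Or.inr hl) hw⟩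
        · exact ⟨subset_Co hwN, fun y hy hty => step huS hy (Or.inl rfl) (Or.inr ⟨hl, hwN⟩) hty
            (Or.inl rfl) (subset_Co hwN)⟩
        · have hw : w ∈ G.Co (G.An D) := subset_Co (mem_An_of_arrow hl huN)
          exact ⟨hw, fun y hy hty => step hwS hy (Or.inr ⟨hl, huN⟩) (Or.inl rfl) hty
            (Or.inl rfl) hw⟩
    obtain ⟨p, hp⟩ := exists_walk_avoiding ((key b hab).2 b hbS (Or.inl rfl)) haS
    obtain ⟨s, hs, hs'⟩ := h a ha b hb p
    exact hp s hs hs'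
  · intro h a ha b hb p
    by_contra hcon
    push Not at hcon
    refine h a ha b hb ?_
    clear h ha hb hAD hAS hBS
    induction p with
    | nil => exact .refl
    | cons hadj p ih =>
      have h1 : ∀ s ∈ S, s ∉ p.support := fun s hs h => hcon s hs (by simp [h])
      refine (reflTransGen_active_of_augmented_adj hadj ?_ ?_).trans (ih h1)
      · exact fun hs => hcon _ hs (by simp)
      · exact fun hs => h1 _ hs (by simp)

/-- Nonadjacent vertices `a, c` are separated by some set that contains every common neighbour `b`
in the skeleton for which `({a, c}, b)` is not a triplex. -/
theorem exists_separating_set (hG : G.IsChainGraph) (hac : a ≠ c) (hadj : ¬ G.Adj a c) :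
    ∃ S : Set V, a ∉ S ∧ c ∉ S ∧
      Separates (G.extended ({a} ∪ {c} ∪ S)).augmented {a} {c} S ∧
      ∀ b, G.Adj a b → G.Adj b c → ¬ G.IsTriplex a b c → b ∈ S := by
  have directed : ∀ {a c : V}, a ≠ c → ¬ G.Adj a c → ¬ G.Reach c a →
      ∃ S : Set V, a ∉ S ∧ c ∉ S ∧
      (∀ D, D = {a} ∪ {c} ∪ S → ¬ Relation.ReflTransGen (G.Active (G.An D) S) c a) ∧
      ∀ b, G.Adj a b → G.Adj b c → ¬ G.IsTriplex a b c → b ∈ S := by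
    intro a c hac hadj hr
    -- The parents of `c` separate. An active walk from `c` cannot use an arrow out of the component
    -- of `c`, because its head would not be an ancestor of `D`; an arrow into `c` is blocked at its
    -- tail.
    refine ⟨{p | G.Arrow p c}, fun h => hadj h.adj, fun h => h.ne rfl, ?_, ?_⟩
    · rintro D rfl h
      set D := {a} ∪ {c} ∪ {p | G.Arrow p c}
      have hN : ∀ v ∈ G.An D, G.Reach c v → v = c := by
        rintro v ⟨d, (hd | hd) | hd, hvd⟩ hcv
        · rw [Set.mem_singleton_iff] at hd
          subst hd
          exact absurd (hcv.trans (reach_of_reflTransGen_arrow hvd)) hr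
        · rw [Set.mem_singleton_iff] at hd
          subst hd
          rcases Relation.ReflTransGen.cases_head hvd with h | ⟨w, hvw, hwc⟩
          · exact h
          · exact absurd ((reach_of_reflTransGen_arrow hwc).trans hcv) (hG.not_reach hvw)
        · exact absurd (hcv.trans (reach_of_reflTransGen_arrow hvd)) (hG.not_reach hd)
      have inv : ∀ v, Relation.ReflTransGen (G.Active (G.An D) {p | G.Arrow p c}) c v →
          Relation.ReflTransGen G.Line c v := by
        intro v hv
        induction hv with
        | refl => exact .refl
        | @tail u w _ huw ih =>
          rcases huw.2.2 with hl | ⟨hl, -, hw⟩ | ⟨hl, hw, hu⟩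
          · exact ih.tail hl
          · have := hN w hw ((reach_of_reflTransGen_line ih).trans hl.reach)
            exact this ▸ .refl
          · have := hN u hu (reach_of_reflTransGen_line ih)
            exact absurd (this ▸ hl) hw
      exact hr (reach_of_reflTransGen_line (inv a h))
    · intro b hab hbc ht
      rcases adj_iff.mp hbc with h | h | h
      · refine absurd ?_ ht
        refine (Or.inl ⟨arrow_of_adj hab ?_, h, hadj⟩)
        exact fun hba => hr (h.symm.reach.trans hba)
      · exact h
      · exact absurd (isTriplex_of_arrow hac.symm h (fun h => hadj h.symm) hab.symm
          fun h' => hr (h.reach.trans h'.reach)).symm ht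
  have disj : ∀ {S : Set V} {x : V}, x ∉ S → Disjoint {x} S := fun h =>
    Set.disjoint_singleton_left.mpr h
  by_cases h1 : G.Reach c a
  · by_cases h2 : G.Reach a c
    · have hline := hG.reflTransGen_line h2 h1
      let T : Set V := {v | Relation.ReflTransGen G.Line a v}
      have hT : ∀ {v}, v ∈ T → G.Reach a v ∧ G.Reach v a := fun hv =>
        ⟨reach_of_reflTransGen_line hv, reach_of_reflTransGen_line (reflTransGen_line_symm hv)⟩
      -- Here `a` and `c` share the chain component `T`. Each vertex of `T` other than `a` and `c`
      -- lies in `S` together with all its parents, hence is not open; so no active step leaves `a`.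
      let S : Set V := {v | v ≠ a ∧ v ≠ c ∧ (v ∈ T ∨ ∃ t ∈ T, G.Arrow v t)}
      have haS : a ∉ S := fun h => h.1 rfl
      have hcS : c ∉ S := fun h => h.2.1 rfl
      have hpa : ∀ {p t}, t ∈ T → G.Arrow p t → p ∈ S := by
        intro p t ht hp
        refine ⟨?_, ?_, Or.inr ⟨t, ht, hp⟩⟩
        · rintro rfl
          exact hG.not_reach hp (hT ht).2
        · rintro rfl
          exact hG.not_reach hp ((hT ht).2.trans h2)
      refine ⟨S, haS, hcS, ?_, ?_⟩
      · refine (separates_iff_active (D := {a} ∪ {c} ∪ S) hG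
          (fun _ h => Or.inl (Or.inl h)) (fun _ h => Or.inr h) (disj haS) (disj hcS)).mpr ?_
        intro x hx y hy h
        rw [Set.mem_singleton_iff] at hx hy
        subst x y
        rcases Relation.ReflTransGen.cases_head h with h | ⟨w, haw, -⟩
        · exact hac h
        · rcases haw with ⟨-, hw, hl | ⟨hl, -, d, hd, hwd⟩ | ⟨hl, hw, -⟩⟩
          · have hwT : w ∈ T := .single hl
            rcases hw with hw | ⟨p, hp, hpw⟩
            · refine hw ⟨hl.ne.symm, ?_, Or.inl hwT⟩
              rintro rfl
              exact hadj hl.adj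
            · exact hp (hpa hwT hpw)
          · refine hG.not_reach hl ((reach_of_reflTransGen_arrow hwd).trans ?_)
            rcases hd with (rfl | rfl) | ⟨-, -, hd | ⟨t, ht, hd⟩⟩
            · exact Reach.refl _
            · exact h1
            · exact (hT hd).2
            · exact hd.reach.trans (hT ht).2
          · exact hw (hpa .refl hl)
      · intro b hab hbc ht
        refine ⟨?_, ?_, ?_⟩
        · rintro rfl
          exact hab.elim (G.irrefl _) (G.irrefl _)
        · rintro rfl
          exact hbc.elim (G.irrefl _) (G.irrefl _)
        · rcases adj_iff.mp hab with h | h | h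
          · exact Or.inl (.single h)
          · refine absurd (isTriplex_of_arrow hac h hadj hbc fun h' => ?_) ht
            exact hG.not_reach h (h'.reach.trans h1)
          · exact Or.inr ⟨a, .refl, h⟩
    · obtain ⟨S, hS1, hS2, hS3, hS4⟩ := directed hac.symm (fun h => hadj h.symm) h2
      refine ⟨S, hS2, hS1, ?_, fun b hab hbc ht => hS4 b hbc.symm hab.symm fun h => ht h.symm⟩
      refine (separates_iff_active (D := {a} ∪ {c} ∪ S) hG
          (fun _ h => Or.inl (Or.inl h)) (fun _ h => Or.inr h) (disj hS2) (disj hS1)).mpr ?_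
      intro x hx y hy h
      rw [Set.mem_singleton_iff] at hx hy
      subst x y
      exact hS3 _ (by rw [Set.union_comm {a}]) h
  · obtain ⟨S, hS1, hS2, hS3, hS4⟩ := directed hac hadj h1
    refine ⟨S, hS1, hS2, ?_, hS4⟩
    refine (separates_iff_active (D := {a} ∪ {c} ∪ S) hG
        (fun _ h => Or.inl (Or.inl h)) (fun _ h => Or.inr h) (disj hS1) (disj hS2)).mpr ?_
    rintro _ rfl _ rfl h
    exact hS3 _ rfl (reflTransGen_active_symm h)

end Separation

/-! ### Markov equivalent chain graphs have the same skeleton and the same triplexes -/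

section Measure

variable {Ω : Type*} {m m₁ m₂ mΩ : MeasurableSpace Ω} {μ : Measure Ω}

theorem condExp_indicator_eq_of_indep [IsProbabilityMeasure μ] (hm : m ≤ mΩ) (hm₁ : m₁ ≤ mΩ)
    (h : Indep m₁ m μ) {t : Set Ω} (ht : MeasurableSet[m₁] t) :
    μ⟦t | m⟧ =ᵐ[μ] fun _ => μ.real t := by
  have h1 : StronglyMeasurable[m₁] (t.indicator fun _ : Ω => (1 : ℝ)) :=
    (@stronglyMeasurable_const _ _ m₁ _ (1 : ℝ)).indicator ht
  have h2 := condExp_indep_eq hm₁ hm h1 h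
  rwa [integral_indicator_const (1 : ℝ) (hm₁ t ht), smul_eq_mul, mul_one] at h2

/-- Conditional independence holds given a σ-algebra of events that are independent of everything,
if the two σ-algebras are independent. -/
theorem condIndep_of_indep [StandardBorelSpace Ω] [IsProbabilityMeasure μ] (hm : m ≤ mΩ)
    (hm₁ : m₁ ≤ mΩ) (hm₂ : m₂ ≤ mΩ) (h : Indep mΩ m μ) (h₁₂ : Indep m₁ m₂ μ) :
    CondIndep m m₁ m₂ hm μ := by
  rw [condIndep_iff m m₁ m₂ hm hm₁ hm₂]
  intro t₁ t₂ ht₁ ht₂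
  filter_upwards [condExp_indicator_eq_of_indep hm le_rfl h (hm₁ t₁ ht₁),
    condExp_indicator_eq_of_indep hm le_rfl h (hm₂ t₂ ht₂),
    condExp_indicator_eq_of_indep hm le_rfl h ((hm₁ t₁ ht₁).inter (hm₂ t₂ ht₂))] with x h1 h2 h3
  rw [Pi.mul_apply, h1, h2, h3, measureReal_def, (Indep_iff m₁ m₂ μ).mp h₁₂ t₁ t₂ ht₁ ht₂,
    ENNReal.toReal_mul]
  rfl

/-- A σ-algebra of events that are independent of everything is conditionally independent of any
other. -/
theorem condIndep_of_indep_right [StandardBorelSpace Ω] [IsProbabilityMeasure μ] (hm : m ≤ mΩ)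
    (hm₁ : m₁ ≤ mΩ) (hm₂ : m₂ ≤ mΩ) (h : Indep mΩ m₂ μ) : CondIndep m m₁ m₂ hm μ := by
  rw [condIndep_iff m m₁ m₂ hm hm₁ hm₂]
  intro t₁ t₂ ht₁ ht₂
  -- Being independent of itself, `t₂` has probability 0 or 1, so its indicator is almost surely a
  -- constant.
  have hsq := (Indep_iff mΩ m₂ μ).mp h t₂ t₂ (hm₂ t₂ ht₂) ht₂
  rw [Set.inter_self] at hsq
  have hind : ∀ c : ℝ, (t₂.indicator (fun _ => (1 : ℝ)) =ᵐ[μ] fun _ => c) →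
      (μ⟦t₁ ∩ t₂ | m⟧) =ᵐ[μ] (μ⟦t₁ | m⟧) * (μ⟦t₂ | m⟧) := by
    intro c hc
    have h1 : (μ⟦t₂ | m⟧) =ᵐ[μ] fun _ => c := by
      have := condExp_congr_ae (m := m) hc
      rwa [condExp_const hm] at this
    have h2 : ((t₁ ∩ t₂).indicator fun _ => (1 : ℝ)) =ᵐ[μ]
        c • t₁.indicator fun _ => (1 : ℝ) := by
      filter_upwards [hc] with x hx
      rw [Pi.smul_apply, ← hx]
      by_cases h1 : x ∈ t₁ <;> by_cases h2 : x ∈ t₂ <;> simp [h1, h2]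
    filter_upwards [h1, condExp_congr_ae (m := m) h2, condExp_smul (μ := μ) c
      (t₁.indicator fun _ => (1 : ℝ)) m] with x h1 h2 h3
    rw [h2, h3, Pi.mul_apply, h1, Pi.smul_apply, smul_eq_mul, mul_comm]
  have h01 : μ t₂ = 0 ∨ μ t₂ᶜ = 0 := by
    by_cases h0 : μ t₂ = 0
    · exact Or.inl h0
    · right
      rw [prob_compl_eq_zero_iff (hm₂ t₂ ht₂)]
      exact (ENNReal.mul_left_inj h0 (measure_ne_top μ t₂)).mp (by rw [← hsq, one_mul])
  rcases h01 with h0 | h1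
  · refine hind 0 ?_
    filter_upwards [measure_eq_zero_iff_ae_notMem.mp h0] with x hx
    simp [hx]
  · refine hind 1 ?_
    filter_upwards [measure_eq_zero_iff_ae_notMem.mp h1] with x hx
    simp [Set.notMem_compl_iff.mp hx]

/-- The two conditional probabilities are constants, so integrating their product over `E`
factorizes. This is the numerical test that the coin distributions fail. -/
theorem measure_inter_of_condIndep [StandardBorelSpace Ω] [IsProbabilityMeasure μ] (hm : m ≤ mΩ)
    (hm₁ : m₁ ≤ mΩ) (hm₂ : m₂ ≤ mΩ) (h : CondIndep m m₁ m₂ hm μ) (h₁ : Indep m₁ m μ)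
    (h₂ : Indep m₂ m μ) {t₁ t₂ E : Set Ω} (ht₁ : MeasurableSet[m₁] t₁)
    (ht₂ : MeasurableSet[m₂] t₂) (hE : MeasurableSet[m] E) :
    μ.real (t₁ ∩ t₂ ∩ E) = μ.real t₁ * μ.real t₂ * μ.real E := by
  have h3 := (condIndep_iff m m₁ m₂ hm hm₁ hm₂ μ).mp h t₁ t₂ ht₁ ht₂
  have h4 : (μ⟦t₁ ∩ t₂ | m⟧) =ᵐ[μ] fun _ => μ.real t₁ * μ.real t₂ := by
    filter_upwards [h3, condExp_indicator_eq_of_indep hm hm₁ h₁ ht₁,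
      condExp_indicator_eq_of_indep hm hm₂ h₂ ht₂] with x h3 h5 h6
    rw [h3, Pi.mul_apply, h5, h6]
  have ht : MeasurableSet (t₁ ∩ t₂) := (hm₁ t₁ ht₁).inter (hm₂ t₂ ht₂)
  have h7 : ∫ x in E, (μ⟦t₁ ∩ t₂ | m⟧) x ∂μ =
      ∫ x in E, (t₁ ∩ t₂).indicator (fun _ => (1 : ℝ)) x ∂μ :=
    setIntegral_condExp hm ((integrable_const (1 : ℝ)).indicator ht) hE
  rw [setIntegral_congr_ae (hm E hE) (h4.mono fun x hx _ => hx), setIntegral_const,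
    integral_indicator_const (1 : ℝ) ht, smul_eq_mul, smul_eq_mul, mul_one,
    measureReal_restrict_apply ht] at h7
  rw [← h7, mul_comm]

end Measure

/-! ### Distributions generated by two fair coins. -/

section Coins

/-- The distribution of two independent fair coins. -/
noncomputable def coins : Measure (Bool × Bool) := (PMF.uniformOfFintype (Bool × Bool)).toMeasure

instance : IsProbabilityMeasure coins := by unfold coins; infer_instance

theorem coins_apply (s : Finset (Bool × Bool)) : coins s = (s.card : ENNReal) / 4 := by
  rw [coins, PMF.toMeasure_uniformOfFintype_apply _ (Set.toFinite _).measurableSet]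
  simp

/-- All four outcomes have mass 1/4, so independence is an identity between cardinalities, which a
finite check decides. -/
theorem indepFun_coins {φ ψ : Bool × Bool → Bool}
    (h : ∀ s t : Finset Bool, 4 * (Finset.univ.filter fun p => φ p ∈ s ∧ ψ p ∈ t).card =
      (Finset.univ.filter fun p => φ p ∈ s).card * (Finset.univ.filter fun p => ψ p ∈ t).card) :
    IndepFun φ ψ coins := by
  classical
  rw [indepFun_iff_measure_inter_preimage_eq_mul]
  intro s t _ _
  have h1 : φ ⁻¹' s ∩ ψ ⁻¹' t =
      ↑(Finset.univ.filter fun p => φ p ∈ s.toFinset ∧ ψ p ∈ t.toFinset) := by ext; simp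
  have h2 : φ ⁻¹' s = ↑(Finset.univ.filter fun p => φ p ∈ s.toFinset) := by ext; simp
  have h3 : ψ ⁻¹' t = ↑(Finset.univ.filter fun p => ψ p ∈ t.toFinset) := by ext; simp
  rw [h1, h2, h3, coins_apply, coins_apply, coins_apply]
  have h4 := h s.toFinset t.toFinset
  generalize (Finset.univ.filter fun p => φ p ∈ s.toFinset ∧ ψ p ∈ t.toFinset).card = n at *
  generalize (Finset.univ.filter fun p => φ p ∈ s.toFinset).card = k at *
  generalize (Finset.univ.filter fun p => ψ p ∈ t.toFinset).card = l at *
  have h5 : (4 : ENNReal) * n = k * l := by exact_mod_cast h4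
  rw [ENNReal.div_eq_inv_mul, ENNReal.div_eq_inv_mul, ENNReal.div_eq_inv_mul,
    mul_mul_mul_comm, ← h5, ← mul_assoc, mul_assoc (4⁻¹ : ENNReal),
    ENNReal.inv_mul_cancel (by norm_num) (by norm_num), mul_one]

theorem indepFun_fst_snd : IndepFun Prod.fst Prod.snd coins := indepFun_coins (by decide)

theorem indepFun_fst_xor : IndepFun Prod.fst (fun p => xor p.1 p.2) coins :=
  indepFun_coins (by decide)

theorem indepFun_snd_xor : IndepFun Prod.snd (fun p => xor p.1 p.2) coins :=
  indepFun_coins (by decide)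

variable (g : Bool × Bool → V → Bool) {A B : Set V}

theorem measurable_config : Measurable g := measurable_of_finite g

/-- The distribution of the configuration `g` of functions of two fair coins. -/
noncomputable def coinModel : ProbabilityMeasure (V → Bool) :=
  ⟨coins.map g, Measure.isProbabilityMeasure_map (measurable_config g).aemeasurable⟩

variable {g}

/-- An event whose occurrence is determined by the value of `φ` is a preimage under `φ`, and
likewise for `ψ`; independence of `φ` and `ψ` then transfers to the events. -/
theorem coinModel_inter {β γ : Type*} [MeasurableSpace β] [DiscreteMeasurableSpace β]
    [MeasurableSpace γ] [DiscreteMeasurableSpace γ] {φ : Bool × Bool → β} {ψ : Bool × Bool → γ}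
    (h : IndepFun φ ψ coins) {t₁ t₂ : Set (V → Bool)} (ht₁ : MeasurableSet t₁)
    (ht₂ : MeasurableSet t₂) (h₁ : ∀ p q, φ p = φ q → g p ∈ t₁ → g q ∈ t₁)
    (h₂ : ∀ p q, ψ p = ψ q → g p ∈ t₂ → g q ∈ t₂) :
    (coinModel g : Measure (V → Bool)) (t₁ ∩ t₂) =
      (coinModel g : Measure (V → Bool)) t₁ * (coinModel g : Measure (V → Bool)) t₂ := by
  have e₁ : g ⁻¹' t₁ = φ ⁻¹' (φ '' (g ⁻¹' t₁)) := by
    ext q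
    refine ⟨fun hq => ⟨q, hq, rfl⟩, ?_⟩
    rintro ⟨p, hp, hpq⟩
    exact h₁ p q hpq hp
  have e₂ : g ⁻¹' t₂ = ψ ⁻¹' (ψ '' (g ⁻¹' t₂)) := by
    ext q
    refine ⟨fun hq => ⟨q, hq, rfl⟩, ?_⟩
    rintro ⟨p, hp, hpq⟩
    exact h₂ p q hpq hp
  have hg := measurable_config g
  change coins.map g (t₁ ∩ t₂) = coins.map g t₁ * coins.map g t₂
  rw [Measure.map_apply hg (ht₁.inter ht₂), Measure.map_apply hg ht₁, Measure.map_apply hg ht₂,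
    Set.preimage_inter, e₁, e₂]
  exact h.measure_inter_preimage_eq_mul _ _ (MeasurableSet.of_discrete) (MeasurableSet.of_discrete)

theorem mem_of_coordSigma {x y : V → Bool} {t : Set (V → Bool)}
    (ht : MeasurableSet[coordSigma (fun _ : V => Bool) A] t) (h : ∀ v ∈ A, x v = y v) (hx : x ∈ t) :
    y ∈ t := by
  obtain ⟨s, -, rfl⟩ := ht
  have : A.domRestrict x = A.domRestrict y := funext fun v => h v v.2
  rwa [Set.mem_preimage, ← this]

theorem measurableSet_coord {v : V} (hv : v ∈ A) (e : Bool) :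
    MeasurableSet[coordSigma (fun _ : V => Bool) A] {x | x v = e} :=
  ⟨(fun y : ∀ _ : A, Bool => y ⟨v, hv⟩) ⁻¹' {e},
    (measurable_pi_apply (⟨v, hv⟩ : A)) (measurableSet_singleton e), rfl⟩

theorem indep_coordSigma {φ ψ : Bool × Bool → Bool} (h : IndepFun φ ψ coins)
    (hA : ∀ p q, φ p = φ q → ∀ v ∈ A, g p v = g q v)
    (hB : ∀ p q, ψ p = ψ q → ∀ v ∈ B, g p v = g q v) :
    Indep (coordSigma (fun _ : V => Bool) A) (coordSigma (fun _ : V => Bool) B)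
      (coinModel g : Measure (V → Bool)) :=
  (Indep_iff _ _ _).mpr fun _ _ ht₁ ht₂ => coinModel_inter h (coordSigma_le _ A _ ht₁)
    (coordSigma_le _ B _ ht₂) (fun p q hpq => mem_of_coordSigma ht₁ (hA p q hpq))
    (fun p q hpq => mem_of_coordSigma ht₂ (hB p q hpq))

theorem indep_coordSigma_of_const (hB : ∀ p q, ∀ v ∈ B, g p v = g q v) :
    Indep MeasurableSpace.pi (coordSigma (fun _ : V => Bool) B)
      (coinModel g : Measure (V → Bool)) :=
  -- A block that ignores the coins is a function of a one-point map, which is independent of the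
  -- identity.
  (Indep_iff _ _ _).mpr fun t _ ht₁ ht₂ => coinModel_inter (indepFun_const_right id ()) ht₁
    (coordSigma_le _ B _ ht₂) (fun _ _ hpq => congrArg (g · ∈ t) hpq |>.mp)
    (fun p q _ => mem_of_coordSigma ht₂ (hB p q))

theorem coinModel_real {t : Set (V → Bool)} (ht : MeasurableSet t) (s : Finset (Bool × Bool))
    (hs : ∀ p, g p ∈ t ↔ p ∈ s) :
    (coinModel g : Measure (V → Bool)).real t = (s.card : ℝ) / 4 := by
  have : g ⁻¹' t = s := by ext p; exact hs p
  change ((coins.map g) t).toReal = _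
  rw [Measure.map_apply (measurable_config g) ht, this, coins_apply]
  simp

end Coins

/-! ### Coin distributions that detect edges and triplexes. -/

section Characterization

variable {G H : MixedGraph V} {a b c x y : V} {A B D S : Set V}

theorem augmented_adj_of_adj (hG : G.IsChainGraph) (hx : x ∈ D) (hy : y ∈ D) (h : G.Adj x y) :
    (G.extended D).augmented.Adj x y := by
  rcases adj_iff.mp h with h | h | h
  · exact augmented_adj_of_touches hG h.ne (Or.inl rfl) (Or.inl rfl) (Or.inr h)
      (subset_Co (subset_An hy))
  · exact augmented_adj_of_touches hG h.ne (Or.inr ⟨h, subset_An hy⟩) (Or.inl rfl) (Or.inl rfl)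
      (subset_Co (subset_An hy))
  · exact augmented_adj_of_touches hG h.ne.symm (Or.inl rfl) (Or.inr ⟨h, subset_An hx⟩)
      (Or.inl rfl) (subset_Co (subset_An hx))

theorem IsTriplex.augmented_adj (hG : G.IsChainGraph) (hb : b ∈ D) (hc : c ∈ D)
    (hac : a ≠ c) (h : G.IsTriplex a b c) : (G.extended D).augmented.Adj a c := by
  rcases h with h | h | h
  · exact augmented_adj_of_touches hG hac (Or.inr ⟨h.1, subset_An hb⟩) (Or.inl rfl)
      (Or.inr h.2.1) (subset_Co (subset_An hc))
  · exact augmented_adj_of_touches hG hac (Or.inl rfl) (Or.inr ⟨h.1, subset_An hb⟩)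
      (Or.inr h.2.1.symm) (subset_Co (subset_An hb))
  · exact augmented_adj_of_touches hG hac (Or.inr ⟨h.2.1, subset_An hb⟩)
      (Or.inr ⟨h.2.2.1, subset_An hb⟩) (Or.inl rfl) (subset_Co (subset_An hb))

theorem not_augmented_adj_of_separates {K : SimpleGraph V} (h : Separates K A B S)
    (hAS : Disjoint A S) (hBS : Disjoint B S) (hx : x ∈ A) (hy : y ∈ B) : ¬ K.Adj x y := by
  intro hadj
  obtain ⟨s, hs, hs'⟩ := h x hx y hy (.cons hadj .nil)
  simp only [SimpleGraph.Walk.support_cons, SimpleGraph.Walk.support_nil, List.mem_cons,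
    List.not_mem_nil, or_false] at hs'
  rcases hs' with rfl | rfl
  · exact Set.disjoint_left.mp hAS hx hs
  · exact Set.disjoint_left.mp hBS hy hs

theorem condIndep_coinModel_of_const [Finite V] {g : Bool × Bool → V → Bool}
    (h : (∀ p q, ∀ v ∈ A, g p v = g q v) ∨ (∀ p q, ∀ v ∈ B, g p v = g q v)) :
    CondIndep (coordSigma (fun _ : V => Bool) S) (coordSigma (fun _ : V => Bool) A)
      (coordSigma (fun _ : V => Bool) B) (coordSigma_le _ S)
      (coinModel g : Measure (V → Bool)) := by
  rcases h with h | h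
  · exact (condIndep_of_indep_right (coordSigma_le _ S) (coordSigma_le _ B) (coordSigma_le _ A)
      (indep_coordSigma_of_const h)).symm
  · exact condIndep_of_indep_right (coordSigma_le _ S) (coordSigma_le _ A) (coordSigma_le _ B)
      (indep_coordSigma_of_const h)

/-- Let `a` and `b` show the same coin and all other vertices be constant. If `a, b` are adjacent,
separated sets never contain one of them each, so one block is constant and the Markov property
holds. If they are nonadjacent in `H`, they are separated by a set of constant vertices and would
have to be independent. -/
theorem MarkovEquiv.adj [Finite V] (hG : G.IsChainGraph) (hH : H.IsChainGraph) (h : MarkovEquiv G H)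
    (hab : G.Adj a b) : H.Adj a b := by
  classical
  by_contra hH'
  have hne : a ≠ b := by
    rintro rfl
    exact hab.elim (G.irrefl a) (G.irrefl a)
  let g : Bool × Bool → V → Bool := fun p v => if v = a ∨ v = b then p.1 else false
  have hmem : coinModel g ∈ G.ampModel fun _ => Bool := by
    intro A B S hAB hAS hBS hsep
    have hn : ∀ {x y}, x ∈ A → y ∈ B → ¬ G.Adj x y := fun hx hy hadj =>
      not_augmented_adj_of_separates hsep hAS hBS hx hy
        (augmented_adj_of_adj hG (Or.inl (Or.inl hx)) (Or.inl (Or.inr hy)) hadj)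
    have hd : ∀ {x}, x ∈ A → x ∉ B := fun hx => Set.disjoint_left.mp hAB hx
    have hconst : ∀ {C : Set V}, a ∉ C → b ∉ C → ∀ p q, ∀ v ∈ C, g p v = g q v := by
      intro C ha hb p q v hv
      have : ¬ (v = a ∨ v = b) := by rintro (rfl | rfl) <;> contradiction
      simp only [g, if_neg this]
    refine condIndep_coinModel_of_const ?_
    by_cases haA : a ∈ A
    · exact Or.inr (hconst (hd haA) fun hb => hn haA hb hab)
    by_cases hbA : b ∈ A
    · exact Or.inr (hconst (fun ha => hn hbA ha hab.symm) (hd hbA))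
    exact Or.inl (hconst haA hbA)
  rw [h fun _ => Bool] at hmem
  obtain ⟨S, ha, hb, hsep, -⟩ := exists_separating_set hH hne hH'
  have hci := hmem {a} {b} S (by simpa using hne) (by simpa using ha) (by simpa using hb) hsep
  have htriv : ∀ C, Indep (coordSigma (fun _ : V => Bool) C) (coordSigma (fun _ : V => Bool) S)
      (coinModel g : Measure (V → Bool)) := by
    intro C
    refine indep_of_indep_of_le_left (indep_coordSigma_of_const ?_) (coordSigma_le _ C)
    intro p q v hv
    have : ¬ (v = a ∨ v = b) := by rintro (rfl | rfl) <;> contradiction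
    simp only [g, if_neg this]
  have m₁ := measurableSet_coord (A := {a}) rfl true
  have m₂ := measurableSet_coord (A := {b}) rfl true
  have key := measure_inter_of_condIndep (coordSigma_le _ S) (coordSigma_le _ _)
    (coordSigma_le _ _) hci (htriv _) (htriv _) m₁ m₂ MeasurableSet.univ
  have n₁ := coordSigma_le _ _ _ m₁
  have n₂ := coordSigma_le _ _ _ m₂
  -- Both events say that the first coin shows `true`, so the product formula would read 1/2 = 1/4.
  rw [Set.inter_univ, coinModel_real (n₁.inter n₂) {(true, true), (true, false)},
    coinModel_real n₁ {(true, true), (true, false)},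
    coinModel_real n₂ {(true, true), (true, false)}, probReal_univ] at key
  · norm_num at key
  all_goals
    rintro ⟨p, q⟩
    revert p q
    simp [g]

/-- Let `a` and `c` show independent coins and `b` their exclusive or. In `G` the triplex forces `b`
out of any set separating `a` from `c`, which suits the distribution because `a` and `c` are
independent. If `H` lacks the triplex, some separating set contains `b`, but given `b` the coins at
`a` and `c` determine each other. -/
theorem MarkovEquiv.isTriplex [Finite V] (hG : G.IsChainGraph) (hH : H.IsChainGraph)
    (h : MarkovEquiv G H) (ht : G.IsTriplex a b c) : H.IsTriplex a b c := by
  classical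
  by_contra hH'
  have hac : a ≠ c := by
    rintro rfl
    rcases ht with h | h | h
    · exact h.1.2 h.2.1.1
    · exact h.1.2 h.2.1.1
    · exact h.1 rfl
  have hnadj : ¬ G.Adj a c := by
    rcases ht with h | h | h
    · exact h.2.2
    · exact fun h' => h.2.2 h'.symm
    · exact h.2.2.2
  have hab : G.Adj a b := by
    rcases ht with h | h | h
    · exact h.1.adj
    · exact h.2.1.adj.symm
    · exact h.2.1.adj
  have hcb : G.Adj c b := by
    rcases ht with h | h | h
    · exact h.2.1.adj.symm
    · exact h.1.adj
    · exact h.2.2.1.adj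
  have hab' : a ≠ b := by
    rintro rfl
    exact hab.elim (G.irrefl _) (G.irrefl _)
  have hcb' : c ≠ b := by
    rintro rfl
    exact hcb.elim (G.irrefl _) (G.irrefl _)
  let g : Bool × Bool → V → Bool := fun p v =>
    if v = a then p.1 else if v = c then p.2 else if v = b then xor p.1 p.2 else false
  have gconst : ∀ {v}, v ≠ a → v ≠ b → v ≠ c → ∀ p, g p v = false := by
    intro v h1 h2 h3 p
    simp [g, h1, h2, h3]
  have ga : ∀ p, g p a = p.1 := fun p => by simp [g]
  have gc : ∀ p, g p c = p.2 := fun p => by simp [g, hac.symm]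
  have gb : ∀ p, g p b = xor p.1 p.2 := fun p => by simp [g, hab'.symm, hcb'.symm]
  have facA : ∀ {C : Set V}, b ∉ C → c ∉ C → ∀ p q : Bool × Bool, p.1 = q.1 →
      ∀ v ∈ C, g p v = g q v := by
    intro C hb hc p q hpq v hv
    by_cases hva : v = a
    · rw [hva, ga, ga, hpq]
    · rw [gconst hva (fun e => hb (e ▸ hv)) (fun e => hc (e ▸ hv)),
        gconst hva (fun e => hb (e ▸ hv)) (fun e => hc (e ▸ hv))]
  have facC : ∀ {C : Set V}, b ∉ C → a ∉ C → ∀ p q : Bool × Bool, p.2 = q.2 →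
      ∀ v ∈ C, g p v = g q v := by
    intro C hb ha p q hpq v hv
    by_cases hvc : v = c
    · rw [hvc, gc, gc, hpq]
    · rw [gconst (fun e => ha (e ▸ hv)) (fun e => hb (e ▸ hv)) hvc,
        gconst (fun e => ha (e ▸ hv)) (fun e => hb (e ▸ hv)) hvc]
  have facB : ∀ {C : Set V}, a ∉ C → c ∉ C → ∀ p q : Bool × Bool, xor p.1 p.2 = xor q.1 q.2 →
      ∀ v ∈ C, g p v = g q v := by
    intro C ha hc p q hpq v hv
    by_cases hvb : v = b
    · rw [hvb, gb, gb, hpq]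
    · rw [gconst (fun e => ha (e ▸ hv)) hvb (fun e => hc (e ▸ hv)),
        gconst (fun e => ha (e ▸ hv)) hvb (fun e => hc (e ▸ hv))]
  have fac : ∀ {C : Set V}, a ∉ C → b ∉ C → c ∉ C → ∀ p q, ∀ v ∈ C, g p v = g q v := by
    intro C ha hb hc p q v hv
    rw [gconst (fun e => ha (e ▸ hv)) (fun e => hb (e ▸ hv)) (fun e => hc (e ▸ hv)),
      gconst (fun e => ha (e ▸ hv)) (fun e => hb (e ▸ hv)) (fun e => hc (e ▸ hv))]
  have hmem : coinModel g ∈ G.ampModel fun _ => Bool := by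
    intro A B S hAB hAS hBS hsep
    have hn : ∀ {x y}, x ∈ A → y ∈ B → ¬ G.Adj x y := fun hx hy hadj =>
      not_augmented_adj_of_separates hsep hAS hBS hx hy
        (augmented_adj_of_adj hG (Or.inl (Or.inl hx)) (Or.inl (Or.inr hy)) hadj)
    have hd : ∀ {x}, x ∈ A → x ∉ B := fun hx => Set.disjoint_left.mp hAB hx
    have hdS : ∀ {x}, x ∈ A → x ∉ S := fun hx => Set.disjoint_left.mp hAS hx
    have hdS' : ∀ {x}, x ∈ B → x ∉ S := fun hx => Set.disjoint_left.mp hBS hx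
    by_cases hbA : b ∈ A
    · exact condIndep_coinModel_of_const (Or.inr (fac (fun ha => hn hbA ha hab.symm) (hd hbA)
        fun hc => hn hbA hc hcb.symm))
    by_cases hbB : b ∈ B
    · exact condIndep_coinModel_of_const (Or.inl (fac (fun ha => hn ha hbB hab) hbA
        fun hc => hn hc hbB hcb))
    have cross : ∀ {x y}, x ∈ A → y ∈ B → x ≠ y → G.IsTriplex x b y → b ∉ S :=
      fun hx hy hxy hT hb => not_augmented_adj_of_separates hsep hAS hBS hx hy
        (hT.augmented_adj hG (Or.inr hb) (Or.inl (Or.inr hy)) hxy)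
    by_cases haA : a ∈ A
    · by_cases hcB : c ∈ B
      · refine condIndep_of_indep (coordSigma_le _ S) (coordSigma_le _ A) (coordSigma_le _ B)
          (indep_coordSigma_of_const (fac (hdS haA) (cross haA hcB hac ht) (hdS' hcB))) ?_
        exact indep_coordSigma indepFun_fst_snd (facA hbA fun h => hd h hcB) (facC hbB (hd haA))
      · exact condIndep_coinModel_of_const (Or.inr (fac (hd haA) hbB hcB))
    by_cases hcA : c ∈ A
    · by_cases haB : a ∈ B
      · refine condIndep_of_indep (coordSigma_le _ S) (coordSigma_le _ A) (coordSigma_le _ B)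
          (indep_coordSigma_of_const (fac (hdS' haB) (cross hcA haB hac.symm ht.symm)
            (hdS hcA))) ?_
        exact indep_coordSigma indepFun_fst_snd.symm (facC hbA haA) (facA hbB (hd hcA))
      · exact condIndep_coinModel_of_const (Or.inr (fac haB hbB (hd hcA)))
    exact condIndep_coinModel_of_const (Or.inl (fac haA hbA hcA))
  have hnadj' : ¬ H.Adj a c := fun h' => hnadj (MarkovEquiv.adj hH hG (fun X _ _ => (h X).symm) h')
  obtain ⟨S, ha, hc, hsep, hS⟩ := exists_separating_set hH hac hnadj'
  have hbS : b ∈ S := hS b (h.adj hG hH hab) (h.adj hG hH hcb).symm hH'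
  rw [h fun _ => Bool] at hmem
  have hci := hmem {a} {c} S (by simpa using hac) (by simpa using ha) (by simpa using hc) hsep
  have m₁ := measurableSet_coord (A := {a}) rfl true
  have m₂ := measurableSet_coord (A := {c}) rfl true
  have m₃ := measurableSet_coord hbS false
  have key := measure_inter_of_condIndep (coordSigma_le _ S) (coordSigma_le _ _)
    (coordSigma_le _ _) hci
    (indep_coordSigma indepFun_fst_xor (facA hab'.symm hac.symm) (facB ha hc))
    (indep_coordSigma indepFun_snd_xor (facC hcb'.symm hac) (facB ha hc)) m₁ m₂ m₃
  have n₁ := coordSigma_le _ _ _ m₁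
  have n₂ := coordSigma_le _ _ _ m₂
  have n₃ := coordSigma_le _ _ _ m₃
  -- The outcome `a = c = true`, `b = false` has probability 1/4, against 1/8 from the product
  -- formula.
  rw [coinModel_real ((n₁.inter n₂).inter n₃) {(true, true)},
    coinModel_real n₁ {(true, true), (true, false)},
    coinModel_real n₂ {(true, true), (false, true)},
    coinModel_real n₃ {(true, true), (false, false)}] at key
  · norm_num at key
  all_goals
    rintro ⟨p, q⟩
    simp only [Set.mem_inter_iff, Set.mem_ofPred_eq, ga, gb, gc]
    revert p q
    decide

end Characterization

/-! ### Splitting a chain component -/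

section Split

variable {G : MixedGraph V} {κ : Set V} {a b k k' p x y v w : V} {D S N : Set V}

/-- The graph obtained by directing every line between `κ` and its complement into `κ`. -/
def split (G : MixedGraph V) (κ : Set V) : MixedGraph V where
  Edge x y := G.Edge x y ∧ ¬ (x ∈ κ ∧ y ∉ κ ∧ G.Edge y x)
  irrefl a h := G.irrefl a h.1

/-- The conditions under which directing the lines between `κ` and its complement into `κ` creates
and destroys no triplex. -/
structure IsSplittable (G : MixedGraph V) (κ : Set V) : Prop where
  connected : ∀ x ∈ κ, ∀ y ∈ κ, Relation.ReflTransGen (fun u v => G.Line u v ∧ v ∈ κ) x y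
  covers : ∀ a k k', a ∉ κ → k ∈ κ → k' ∈ κ → G.Line a k → G.Line a k'
  complete : ∀ a b k, a ∉ κ → b ∉ κ → k ∈ κ → G.Line a k → G.Line b k → a ≠ b → G.Line a b
  parents : ∀ p a k, a ∉ κ → k ∈ κ → G.Line a k → G.Arrow p a → G.Arrow p k

theorem split_line : (G.split κ).Line x y ↔ G.Line x y ∧ (x ∈ κ ↔ y ∈ κ) := by
  simp only [Line, split]; tauto

theorem split_arrow :
    (G.split κ).Arrow x y ↔ G.Arrow x y ∨ (G.Line x y ∧ x ∉ κ ∧ y ∈ κ) := by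
  simp only [Line, Arrow, split]; tauto

/-- For a new arrow `x → y`, a walk from `y` back to `x` would stay in the chain component of `x`
and `y`; but inside it no edge of the split graph leads out of `κ`. -/
theorem IsChainGraph.split (hG : G.IsChainGraph) (κ : Set V) : (G.split κ).IsChainGraph := by
  refine isChainGraph_of_not_reach fun x y hxy hyx => ?_
  have toG : ∀ {u v}, (G.split κ).Reach u v → G.Reach u v := fun h =>
    Relation.ReflTransGen.mono (fun _ _ h => h.1) _ _ h
  rcases split_arrow.mp hxy with h | ⟨h, hx, hy⟩
  · exact hG.not_reach h (toG hyx)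
  · have inv : ∀ u, (G.split κ).Reach y u → G.Reach u x → u ∈ κ := by
      intro u hu
      induction hu with
      | refl => exact fun _ => hy
      | @tail u w hyu huw ih =>
        intro hwx
        have huG : G.Reach u w := Relation.ReflTransGen.single huw.1
        by_contra hw
        have hwu : G.Reach w u := hwx.trans (h.reach.trans (toG hyu))
        have := hG.line_of_adj (Or.inl huw.1) huG hwu
        exact huw.2 ⟨ih (huG.trans hwx), hw, this.2⟩
    exact hx (inv x hyx (Reach.refl x))

theorem An_subset_An_split : G.An D ⊆ (G.split κ).An D := by
  rintro v ⟨d, hd, h⟩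
  exact ⟨d, hd, Relation.ReflTransGen.mono (fun _ _ h => split_arrow.mpr (Or.inl h)) _ _ h⟩

/-- New ancestors arise only through a new arrow into `κ`. Climbing on from its tail adds nothing,
since the parents of the tail are already parents of the members of `κ`. -/
theorem IsSplittable.mem_An_split (hs : G.IsSplittable κ) (hv : v ∈ (G.split κ).An D) :
    v ∈ G.An D ∨ (v ∉ κ ∧ ∃ k ∈ κ, k ∈ G.An D ∧ G.Line v k) := by
  obtain ⟨d, hd, h⟩ := hv
  induction h using Relation.ReflTransGen.head_induction_on with
  | refl => exact Or.inl (subset_An hd)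
  | @head v w hvw _ ih =>
    rcases ih with ih | ⟨hw, k, hk, hkN, hwk⟩
    · rcases split_arrow.mp hvw with h | ⟨h, hv, hw⟩
      · exact Or.inl (mem_An_of_arrow h ih)
      · exact Or.inr ⟨hv, w, hw, ih, h⟩
    · rcases split_arrow.mp hvw with h | ⟨-, -, h⟩
      · exact Or.inl (mem_An_of_arrow (hs.parents v w k hw hk hwk h) hkN)
      · exact absurd h hw

theorem Open.split (h : G.Open S v) : (G.split κ).Open S v :=
  h.imp id fun ⟨p, hp, h⟩ => ⟨p, hp, split_arrow.mpr (Or.inl h)⟩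

theorem open_of_split (h : (G.split κ).Open S v) (hv : v ∉ κ) : G.Open S v :=
  h.imp id fun ⟨p, hp, h⟩ => ⟨p, hp, (split_arrow.mp h).resolve_right fun h => hv h.2.2⟩

theorem reflTransGen_of_map {α : Type*} {r s : α → α → Prop} (f : α → α)
    (h : ∀ u v, r u v → Relation.ReflTransGen s (f u) (f v)) {a b : α}
    (hab : Relation.ReflTransGen r a b) : Relation.ReflTransGen s (f a) (f b) := by
  induction hab with
  | refl => exact .refl
  | tail _ hbc ih => exact ih.trans (h _ _ hbc)

/-- Only lines across the border of `κ` need rerouting. If `κ` meets the ancestral set, go through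
an ancestral member of `κ`; if not, the walk starts and ends outside `κ` and its excursions into `κ`
can be short-circuited. -/
theorem IsSplittable.active_split (hs : G.IsSplittable κ) (hSD : S ⊆ D) (ha : a ∈ D) (hb : b ∈ D)
    (h : Relation.ReflTransGen (G.Active (G.An D) S) a b) :
    Relation.ReflTransGen ((G.split κ).Active ((G.split κ).An D) S) a b := by
  classical
  have lin : ∀ {u v}, G.Open S u → G.Open S v → G.Line u v → (u ∈ κ ↔ v ∈ κ) →
      (G.split κ).Active ((G.split κ).An D) S u v := fun h1 h2 h3 h4 =>
    ⟨h1.split, h2.split, Or.inl (split_line.mpr ⟨h3, h4⟩)⟩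
  have arr : ∀ {u v}, G.Open S u → G.Open S v →
      ((G.Arrow u v ∧ u ∉ S ∧ v ∈ G.An D) ∨ (G.Arrow v u ∧ v ∉ S ∧ u ∈ G.An D)) →
      (G.split κ).Active ((G.split κ).An D) S u v := fun h1 h2 h3 =>
    ⟨h1.split, h2.split, Or.inr (h3.imp
      (fun h => ⟨split_arrow.mpr (Or.inl h.1), h.2.1, An_subset_An_split h.2.2⟩)
      (fun h => ⟨split_arrow.mpr (Or.inl h.1), h.2.1, An_subset_An_split h.2.2⟩))⟩
  by_cases hit : ∃ k ∈ κ, k ∈ G.An D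
  · obtain ⟨k₀, hk₀, hk₀N⟩ := hit
    -- A common parent outside `S` opens all of `κ`, so one can enter at the ancestral vertex `k₀`
    -- and walk to `v` along lines inside `κ`.
    have fan : ∀ {x v}, x ∉ S → (∀ k ∈ κ, (G.split κ).Arrow x k) → v ∈ κ →
        Relation.ReflTransGen ((G.split κ).Active ((G.split κ).An D) S) x v := by
      intro x v hx hxk hv
      have ho : ∀ k ∈ κ, (G.split κ).Open S k := fun k hk => Or.inr ⟨x, hx, hxk k hk⟩
      refine .head ⟨Or.inl hx, ho k₀ hk₀,
        Or.inr (Or.inl ⟨hxk k₀ hk₀, hx, An_subset_An_split hk₀N⟩)⟩ ?_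
      have := hs.connected k₀ hk₀ v hv
      clear hv
      have hmem : ∀ w, Relation.ReflTransGen (fun u v => G.Line u v ∧ v ∈ κ) k₀ w → w ∈ κ := by
        intro w hw
        cases hw with
        | refl => exact hk₀
        | tail _ h => exact h.2
      induction this with
      | refl => exact .refl
      | @tail u w h1 h2 ih =>
        exact ih.tail ⟨ho u (hmem u h1), ho w h2.2,
          Or.inl (split_line.mpr ⟨h2.1, by simp [hmem u h1, h2.2]⟩)⟩
    have cross : ∀ {u v}, G.Open S u → u ∉ κ → v ∈ κ → G.Line u v →
        Relation.ReflTransGen ((G.split κ).Active ((G.split κ).An D) S) u v := by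
      intro u v hu huκ hv hl
      by_cases huS : u ∈ S
      · obtain ⟨p, hp, hpu⟩ := hu.resolve_left (fun h => h huS)
        have hpk : ∀ k ∈ κ, G.Arrow p k := fun k hk =>
          hs.parents p u k huκ hk (hs.covers u v k huκ hv hk hl) hpu
        refine .head (arr hu (Or.inl hp) (Or.inr ⟨hpu, hp, subset_An (hSD huS)⟩)) ?_
        exact fan hp (fun k hk => split_arrow.mpr (Or.inl (hpk k hk))) hv
      · exact fan huS (fun k hk => split_arrow.mpr
          (Or.inr ⟨hs.covers u v k huκ hv hk hl, huκ, hk⟩)) hv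
    refine reflTransGen_of_map id (fun u v huv => ?_) h
    rcases huv with ⟨hu, hv, hl | ha⟩
    · by_cases huκ : u ∈ κ <;> by_cases hvκ : v ∈ κ
      · exact .single (lin hu hv hl (by simp [huκ, hvκ]))
      · exact reflTransGen_active_symm (cross hv hvκ huκ hl.symm)
      · exact cross hu huκ hvκ hl
      · exact .single (lin hu hv hl (by simp [huκ, hvκ]))
    · exact .single (arr hu hv ha)
  · push Not at hit
    have hN : ∀ {v}, v ∈ G.An D → v ∉ κ := fun h h' => hit _ h' h
    by_cases hopen : ∃ a₁, a₁ ∉ κ ∧ G.Open S a₁ ∧ ∃ k ∈ κ, G.Line a₁ k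
    · obtain ⟨a₁, ha₁, ho, k₁, hk₁, hak₁⟩ := hopen
      -- All excursions into `κ` are contracted to the open border neighbour `a₁`, which is joined
      -- by a line to every other border neighbour.
      have cross : ∀ {u v}, G.Open S u → u ∉ κ → v ∈ κ → G.Line u v →
          Relation.ReflTransGen ((G.split κ).Active ((G.split κ).An D) S) u a₁ := by
        intro u v hu huκ hv hl
        by_cases he : u = a₁
        · exact he ▸ .refl
        · exact .single (lin hu ho (hs.complete u a₁ v huκ ha₁ hv hl
            (hs.covers a₁ k₁ v ha₁ hk₁ hv hak₁) he) (by simp [huκ, ha₁]))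
      have := reflTransGen_of_map (s := (G.split κ).Active ((G.split κ).An D) S)
        (fun v => if v ∈ κ then a₁ else v) (fun u v huv => ?_) h
      · simpa [hN (subset_An ha), hN (subset_An hb)] using this
      · rcases huv with ⟨hu, hv, hl | ha⟩
        · by_cases huκ : u ∈ κ <;> by_cases hvκ : v ∈ κ <;> simp only [huκ, hvκ, if_true, if_false]
          · exact .refl
          · exact reflTransGen_active_symm (cross hv hvκ huκ hl.symm)
          · exact cross hu huκ hvκ hl
          · exact .single (lin hu hv hl (by simp [huκ, hvκ]))
        · have huκ : u ∉ κ := by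
            rcases ha with ⟨h1, -, h2⟩ | ⟨-, -, h2⟩
            · exact hN (mem_An_of_arrow h1 h2)
            · exact hN h2
          have hvκ : v ∉ κ := by
            rcases ha with ⟨-, -, h2⟩ | ⟨h1, -, h2⟩
            · exact hN h2
            · exact hN (mem_An_of_arrow h1 h2)
          simp only [huκ, hvκ, if_false]
          exact .single (arr hu hv ha)
    -- No border neighbour is open, so an active walk never crosses the border of `κ` along a line.
    · push Not at hopen
      refine reflTransGen_of_map id (fun u v huv => ?_) h
      rcases huv with ⟨hu, hv, hl | ha⟩
      · by_cases huκ : u ∈ κ <;> by_cases hvκ : v ∈ κ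
        · exact .single (lin hu hv hl (by simp [huκ, hvκ]))
        · exact absurd hl.symm (hopen v hvκ hv u huκ)
        · exact absurd hl (hopen u huκ hu v hvκ)
        · exact .single (lin hu hv hl (by simp [huκ, hvκ]))
      · exact .single (arr hu hv ha)

/-- Trouble comes only from new arrows that are usable, and these require both an ancestral member
of `κ` and a border neighbour `a₀` outside `S`. Such an `a₀` is joined to all of `κ` and to all
border neighbours, so `κ` can be collapsed onto it. -/
theorem IsSplittable.active_of_split (hs : G.IsSplittable κ) (hSD : S ⊆ D) (ha : a ∉ S)
    (hb : b ∉ S) (h : Relation.ReflTransGen ((G.split κ).Active ((G.split κ).An D) S) a b) :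
    Relation.ReflTransGen (G.Active (G.An D) S) a b := by
  classical
  by_cases hcase : (∃ k ∈ κ, k ∈ G.An D) ∧ ∃ a₀, a₀ ∉ κ ∧ a₀ ∉ S ∧ ∃ k ∈ κ, G.Line a₀ k
  · obtain ⟨⟨k₀, hk₀, hk₀N⟩, a₀, ha₀, ha₀S, k₁, hk₁, hl₁⟩ := hcase
    have hcov : ∀ k ∈ κ, G.Line a₀ k := fun k hk => hs.covers a₀ k₁ k ha₀ hk₁ hk hl₁
    have toκ : ∀ {k}, k ∈ κ → G.Open S k → G.Active (G.An D) S k a₀ := fun hk ho =>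
      ⟨ho, Or.inl ha₀S, Or.inl (hcov _ hk).symm⟩
    have toα : ∀ {u k}, u ∉ κ → k ∈ κ → G.Open S u → G.Line u k →
        Relation.ReflTransGen (G.Active (G.An D) S) u a₀ := by
      intro u k hu hk ho hl
      by_cases he : u = a₀
      · exact he ▸ .refl
      · exact .single ⟨ho, Or.inl ha₀S, Or.inl (hs.complete u a₀ k hu ha₀ hk hl (hcov k hk) he)⟩
    let f : V → V := fun v => if v ∈ κ then a₀ else v
    have arrow : ∀ {u v}, (G.split κ).Arrow u v → u ∉ S → v ∈ (G.split κ).An D →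
        Relation.ReflTransGen (G.Active (G.An D) S) (f u) (f v) := by
      intro u v huv huS hvN
      rcases split_arrow.mp huv with h | ⟨h, huκ, hvκ⟩
      · have huo : G.Open S u := Or.inl huS
        have hvo : G.Open S v := Or.inr ⟨u, huS, h⟩
        have hfu : Relation.ReflTransGen (G.Active (G.An D) S) (f u) u := by
          by_cases hu : u ∈ κ
          · simp only [f, hu, if_true]
            exact .single (toκ hu huo).symm
          · simp only [f, hu, if_false]
            exact .refl
        have hfv : Relation.ReflTransGen (G.Active (G.An D) S) v (f v) := by
          by_cases hv : v ∈ κ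
          · simp only [f, hv, if_true]
            exact .single (toκ hv hvo)
          · simp only [f, hv, if_false]
            exact .refl
        rcases hs.mem_An_split hvN with hv | ⟨hv, k, hk, hkN, hvk⟩
        · exact hfu.trans (.head ⟨huo, hvo, Or.inr (Or.inl ⟨h, huS, hv⟩)⟩ hfv)
        · have huk := hs.parents u v k hv hk hvk h
          have hko : G.Open S k := Or.inr ⟨u, huS, huk⟩
          refine hfu.trans (.head ⟨huo, hko, Or.inr (Or.inl ⟨huk, huS, hkN⟩)⟩ ?_)
          exact .head (toκ hk hko) ((reflTransGen_active_symm (toα hv hk hvo hvk)).trans hfv)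
      · simp only [f, huκ, hvκ, if_true, if_false]
        exact toα huκ hvκ (Or.inl huS) h
    have := reflTransGen_of_map (s := G.Active (G.An D) S) f (fun u v huv => ?_) h
    · have hf : ∀ {u}, u ∉ S → Relation.ReflTransGen (G.Active (G.An D) S) u (f u) := by
        intro u hu
        by_cases huκ : u ∈ κ
        · simp only [f, huκ, if_true]
          exact .single (toκ huκ (Or.inl hu))
        · simp only [f, huκ, if_false]
          exact .refl
      exact (hf ha).trans (this.trans (reflTransGen_active_symm (hf hb)))
    · rcases huv with ⟨hu, hv, hl | hA | hA⟩
      · obtain ⟨hl, hiff⟩ := split_line.mp hl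
        by_cases huκ : u ∈ κ
        · have hvκ := hiff.mp huκ
          simp only [f, huκ, hvκ, if_true]
          exact .refl
        · have hvκ : v ∉ κ := fun h => huκ (hiff.mpr h)
          simp only [f, huκ, hvκ, if_false]
          exact .single ⟨open_of_split hu huκ, open_of_split hv hvκ, Or.inl hl⟩
      · exact arrow hA.1 hA.2.1 hA.2.2
      · exact reflTransGen_active_symm (arrow hA.1 hA.2.1 hA.2.2)
  -- Without such an `a₀`, or with `κ` off the ancestral set, every usable arrow of the split graph
  -- is already a usable arrow of `G`, so the same walk works.
  · have arrow : ∀ {u v}, (G.split κ).Arrow u v → u ∉ S → v ∈ (G.split κ).An D →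
        G.Arrow u v ∧ v ∈ G.An D := by
      intro u v huv huS hvN
      have hv : v ∈ G.An D := by
        rcases hs.mem_An_split hvN with hv | ⟨hv, k, hk, hkN, hvk⟩
        · exact hv
        · by_cases hvS : v ∈ S
          · exact subset_An (hSD hvS)
          · exact absurd ⟨⟨k, hk, hkN⟩, v, hv, hvS, k, hk, hvk⟩ hcase
      refine ⟨(split_arrow.mp huv).resolve_right ?_, hv⟩
      rintro ⟨hl, hu, hvκ⟩
      exact hcase ⟨⟨v, hvκ, hv⟩, u, hu, huS, v, hvκ, hl⟩
    have hopen : ∀ {v}, (G.split κ).Open S v → G.Open S v := by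
      intro v hv
      by_cases hvS : v ∈ S
      · obtain ⟨p, hp, hpv⟩ := hv.resolve_left (fun h => h hvS)
        exact Or.inr ⟨p, hp, (arrow hpv hp (subset_An (hSD hvS))).1⟩
      · exact Or.inl hvS
    refine Relation.ReflTransGen.mono (fun u v huv => ?_) _ _ h
    refine ⟨hopen huv.1, hopen huv.2.1, ?_⟩
    rcases huv.2.2 with hl | hA | hA
    · exact Or.inl (split_line.mp hl).1
    · exact Or.inr (Or.inl ⟨(arrow hA.1 hA.2.1 hA.2.2).1, hA.2.1, (arrow hA.1 hA.2.1 hA.2.2).2⟩)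
    · exact Or.inr (Or.inr ⟨(arrow hA.1 hA.2.1 hA.2.2).1, hA.2.1, (arrow hA.1 hA.2.1 hA.2.2).2⟩)

theorem MarkovEquiv.refl [Finite V] (G : MixedGraph V) : MarkovEquiv G G := fun _ _ _ => rfl

theorem MarkovEquiv.symm [Finite V] {G H : MixedGraph V} (h : MarkovEquiv G H) :
    MarkovEquiv H G := fun X _ _ => (h X).symm

theorem MarkovEquiv.trans [Finite V] {G H K : MixedGraph V} (h : MarkovEquiv G H)
    (h' : MarkovEquiv H K) : MarkovEquiv G K := fun X _ _ => (h X).trans (h' X)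

theorem IsSplittable.markovEquiv [Finite V] (hs : G.IsSplittable κ) (hG : G.IsChainGraph) :
    MarkovEquiv G (G.split κ) := by
  intro X _ _
  have key : ∀ A B S : Set V, Disjoint A S → Disjoint B S →
      (Separates (G.extended (A ∪ B ∪ S)).augmented A B S ↔
        Separates ((G.split κ).extended (A ∪ B ∪ S)).augmented A B S) := by
    intro A B S hAS hBS
    have hA : A ⊆ A ∪ B ∪ S := fun _ h => Or.inl (Or.inl h)
    have hS : S ⊆ A ∪ B ∪ S := fun _ h => Or.inr h
    rw [separates_iff_active hG hA hS hAS hBS,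
      separates_iff_active (hG.split κ) hA hS hAS hBS]
    refine forall₄_congr fun a ha b hb => not_congr ⟨fun h => ?_, fun h => ?_⟩
    · exact hs.active_split hS (Or.inl (Or.inl ha)) (Or.inl (Or.inr hb)) h
    · exact hs.active_of_split hS (Set.disjoint_left.mp hAS ha) (Set.disjoint_left.mp hBS hb) h
  ext P
  exact forall_congr' fun A => forall_congr' fun B => forall_congr' fun S =>
    forall_congr' fun _ => forall_congr' fun hAS => forall_congr' fun hBS =>
    imp_congr (key A B S hAS hBS) Iff.rfl

end Split

/-! ### Chain components and the properties S and S' -/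

section Components

variable {G : MixedGraph V} {ξ κ W : Set V} {a b p x y : V}

theorem mem_chainComponents_iff : ξ ∈ G.chainComponents ↔ ξ.Nonempty ∧
    (∀ x ∈ ξ, ∀ y, G.Line x y → y ∈ ξ) ∧
    ∀ x ∈ ξ, ∀ y ∈ ξ, Relation.ReflTransGen G.Line x y := by
  have hr : ∀ {x y}, G.lineGraph.Reachable x y ↔ Relation.ReflTransGen G.Line x y := fun {x y} =>
    SimpleGraph.reachable_iff_reflTransGen x y
  constructor
  · rintro ⟨c, rfl⟩
    refine ⟨c.nonempty_supp, fun x hx y hxy => ?_, fun x hx y hy => ?_⟩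
    · rw [SimpleGraph.ConnectedComponent.mem_supp_iff] at hx ⊢
      rw [← hx]
      exact SimpleGraph.ConnectedComponent.sound (hr.mpr (.single hxy.symm))
    · rw [SimpleGraph.ConnectedComponent.mem_supp_iff] at hx hy
      exact hr.mp (SimpleGraph.ConnectedComponent.exact (hx.trans hy.symm))
  · rintro ⟨⟨x, hx⟩, hcl, hconn⟩
    refine ⟨G.lineGraph.connectedComponentMk x, Set.ext fun y => ?_⟩
    rw [SimpleGraph.ConnectedComponent.mem_supp_iff]
    constructor
    · intro hy
      exact SimpleGraph.ConnectedComponent.sound (hr.mpr (hconn y hy x hx))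
    · intro hy
      have := reflTransGen_line_symm (hr.mp (SimpleGraph.ConnectedComponent.exact hy))
      clear hy
      induction this with
      | refl => exact hx
      | tail _ h ih => exact hcl _ ih _ h

/-- The chain component of `x`. -/
def component (G : MixedGraph V) (x : V) : Set V := {y | Relation.ReflTransGen G.Line x y}

theorem mem_component_self : x ∈ G.component x := .refl

theorem component_mem_chainComponents : G.component x ∈ G.chainComponents :=
  mem_chainComponents_iff.mpr ⟨⟨x, .refl⟩, fun _ hy _ h => .tail hy h,
    fun _ hy _ hz => (reflTransGen_line_symm hy).trans hz⟩

theorem mem_of_line (hξ : ξ ∈ G.chainComponents) (hx : x ∈ ξ) (h : G.Line x y) : y ∈ ξ :=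
  (mem_chainComponents_iff.mp hξ).2.1 x hx y h

theorem reach_of_mem (hξ : ξ ∈ G.chainComponents) (hx : x ∈ ξ) (hy : y ∈ ξ) : G.Reach x y :=
  reach_of_reflTransGen_line ((mem_chainComponents_iff.mp hξ).2.2 x hx y hy)

theorem mem_of_reflTransGen_line (hξ : ξ ∈ G.chainComponents) (hx : x ∈ ξ)
    (h : Relation.ReflTransGen G.Line x y) : y ∈ ξ := by
  induction h with
  | refl => exact hx
  | tail _ h ih => exact mem_of_line hξ ih h

theorem IsChainGraph.line_of_mem (hG : G.IsChainGraph) (hξ : ξ ∈ G.chainComponents) (hx : x ∈ ξ)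
    (hy : y ∈ ξ) (h : G.Adj x y) : G.Line x y :=
  hG.line_of_adj h (reach_of_mem hξ hx hy) (reach_of_mem hξ hy hx)

theorem IsChainGraph.parent_notMem (hG : G.IsChainGraph) (hξ : ξ ∈ G.chainComponents)
    (hx : x ∈ ξ) (h : G.Arrow p x) : p ∉ ξ := fun hp =>
  hG.not_reach h (reach_of_mem hξ hx hp)

theorem IsChainGraph.arrow_of_parent (hG : G.IsChainGraph) (hξ : ξ ∈ G.chainComponents)
    (hx : x ∈ ξ) (hy : y ∈ ξ) (h : G.Arrow p x) (h' : G.Adj p y) : G.Arrow p y :=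
  arrow_of_adj h' fun hr => hG.not_reach h ((reach_of_mem hξ hx hy).trans hr)

theorem restrict_line : (G.restrict W).Line x y ↔ G.Line x y ∧ x ∈ W ∧ y ∈ W := by
  simp only [Line, restrict]; tauto

theorem restrict_arrow : (G.restrict W).Arrow x y ↔ G.Arrow x y ∧ x ∈ W ∧ y ∈ W := by
  simp only [Arrow, restrict]; tauto

theorem restrict_adj : (G.restrict W).Adj x y ↔ G.Adj x y ∧ x ∈ W ∧ y ∈ W := by
  simp only [Adj, restrict]; tauto

theorem reflTransGen_line_of_reachable_induce (hG : G.IsChainGraph) (hξ : ξ ∈ G.chainComponents)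
    (hκ : κ ⊆ ξ) {x y : κ} (h : (G.skeleton.induce κ).Reachable x y) :
    Relation.ReflTransGen (fun u v => G.Line u v ∧ v ∈ κ) x.1 y.1 := by
  rw [SimpleGraph.reachable_iff_reflTransGen] at h
  induction h with
  | refl => exact .refl
  | @tail u w _ h ih => exact ih.tail ⟨hG.line_of_mem hξ (hκ u.2) (hκ w.2) h, w.2⟩

theorem reachable_induce_of_reflTransGen_line (hx : x ∈ κ)
    (h : Relation.ReflTransGen (fun u v => G.Line u v ∧ v ∈ κ) x y) :
    ∃ hy : y ∈ κ, (G.skeleton.induce κ).Reachable ⟨x, hx⟩ ⟨y, hy⟩ := by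
  induction h with
  | refl => exact ⟨hx, .refl _⟩
  | @tail u w _ h ih =>
    obtain ⟨hu, ih⟩ := ih
    exact ⟨h.2, ih.trans (SimpleGraph.Adj.reachable (h.1.adj : G.skeleton.Adj u w))⟩

/-- No nonempty proper subset of `ξ` can be split off. -/
def Unsplittable (G : MixedGraph V) (ξ : Set V) : Prop :=
  ∀ κ, κ ⊂ ξ → κ.Nonempty → ¬ G.IsSplittable κ

theorem exists_line_of_ssubset (hξ : ξ ∈ G.chainComponents) (hκ : κ ⊂ ξ) (hne : κ.Nonempty) :
    ∃ a ∈ ξ, a ∉ κ ∧ ∃ k ∈ κ, G.Line a k := by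
  obtain ⟨k, hk⟩ := hne
  obtain ⟨z, hz, hzκ⟩ := Set.exists_of_ssubset hκ
  by_contra hcon
  push Not at hcon
  have := (mem_chainComponents_iff.mp hξ).2.2 k (hκ.1 hk) z hz
  have inv : z ∈ κ := by
    clear hz hzκ
    induction this with
    | refl => exact hk
    | @tail u w _ h ih =>
      by_contra hw
      exact hcon w (mem_of_line hξ (hκ.1 ih) h) hw u ih h.symm
  exact hzκ inv

/-- The dictionary is: `α` is the set of outside line-neighbours of `κ`, and `κ` is a component of
the common neighbours of `α`. A component violating both alternatives of S has no line-neighbours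
beyond `α` and inherits all parents of `α`, that is, it can be split off. -/
theorem propertyS_iff (hG : G.IsChainGraph) (hξ : ξ ∈ G.chainComponents) :
    G.PropertyS ξ ↔ G.Unsplittable ξ := by
  constructor
  · intro hS κ hκ hne hs
    let α : Set V := {a | a ∉ κ ∧ ∃ k ∈ κ, G.Line a k}
    have hκξ : ∀ {k}, k ∈ κ → k ∈ ξ := fun h => hκ.1 h
    have hαξ : ∀ {a}, a ∈ α → a ∈ ξ := fun ⟨_, _, hk, h⟩ => mem_of_line hξ (hκξ hk) h.symm
    have hcov : ∀ {a k}, a ∈ α → k ∈ κ → G.Line a k := fun ⟨ha, k', hk', h⟩ hk =>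
      hs.covers _ k' _ ha hk' hk h
    obtain ⟨k₀, hk₀⟩ := hne
    have hαss : α ⊂ ξ := ⟨fun _ h => hαξ h, fun h => (h (hκξ hk₀)).1 hk₀⟩
    have hαne : α.Nonempty := by
      obtain ⟨a, -, ha, k, hk, h⟩ := exists_line_of_ssubset hξ hκ ⟨k₀, hk₀⟩
      exact ⟨a, ha, k, hk, h⟩
    have hcl : (G.restrict ξ).skeleton.IsClique α := fun a ha b hb hab =>
      restrict_adj.mpr ⟨(hs.complete a b k₀ ha.1 hb.1 hk₀ (hcov ha hk₀) (hcov hb hk₀) hab).adj,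
        hαξ ha, hαξ hb⟩
    have hκcnb : κ ⊆ (G.restrict ξ).cnb α := fun k hk =>
      ⟨fun h => h.1 hk, fun a ha => restrict_line.mpr ⟨(hcov ha hk).symm, hκξ hk, hαξ ha⟩⟩
    have hcomp : G.IsComponentOf ((G.restrict ξ).cnb α) κ := by
      refine ⟨(G.skeleton.induce _).connectedComponentMk ⟨k₀, hκcnb hk₀⟩, Set.ext fun y => ?_⟩
      simp only [Set.mem_image, SimpleGraph.ConnectedComponent.mem_supp_iff]
      have hcnbξ : (G.restrict ξ).cnb α ⊆ ξ := by
        rintro v ⟨-, hv⟩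
        obtain ⟨a, ha⟩ := hαne
        exact (restrict_line.mp (hv a ha)).2.1
      constructor
      · intro hy
        have h := hs.connected y hy k₀ hk₀
        have h' : Relation.ReflTransGen
            (fun u v => G.Line u v ∧ v ∈ (G.restrict ξ).cnb α) y k₀ :=
          Relation.ReflTransGen.mono (fun _ _ h => ⟨h.1, hκcnb h.2⟩) _ _ h
        obtain ⟨_, hr⟩ := reachable_induce_of_reflTransGen_line (hκcnb hy) h'
        exact ⟨⟨y, hκcnb hy⟩, SimpleGraph.ConnectedComponent.sound hr, rfl⟩
      · rintro ⟨⟨y, hy⟩, hr, rfl⟩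
        have h := reflTransGen_line_of_reachable_induce hG hξ hcnbξ
          (SimpleGraph.ConnectedComponent.exact hr).symm
        change y ∈ κ
        change Relation.ReflTransGen _ k₀ y at h
        clear hr hy
        induction h with
        | refl => exact hk₀
        | @tail u w _ h ih =>
          by_contra hw
          exact h.2.1 ⟨hw, u, ih, h.1.symm⟩
    rcases hS α hαss hαne hcl ⟨k₀, hκcnb hk₀⟩ κ hcomp with ⟨v, ⟨hv, k, hk, h⟩, hvα⟩ | ⟨p, hp, hp'⟩
    · exact hvα ⟨hv, k, hk, (restrict_line.mp h).1⟩
    · obtain ⟨-, a, ha, h⟩ := hp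
      obtain ⟨h, -, -⟩ := restrict_arrow.mp h
      have hpk : ∀ k ∈ κ, G.Arrow p k := fun k hk => hs.parents p a k ha.1 hk (hcov ha hk) h
      have hpξ : p ∉ ξ := hG.parent_notMem hξ (hαξ ha) h
      refine hp' ⟨fun hp => hpξ (hκξ hp), fun k hk => restrict_arrow.mpr ⟨hpk k hk, Or.inr ?_,
        Or.inl (hκξ hk)⟩⟩
      exact ⟨hpξ, k, hκξ hk, hpk k hk⟩
  · intro hU α hα hαne hcl hne K hK
    by_contra hcon
    rw [not_or, Set.not_nonempty_iff_eq_empty, Set.not_nonempty_iff_eq_empty, Set.sdiff_eq_empty,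
      Set.sdiff_eq_empty] at hcon
    obtain ⟨hnb, hpa⟩ := hcon
    have hcnbξ : (G.restrict ξ).cnb α ⊆ ξ := by
      rintro v ⟨-, hv⟩
      obtain ⟨a, ha⟩ := hαne
      exact (restrict_line.mp (hv a ha)).2.1
    obtain ⟨c, rfl⟩ := hK
    have hKc : ∀ {k}, k ∈ Subtype.val '' c.supp → k ∈ (G.restrict ξ).cnb α := by
      rintro k ⟨k, -, rfl⟩
      exact k.2
    have hnbα : ∀ {a k}, a ∉ Subtype.val '' c.supp → k ∈ Subtype.val '' c.supp → G.Line a k →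
        a ∈ α := fun ha hk h => hnb ⟨ha, _, hk, restrict_line.mpr
          ⟨h, mem_of_line hξ (hcnbξ (hKc hk)) h.symm, hcnbξ (hKc hk)⟩⟩
    have hαK : ∀ {a k}, a ∈ α → k ∈ Subtype.val '' c.supp → G.Line a k := fun ha hk =>
      (restrict_line.mp ((hKc hk).2 _ ha)).1.symm
    obtain ⟨a₀, ha₀⟩ := hαne
    refine hU _ ⟨fun k hk => hcnbξ (hKc hk), fun h => (hKc (h (hα.1 ha₀))).1 ha₀⟩
      (c.nonempty_supp.image _) ⟨?_, ?_, ?_, ?_⟩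
    · rintro _ ⟨x, hx, rfl⟩ _ ⟨y, hy, rfl⟩
      rw [SimpleGraph.ConnectedComponent.mem_supp_iff] at hx hy
      have hr := SimpleGraph.ConnectedComponent.exact (hx.trans hy.symm)
      rw [SimpleGraph.reachable_iff_reflTransGen] at hr
      clear hy
      induction hr with
      | refl => exact .refl
      | @tail u w hu h ih =>
        refine ih.tail ⟨hG.line_of_mem hξ (hcnbξ u.2) (hcnbξ w.2) h, w, ?_, rfl⟩
        rw [SimpleGraph.ConnectedComponent.mem_supp_iff, ← hx]
        exact (SimpleGraph.ConnectedComponent.sound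
          ((SimpleGraph.reachable_iff_reflTransGen _ _).mpr (hu.tail h))).symm
    · exact fun a k k' ha hk hk' h => hαK (hnbα ha hk h) hk'
    · intro a b k ha hb hk hak hbk hab
      exact hG.line_of_mem hξ (hα.1 (hnbα ha hk hak)) (hα.1 (hnbα hb hk hbk))
        (restrict_adj.mp (hcl (hnbα ha hk hak) (hnbα hb hk hbk) hab)).1
    · intro p a k ha hk hak h
      have haα := hnbα ha hk hak
      have hpξ : p ∉ ξ := hG.parent_notMem hξ (hα.1 haα) h
      have : p ∈ (G.restrict (G.cl ξ)).pa α := ⟨fun h => hpξ (hα.1 h), a, haα, restrict_arrow.mpr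
        ⟨h, Or.inr ⟨hpξ, a, hα.1 haα, h⟩, Or.inl (hα.1 haα)⟩⟩
      exact (restrict_arrow.mp ((hpa this).2 k hk)).1

/-- Here the dictionary starts from `κ`: absence of noncovering neighbours is the covering
condition, and the covering neighbours play the role of `α`. -/
theorem propertyS'_iff (hG : G.IsChainGraph) (hξ : ξ ∈ G.chainComponents) :
    G.PropertyS' ξ ↔ G.Unsplittable ξ := by
  constructor
  · intro hS κ hκ hne hs
    have hκξ : ∀ {k}, k ∈ κ → k ∈ ξ := fun h => hκ.1 h
    have hcnb : ∀ {a}, a ∈ (G.restrict ξ).cnb κ ↔ a ∉ κ ∧ ∃ k ∈ κ, G.Line a k := by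
      intro a
      constructor
      · rintro ⟨ha, h⟩
        obtain ⟨k, hk⟩ := hne
        exact ⟨ha, k, hk, (restrict_line.mp (h k hk)).1⟩
      · rintro ⟨ha, k, hk, h⟩
        exact ⟨ha, fun k' hk' => restrict_line.mpr ⟨hs.covers a k k' ha hk hk' h,
          mem_of_line hξ (hκξ hk) h.symm, hκξ hk'⟩⟩
    obtain ⟨k₀, hk₀⟩ := hne
    have hconn : (G.skeleton.induce κ).Connected := by
      have : Nonempty κ := ⟨⟨k₀, hk₀⟩⟩
      refine ⟨fun x y => ?_⟩
      exact (reachable_induce_of_reflTransGen_line x.2 (hs.connected x x.2 y y.2)).2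
    have hαne : ((G.restrict ξ).cnb κ).Nonempty := by
      obtain ⟨a, -, ha, k, hk, h⟩ := exists_line_of_ssubset hξ hκ ⟨k₀, hk₀⟩
      exact ⟨a, hcnb.mpr ⟨ha, k, hk, h⟩⟩
    have hline : ∀ {a k}, a ∈ (G.restrict ξ).cnb κ → k ∈ κ → G.Line a k ∧ a ∈ ξ :=
      fun ha hk => ⟨(restrict_line.mp (ha.2 _ hk)).1, (restrict_line.mp (ha.2 _ hk)).2.1⟩
    have hcl : (G.restrict ξ).skeleton.IsClique ((G.restrict ξ).cnb κ) := fun a ha b hb hab =>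
      restrict_adj.mpr ⟨(hs.complete a b k₀ ha.1 hb.1 hk₀ (hline ha hk₀).1 (hline hb hk₀).1
        hab).adj, (hline ha hk₀).2, (hline hb hk₀).2⟩
    rcases hS κ hκ ⟨k₀, hk₀⟩ hconn hαne hcl with ⟨v, hv, ⟨k, hk, h⟩, k', hk', h'⟩ | ⟨p, hp, hp'⟩
    · exact h' ((hcnb.mpr ⟨hv, k, hk, (restrict_line.mp h).1⟩).2 k' hk')
    · obtain ⟨-, a, ha, h⟩ := hp
      obtain ⟨h, -, -⟩ := restrict_arrow.mp h
      have hpk : ∀ k ∈ κ, G.Arrow p k := fun k hk => hs.parents p a k ha.1 hk (hline ha hk).1 h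
      have hpξ : p ∉ ξ := hG.parent_notMem hξ (hline ha hk₀).2 h
      exact hp' ⟨fun hp => hpξ (hκξ hp), fun k hk => restrict_arrow.mpr ⟨hpk k hk,
        Or.inr ⟨hpξ, k, hκξ hk, hpk k hk⟩, Or.inl (hκξ hk)⟩⟩
  · intro hU κ hκ hne hconn hαne hcl
    by_contra hcon
    rw [not_or, Set.not_nonempty_iff_eq_empty, Set.not_nonempty_iff_eq_empty,
      Set.sdiff_eq_empty] at hcon
    obtain ⟨hnb, hpa⟩ := hcon
    have hκξ : ∀ {k}, k ∈ κ → k ∈ ξ := fun h => hκ.1 h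
    have hcov : ∀ {a k}, a ∉ κ → k ∈ κ → G.Line a k → a ∈ (G.restrict ξ).cnb κ := by
      intro a k ha hk h
      refine ⟨ha, fun k' hk' => ?_⟩
      by_contra h'
      have : a ∈ (G.restrict ξ).ncnb κ := ⟨ha, ⟨k, hk, restrict_line.mpr
        ⟨h, mem_of_line hξ (hκξ hk) h.symm, hκξ hk⟩⟩, k', hk', h'⟩
      exact (Set.ext_iff.mp hnb a).mp this
    refine hU κ hκ hne ⟨?_, ?_, ?_, ?_⟩
    · intro x hx y hy
      exact reflTransGen_line_of_reachable_induce hG hξ hκ.1 (hconn.preconnected ⟨x, hx⟩ ⟨y, hy⟩)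
    · exact fun a k k' ha hk hk' h => (restrict_line.mp ((hcov ha hk h).2 k' hk')).1
    · intro a b k ha hb hk hak hbk hab
      obtain ⟨h, h1, h2⟩ := restrict_adj.mp (hcl (hcov ha hk hak) (hcov hb hk hbk) hab)
      exact hG.line_of_mem hξ h1 h2 h
    · intro p a k ha hk hak h
      have haξ : a ∈ ξ := mem_of_line hξ (hκξ hk) hak.symm
      have hpξ : p ∉ ξ := hG.parent_notMem hξ haξ h
      have hcnbξ : (G.restrict ξ).cnb κ ⊆ ξ := fun v hv => (restrict_line.mp (hv.2 k hk)).2.1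
      have : p ∈ (G.restrict (G.cl ξ)).pa ((G.restrict ξ).cnb κ) :=
        ⟨fun h => hpξ (hcnbξ h), a, hcov ha hk hak, restrict_arrow.mpr
        ⟨h, Or.inr ⟨hpξ, a, haξ, h⟩, Or.inl haξ⟩⟩
      exact (restrict_arrow.mp ((hpa this).2 k hk)).1

/-- `W` contains a chordless cycle of length at least four of the undirected graph `L`. -/
def HasHole (L : SimpleGraph V) (W : Set V) : Prop :=
  ∃ (k : ℕ) (v : ℕ → V), 4 ≤ k ∧ v k = v 0 ∧ Set.InjOn v (Set.Iio k) ∧ (∀ i < k, v i ∈ W) ∧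
    (∀ i < k, L.Adj (v i) (v (i + 1))) ∧
    ∀ i j, i < j → j < k → j ≠ i + 1 → ¬ (i = 0 ∧ j + 1 = k) → ¬ L.Adj (v i) (v j)

/-- In a chain graph, adjacency inside a component means a line and a parent of the component lies
outside it, so the restrictions to the closure and the nontriviality clause take care of themselves.
-/
theorem mem_strongComponents_iff (hG : G.IsChainGraph) :
    ξ ∈ G.strongComponents ↔ ξ ∈ G.chainComponents ∧
      (HasHole G.lineGraph ξ ∨ ∃ a b c, G.IsFlag a b c ∧ b ∈ ξ) := by
  constructor
  · rintro ⟨hξ, -, ⟨k, v, ⟨⟨-, h0, hinj, -⟩, hk, hl, hch⟩, hmem⟩ | ⟨a, b, c, h, hb, -⟩⟩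
    · refine ⟨hξ, Or.inl ⟨k, v, hk, h0, hinj, fun i hi => hmem i hi.le,
        fun i hi => (restrict_line.mp (hl i hi)).1, fun i j hij hj h1 h2 h3 => ?_⟩⟩
      exact hch i j hij hj h1 h2 (restrict_adj.mpr ⟨Line.adj h3, Or.inl (hmem i (by omega)),
        Or.inl (hmem j hj.le)⟩)
    · obtain ⟨h1, h2, h3⟩ := h
      obtain ⟨h1, ha, hb'⟩ := restrict_arrow.mp h1
      obtain ⟨h2, -, hc⟩ := restrict_line.mp h2
      exact ⟨hξ, Or.inr ⟨a, b, c, ⟨h1, h2, fun h => h3 (restrict_adj.mpr ⟨h, ha, hc⟩)⟩, hb⟩⟩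
  · rintro ⟨hξ, ⟨k, v, hk, h0, hinj, hmem, hl, hch⟩ | ⟨a, b, c, h, hb⟩⟩
    · have hmem' : ∀ i ≤ k, v i ∈ ξ := by
        intro i hi
        rcases hi.lt_or_eq with h | rfl
        · exact hmem i h
        · exact h0 ▸ hmem 0 (by omega)
      have hl' : ∀ i < k, (G.restrict (G.cl ξ)).Line (v i) (v (i + 1)) := fun i hi =>
        restrict_line.mpr ⟨hl i hi, Or.inl (hmem' i hi.le), Or.inl (hmem' (i + 1) hi)⟩
      refine ⟨hξ, ⟨v 0, hmem' 0 (by omega), v 1, hmem' 1 (by omega), fun h => ?_⟩, Or.inl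
        ⟨k, v, ⟨⟨by omega, h0, hinj, fun i hi => (hl' i hi).1⟩, hk, hl', ?_⟩, hmem'⟩⟩
      · exact absurd (hinj (show 0 < k by omega) (show 1 < k by omega) h) (by norm_num)
      · intro i j hij hj h1 h2 h3
        exact hch i j hij hj h1 h2 (hG.line_of_mem hξ (hmem i (by omega)) (hmem j hj)
          (restrict_adj.mp h3).1)
    · obtain ⟨h1, h2, h3⟩ := h
      have hc := mem_of_line hξ hb h2
      have ha : a ∈ G.cl ξ := Or.inr ⟨hG.parent_notMem hξ hb h1, b, hb, h1⟩
      exact ⟨hξ, ⟨b, hb, c, hc, h2.ne⟩, Or.inr ⟨a, b, c, ⟨restrict_arrow.mpr ⟨h1, ha, Or.inl hb⟩,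
        restrict_line.mpr ⟨h2, Or.inl hb, Or.inl hc⟩, fun h => h3 (restrict_adj.mp h).1⟩, hb, hc⟩⟩

end Components

/-! ### Rigid lines and arrows -/

section Rigid

variable {G H : MixedGraph V} {ξ : Set V} {a b c x y : V}

/-- `G` and `H` have the same skeleton and the same triplexes. -/
structure SameTriplexes (G H : MixedGraph V) : Prop where
  adj : ∀ a b, G.Adj a b ↔ H.Adj a b
  triplex : ∀ a b c, G.IsTriplex a b c ↔ H.IsTriplex a b c

theorem MarkovEquiv.sameTriplexes [Finite V] (hG : G.IsChainGraph) (hH : H.IsChainGraph)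
    (h : MarkovEquiv G H) : SameTriplexes G H :=
  ⟨fun _ _ => ⟨h.adj hG hH, h.symm.adj hH hG⟩,
    fun _ _ _ => ⟨h.isTriplex hG hH, h.symm.isTriplex hH hG⟩⟩

/-- The lines of an unsplittable chain component are lines in every equivalent chain graph. -/
theorem Unsplittable.line [Finite V] (hU : G.Unsplittable ξ) (hG : G.IsChainGraph)
    (hH : H.IsChainGraph) (hGH : SameTriplexes G H) (hξ : ξ ∈ G.chainComponents) (hx : x ∈ ξ)
    (hxy : G.Line x y) : H.Line x y := by
  obtain ⟨r, hrA, hrL⟩ := hH.exists_height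
  -- The candidate for splitting is the piece of `ξ` that `H`-lines connect to a vertex of maximal
  -- `H`-height: edges of `H` to the rest of `ξ` can only be arrows into it.
  obtain ⟨t, ht, hmax⟩ := Set.exists_max_image ξ r (Set.toFinite ξ) ⟨x, hx⟩
  let κ : Set V := {y | Relation.ReflTransGen (fun u v => H.Line u v ∧ v ∈ ξ) t y}
  have hκξ : ∀ {k}, k ∈ κ → k ∈ ξ := by
    intro k hk
    cases hk with
    | refl => exact ht
    | tail _ h => exact h.2
  have hκL : ∀ {k}, k ∈ κ → Relation.ReflTransGen H.Line t k := fun hk =>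
    Relation.ReflTransGen.mono (fun _ _ h => h.1) _ _ hk
  have hrκ : ∀ {k}, k ∈ κ → r k = r t := by
    intro k hk
    have := hκL hk
    clear hk
    induction this with
    | refl => rfl
    | tail _ h ih => rw [← hrL _ _ h, ih]
  have gline : ∀ {u v}, u ∈ ξ → v ∈ ξ → H.Adj u v → G.Line u v := fun hu hv h =>
    hG.line_of_mem hξ hu hv ((hGH.adj _ _).mpr h)
  by_cases hκ : κ = ξ
  · have hx' := hκL (hκ.symm ▸ hx : x ∈ κ)
    have hy' := hκL (hκ.symm ▸ mem_of_line hξ hx hxy : y ∈ κ)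
    exact hH.line_of_adj ((hGH.adj _ _).mp hxy.adj)
      (reach_of_reflTransGen_line ((reflTransGen_line_symm hx').trans hy'))
      (reach_of_reflTransGen_line ((reflTransGen_line_symm hy').trans hx'))
  · exfalso
    have arr : ∀ {a k}, a ∉ κ → k ∈ κ → G.Line a k → a ∈ ξ ∧ H.Arrow a k := by
      intro a k ha hk h
      have haξ := mem_of_line hξ (hκξ hk) h.symm
      refine ⟨haξ, ?_⟩
      rcases adj_iff.mp ((hGH.adj _ _).mp h.adj) with h' | h' | h'
      · exact absurd (Relation.ReflTransGen.tail hk ⟨h'.symm, haξ⟩) ha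
      · exact h'
      · have := hrA _ _ h'
        have := hmax a haξ
        rw [hrκ hk] at *
        omega
    have κconn : ∀ {x y}, x ∈ κ → y ∈ κ →
        Relation.ReflTransGen (fun u v => H.Line u v ∧ u ∈ κ ∧ v ∈ κ) x y := by
      have from_t : ∀ {y}, y ∈ κ →
          Relation.ReflTransGen (fun u v => H.Line u v ∧ u ∈ κ ∧ v ∈ κ) t y := by
        intro y hy
        induction hy with
        | refl => exact .refl
        | tail h1 h2 ih => exact ih.tail ⟨h2.1, h1, h1.tail h2⟩
      have to_t : ∀ {y}, y ∈ κ →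
          Relation.ReflTransGen (fun u v => H.Line u v ∧ u ∈ κ ∧ v ∈ κ) y t := by
        intro y hy
        induction hy with
        | refl => exact .refl
        | tail h1 h2 ih => exact .head ⟨h2.1.symm, h1.tail h2, h1⟩ ih
      intro x y hx hy
      exact (to_t hx).trans (from_t hy)
    refine hU κ (Set.ssubset_iff_subset_ne.mpr ⟨fun k hk => hκξ hk, hκ⟩) ⟨t, .refl⟩
      ⟨?_, ?_, ?_, ?_⟩
    · intro x hx y hy
      exact Relation.ReflTransGen.mono
        (fun u v h => ⟨gline (hκξ h.2.1) (hκξ h.2.2) h.1.adj, h.2.2⟩) _ _ (κconn hx hy)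
    · intro a k k' ha hk hk' h
      have := κconn hk hk'
      clear hk'
      induction this with
      | refl => exact h
      | @tail u w _ huw ih =>
        obtain ⟨haξ, hau⟩ := arr ha huw.2.1 ih
        by_contra hcon
        -- Otherwise `a → u - w` is a flag of `H`, hence a triplex of `G`, where both edges are
        -- lines.
        have hadj : ¬ H.Adj a w := fun h' => hcon (gline haξ (hκξ huw.2.2) h')
        have htri := (hGH.triplex a u w).mpr (Or.inl ⟨hau, huw.1, hadj⟩)
        exact htri.not_line_line ih (gline (hκξ huw.2.1) (hκξ huw.2.2) huw.1.adj)
    · intro a b k ha hb hk hak hbk hab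
      obtain ⟨haξ, ha'⟩ := arr ha hk hak
      obtain ⟨hbξ, hb'⟩ := arr hb hk hbk
      by_contra hcon
      have hadj : ¬ H.Adj a b := fun h' => hcon (gline haξ hbξ h')
      have htri := (hGH.triplex a k b).mpr (Or.inr (Or.inr ⟨hab, ha', hb', hadj⟩))
      exact htri.not_line_line hak hbk.symm
    · intro p a k ha hk hak hpa
      obtain ⟨haξ, ha'⟩ := arr ha hk hak
      refine hG.arrow_of_parent hξ haξ (hκξ hk) hpa ?_
      by_contra hadj
      exact absurd ha' ((hGH.triplex p a k).mp (Or.inl ⟨hpa, hak, hadj⟩)).not_arrow_right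

/-- A hole contains two nonadjacent vertices. -/
theorem HasHole.exists_not_adj {L : SimpleGraph V} {W : Set V} (h : HasHole L W) :
    ∃ x ∈ W, ∃ y ∈ W, x ≠ y ∧ ¬ L.Adj x y := by
  obtain ⟨k, v, hk, -, hinj, hmem, -, hch⟩ := h
  refine ⟨v 0, hmem 0 (by omega), v 2, hmem 2 (by omega), fun h => ?_,
    hch 0 2 (by omega) (by omega) (by omega) (by omega)⟩
  exact absurd (hinj (show 0 < k by omega) (show 2 < k by omega) h) (by norm_num)

/-- The well protected arrows of a graph whose strong components are unsplittable are not reversed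
in any equivalent chain graph. -/
theorem not_arrow_of_wellProtected [Finite V] (hG : G.IsChainGraph) (hH : H.IsChainGraph)
    (hGH : SameTriplexes G H) (hU : ∀ ξ ∈ G.strongComponents, G.Unsplittable ξ)
    (hW : ∀ a b, G.Arrow a b → G.WellProtected a b) (hab : G.Arrow a b) : ¬ H.Arrow b a := by
  intro hba
  have strong : ∀ {x y}, G.StrongLine x y → H.Line x y := by
    rintro x y ⟨hxy, ξ, hξ, hx, -⟩
    exact (hU ξ hξ).line hG hH hGH hξ.1 hx hxy
  obtain ⟨r, hrA, hrL⟩ := hG.exists_height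
  -- Among the arrows of `G` reversed in `H`, take the lowest head and then the highest tail, with
  -- heights measured in `G`. `Ext` collects all arrows at these extremal heights, so that it is
  -- stable under moving an end along strong lines.
  let S : Set (V × V) := {q | G.Arrow q.1 q.2 ∧ H.Arrow q.2 q.1}
  obtain ⟨q₁, hq₁, hmin⟩ := Set.exists_min_image S (fun q => r q.2) (Set.toFinite S)
    ⟨(a, b), hab, hba⟩
  obtain ⟨q₂, ⟨hq₂, hq₂'⟩, hmax⟩ := Set.exists_max_image {q ∈ S | r q.2 = r q₁.2}
    (fun q => r q.1) (Set.toFinite _) ⟨q₁, hq₁, rfl⟩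
  let Ext : V → V → Prop := fun a b => (G.Arrow a b ∧ H.Arrow b a) ∧ r b = r q₁.2 ∧ r a = r q₂.1
  have ext_head : ∀ {a b c d}, Ext a b → G.Arrow c d → H.Arrow d c → r b ≤ r d := by
    intro a b c d h h1 h2
    rw [h.2.1]
    exact hmin (c, d) ⟨h1, h2⟩
  have ext_tail : ∀ {a b c d}, Ext a b → G.Arrow c d → H.Arrow d c → r d = r b → r c ≤ r a := by
    intro a b c d h h1 h2 h3
    rw [h.2.2]
    exact hmax (c, d) ⟨⟨h1, h2⟩, h3.trans h.2.1⟩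
  have n1 : ∀ {a b c}, Ext a b → G.Arrow c a → G.Adj c b := by
    intro a b c h hca
    by_contra hcb
    have hne : c ≠ b := fun e => (hG.not_reach h.1.1) (e ▸ hca.reach)
    have hnt : ¬ H.IsTriplex b a c := fun ht =>
      ((hGH.triplex b a c).mpr ht).not_arrow_left h.1.1
    -- Otherwise `b → a` starts a triplex of `H`, impossible in `G` where `a → b`. But then `c → a`
    -- is reversed too, with a lower head.
    have hac : H.Arrow a c := by
      by_contra hac
      exact hnt (isTriplex_of_arrow hne.symm h.1.2
        (fun h' => hcb ((hGH.adj _ _).mpr h').symm) ((hGH.adj _ _).mp hca.adj.symm) hac)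
    have := ext_head h hca hac
    have := hrA _ _ h.1.1
    omega
  have n2 : ∀ {a b c}, Ext a b → ¬ G.IsImmorality a b c := fun h hi =>
    ((hGH.triplex _ _ _).mp (Or.inr (Or.inr hi))).not_arrow_left h.1.2
  have n3 : ∀ {a b c}, Ext a b → G.Arrow a c → ¬ G.Arrow c b := by
    intro a b c h hac hcb
    have hr1 := hrA _ _ hac
    have hr2 := hrA _ _ hcb
    rcases adj_iff.mp ((hGH.adj _ _).mp hac.adj) with h1 | h1 | h1
    · have : H.Arrow b c := arrow_of_adj ((hGH.adj _ _).mp hcb.adj.symm) fun h2 =>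
        hH.not_reach h.1.2 (h1.reach.trans h2)
      have := ext_tail h hcb this rfl
      omega
    · have : H.Arrow b c := arrow_of_adj ((hGH.adj _ _).mp hcb.adj.symm) fun h2 =>
        hH.not_reach h.1.2 (h1.reach.trans h2)
      have := ext_tail h hcb this rfl
      omega
    · have := ext_head h hac h1
      omega
  -- In `H`, `c` and `d` must both point to `a` to avoid a semi-directed cycle, and this immorality
  -- contradicts the lines `c - a - d` of `G`.
  have n4 : ∀ {a b c d}, Ext a b → G.Line a c → G.Line a d → ¬ G.IsImmorality c b d := by
    intro a b c d h hac had hi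
    have htri : H.IsTriplex c b d := (hGH.triplex _ _ _).mp (Or.inr (Or.inr hi))
    have toA : ∀ {e}, G.Line a e → G.Arrow e b → ¬ H.Arrow b e → H.Arrow e a := by
      intro e hae heb hbe
      refine arrow_of_adj ((hGH.adj _ _).mp hae.adj.symm) fun h1 => ?_
      have : H.Reach e b := by
        rcases adj_iff.mp ((hGH.adj _ _).mp heb.adj) with h2 | h2 | h2
        · exact h2.reach
        · exact h2.reach
        · exact absurd h2 hbe
      exact hH.not_reach h.1.2 (h1.trans this)
    have hca := toA hac hi.2.1 htri.not_arrow_left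
    have hda := toA had hi.2.2.1 htri.not_arrow_right
    have htri' : H.IsTriplex c a d :=
      Or.inr (Or.inr ⟨hi.1, hca, hda, fun h => hi.2.2.2 ((hGH.adj _ _).mpr h)⟩)
    exact ((hGH.triplex _ _ _).mpr htri').not_line_line hac.symm had
  have n6 : ∀ {a b c}, Ext a b → G.StrongLine a c → G.Adj c b := by
    intro a b c h hac
    by_contra hcb
    have ht : H.IsTriplex b a c := Or.inl ⟨h.1.2, strong hac,
      fun h' => hcb ((hGH.adj _ _).mpr h').symm⟩
    exact ((hGH.triplex _ _ _).mpr ht).not_arrow_left h.1.1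
  have n7 : ∀ {a b c}, Ext a b → G.StrongLine b c → G.Adj a c := by
    intro a b c h hbc
    by_contra hac
    have ht : G.IsTriplex a b c := Or.inl ⟨h.1.1, hbc.1, hac⟩
    exact ((hGH.triplex _ _ _).mp ht).not_arrow_left h.1.2
  have step_tail : ∀ {a b c}, Ext a b → G.StrongLine a c → Ext c b := by
    intro a b c h hac
    have hcb : G.Arrow c b := arrow_of_adj (n6 h hac) fun h' =>
      hG.not_reach h.1.1 (h'.trans hac.1.symm.reach)
    have hbc : H.Arrow b c := arrow_of_adj ((hGH.adj _ _).mp hcb.adj.symm) fun h' =>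
      hH.not_reach h.1.2 ((strong hac).reach.trans h')
    exact ⟨⟨hcb, hbc⟩, h.2.1, (hrL _ _ hac.1) ▸ h.2.2⟩
  have step_head : ∀ {a b c}, Ext a b → G.StrongLine b c → Ext a c := by
    intro a b c h hbc
    have hac : G.Arrow a c := arrow_of_adj (n7 h hbc) fun h' =>
      hG.not_reach h.1.1 (hbc.1.reach.trans h')
    have hca : H.Arrow c a := arrow_of_adj ((hGH.adj _ _).mp hac.adj.symm) fun h' =>
      hH.not_reach h.1.2 (h'.trans (strong hbc).symm.reach)
    exact ⟨⟨hac, hca⟩, (hrL _ _ hbc.1) ▸ h.2.1, h.2.2⟩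
  -- If the tail lay in a strong component, all of that component would point to `b` extremally;
  -- nonadjacent vertices of a hole, or the ends of a flag, would then form an excluded immorality
  -- at `b`.
  have no_tail : ∀ {a b ξ}, Ext a b → ξ ∈ G.strongComponents → a ∉ ξ := by
    intro a b ξ h hξ ha
    have all : ∀ c ∈ ξ, Ext c b := by
      intro c hc
      have := (mem_chainComponents_iff.mp hξ.1).2.2 a ha c hc
      clear hc
      induction this with
      | refl => exact h
      | @tail u w hu huw ih =>
        have huξ : u ∈ ξ := mem_of_reflTransGen_line hξ.1 ha hu
        exact step_tail ih ⟨huw, ξ, hξ, huξ, mem_of_line hξ.1 huξ huw⟩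
    rcases ((mem_strongComponents_iff hG).mp hξ).2 with hole | ⟨p, c, d, ⟨h1, h2, h3⟩, hc⟩
    · obtain ⟨x, hx, y, hy, hxy, hadj⟩ := hole.exists_not_adj
      exact n2 (all x hx) ⟨hxy, (all x hx).1.1, (all y hy).1.1,
        fun h => hadj (hG.line_of_mem hξ.1 hx hy h)⟩
    · have hd := mem_of_line hξ.1 hc h2
      have hpb : G.Arrow p b := arrow_of_adj (n1 (all c hc) h1) fun h' =>
        hG.not_reach h1 ((all c hc).1.1.reach.trans h')
      have hne : d ≠ p := by
        rintro rfl
        exact h1.2 h2.1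
      exact n2 (all d hd) ⟨hne, (all d hd).1.1, hpb, fun h => h3 h.symm⟩
  -- If the head lay in a strong component, all of it would be hit by `a`. A hole then gives an
  -- immorality at `a` in `H`; for a flag `p → x - y`, each possible edge between `p` and `a` is
  -- excluded, the line because it creates a semi-directed cycle of `H`.
  have no_head : ∀ {a b ξ}, Ext a b → ξ ∈ G.strongComponents → b ∉ ξ := by
    intro a b ξ h hξ hb
    have all : ∀ c ∈ ξ, Ext a c := by
      intro c hc
      have := (mem_chainComponents_iff.mp hξ.1).2.2 b hb c hc
      clear hc
      induction this with
      | refl => exact h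
      | @tail u w hu huw ih =>
        have huξ : u ∈ ξ := mem_of_reflTransGen_line hξ.1 hb hu
        exact step_head ih ⟨huw, ξ, hξ, huξ, mem_of_line hξ.1 huξ huw⟩
    rcases ((mem_strongComponents_iff hG).mp hξ).2 with hole | ⟨p, x, y, ⟨h1, h2, h3⟩, hx⟩
    · obtain ⟨x, hx, y, hy, hxy, hadj⟩ := hole.exists_not_adj
      have ht : H.IsTriplex x a y := Or.inr (Or.inr ⟨hxy, (all x hx).1.2, (all y hy).1.2,
        fun h => hadj (hG.line_of_mem hξ.1 hx hy ((hGH.adj _ _).mpr h))⟩)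
      exact ((hGH.triplex _ _ _).mpr ht).not_arrow_left (all x hx).1.1
    · have hy := mem_of_line hξ.1 hx h2
      have ex := all x hx
      have ey := all y hy
      have hpa : p ≠ a := by
        rintro rfl
        exact h3 ey.1.1.adj
      have hadj : G.Adj p a := by
        by_contra hcon
        exact n2 ex ⟨hpa.symm, ex.1.1, h1, fun h => hcon h.symm⟩
      rcases adj_iff.mp hadj with h4 | h4 | h4
      · have hxy : H.Line x y := strong ⟨h2, ξ, hξ, hx, hy⟩
        have hpx : H.Arrow p x := by
          have ht := (hGH.triplex p x y).mp (Or.inl ⟨h1, h2, h3⟩)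
          rcases adj_iff.mp ((hGH.adj _ _).mp h1.adj) with h5 | h5 | h5
          · exact absurd hxy (ht.not_line_line h5)
          · exact h5
          · exact absurd h5 ht.not_arrow_left
        have hap : H.Arrow a p := by
          by_contra hap
          have hyp : y ≠ p := by
            rintro rfl
            exact h1.2 h2.1
          have ht := isTriplex_of_arrow hyp ey.1.2
            (fun h => h3 ((hGH.adj _ _).mpr h).symm) ((hGH.adj _ _).mp h4.adj.symm) hap
          exact ((hGH.triplex _ _ _).mpr ht).not_arrow_left ey.1.1
        exact hH.not_reach ex.1.2 (hap.reach.trans hpx.reach)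
      · exact h3 (n1 ey h4)
      · exact n3 ex h4 h1
  have hext : Ext q₂.1 q₂.2 := ⟨hq₂, hq₂', rfl⟩
  rcases (hW _ _ hq₂.1).2 with ⟨c, h1, h2⟩ | ⟨c, h1⟩ | ⟨c, h1, h2⟩ | ⟨c, d, h1, h2, h3⟩ |
    ⟨c, ⟨-, ξ, hξ, h1, -⟩, -⟩ | ⟨c, ⟨-, ξ, hξ, -, h1⟩, -⟩ | ⟨c, ⟨-, ξ, hξ, h1, -⟩, -⟩ |
    ⟨c, ⟨-, ξ, hξ, h1, -⟩, -⟩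
  · exact h2 (n1 hext h1)
  · exact n2 hext h1
  · exact n3 hext h1 h2
  · exact n4 hext h1 h2 h3
  · exact no_tail hext hξ h1
  · exact no_tail hext hξ h1
  · exact no_head hext hξ h1
  · exact no_head hext hξ h1

end Rigid

/-! ### Chordal components -/

section Chordal

variable {L L' : SimpleGraph V} {W W' : Set V} {s v x y : V}

/-- `s` is a vertex of `W` whose neighbours in `W` are pairwise adjacent. -/
def IsSimplicialIn (L : SimpleGraph V) (W : Set V) (s : V) : Prop :=
  s ∈ W ∧ ∀ x ∈ W, ∀ y ∈ W, L.Adj s x → L.Adj s y → x ≠ y → L.Adj x y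

theorem HasHole.congr (h : HasHole L W) (hW : W ⊆ W')
    (hL : ∀ x ∈ W, ∀ y ∈ W, L.Adj x y ↔ L'.Adj x y) : HasHole L' W' := by
  obtain ⟨k, v, hk, h0, hinj, hmem, hadj, hch⟩ := h
  have hmem' : ∀ i ≤ k, v i ∈ W := by
    intro i hi
    rcases hi.lt_or_eq with h | rfl
    · exact hmem i h
    · exact h0 ▸ hmem 0 (by omega)
  exact ⟨k, v, hk, h0, hinj, fun i hi => hW (hmem i hi),
    fun i hi => (hL _ (hmem' i hi.le) _ (hmem' (i + 1) hi)).mp (hadj i hi),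
    fun i j hij hj h1 h2 h3 => hch i j hij hj h1 h2
      ((hL _ (hmem i (by omega)) _ (hmem j hj)).mpr h3)⟩

/-- The vertex set of a hole has no simplicial vertex. -/
theorem HasHole.exists_subset (h : HasHole L W) :
    ∃ U ⊆ W, U.Nonempty ∧ ∀ s, ¬ IsSimplicialIn L U s := by
  obtain ⟨k, v, hk, h0, hinj, hmem, hadj, hch⟩ := h
  refine ⟨v '' Set.Iio k, ?_, ⟨v 0, 0, show 0 < k by omega, rfl⟩, ?_⟩
  · rintro _ ⟨i, hi, rfl⟩
    exact hmem i hi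
  · rintro _ ⟨⟨i, hi, rfl⟩, hs⟩
    replace hi : i < k := hi
    have key : ∀ i₁ i₂, i₁ < i₂ → i₂ < k → i₂ ≠ i₁ + 1 → ¬ (i₁ = 0 ∧ i₂ + 1 = k) →
        L.Adj (v i) (v i₁) → ¬ L.Adj (v i) (v i₂) := by
      intro i₁ i₂ h1 h2 h3 h4 h5 h6
      refine hch i₁ i₂ h1 h2 h3 h4 (hs _ ⟨i₁, h1.trans h2, rfl⟩ _ ⟨i₂, h2, rfl⟩ h5 h6 fun h => ?_)
      exact absurd (hinj (h1.trans h2) h2 h) h1.ne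
    rcases Nat.eq_zero_or_pos i with rfl | hpos
    · refine key 1 (k - 1) (by omega) (by omega) (by omega) (by omega) (hadj 0 hi) ?_
      have := hadj (k - 1) (by omega)
      rw [Nat.sub_add_cancel (by omega), h0] at this
      exact this.symm
    · have hprev : L.Adj (v i) (v (i - 1)) := by
        have := hadj (i - 1) (by omega)
        rw [Nat.sub_add_cancel (by omega)] at this
        exact this.symm
      by_cases hik : i + 1 = k
      · refine key 0 (i - 1) (by omega) (by omega) (by omega) (by omega) ?_ hprev
        have := hadj i hi
        rwa [hik, h0] at this
      · exact key (i - 1) (i + 1) (by omega) (by omega) (by omega) (by omega) hprev (hadj i hi)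

/-- In a graph without holes, two nonadjacent vertices that are joined by a path through `A` and
have a common neighbour not adjacent to `A` do not exist. -/
theorem adj_of_not_hasHole (hW : ¬ HasHole L W) {A : Set V} {b t : V} (hAW : A ⊆ W) (hs : s ∈ W)
    (ht : t ∈ W) (hb : b ∈ W) (hbA : b ∉ A) (hbA' : ∀ a ∈ A, ¬ L.Adj a b) (hsb : L.Adj s b)
    (htb : L.Adj t b) (hst : s ≠ t)
    (hpath : Relation.ReflTransGen (fun u w => L.Adj u w ∧ (u ∈ A ∨ u = s ∨ u = t) ∧
      (w ∈ A ∨ w = s ∨ w = t)) s t) : L.Adj s t := by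
  by_contra hadj
  obtain ⟨n, v, h0, hn, hv, hinj, hch⟩ := exists_shortest_seq hpath
  have hn2 : 2 ≤ n := by
    rcases n with _ | _ | n
    · exact absurd (h0.symm.trans hn) hst
    · have := (hv 0 (by norm_num)).1
      rw [h0, zero_add, hn] at this
      exact absurd this hadj
    · omega
  have hmem : ∀ i ≤ n, v i ∈ A ∨ v i = s ∨ v i = t := by
    intro i hi
    rcases hi.lt_or_eq with h | rfl
    · exact (hv i h).2.1
    · exact Or.inr (Or.inr hn)
  have hmid : ∀ i, 0 < i → i < n → v i ∈ A := by
    intro i h1 h2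
    rcases hmem i h2.le with h | h | h
    · exact h
    · exact absurd (h0.trans h.symm) (hinj 0 i h1 h2.le)
    · exact absurd (h.trans hn.symm) (hinj i n h2 le_rfl)
  have hvb : ∀ i ≤ n, v i ≠ b := by
    intro i hi h
    rcases hmem i hi with h' | h' | h'
    · exact hbA (h ▸ h')
    · exact hsb.ne (h'.symm.trans h)
    · exact htb.ne (h'.symm.trans h)
  refine hW ⟨n + 2, fun i => if i ≤ n then v i else if i = n + 1 then b else s, by omega, ?_, ?_,
    ?_, ?_, ?_⟩
  · simp [h0]
  · intro i hi j hj hij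
    have hi' : i < n + 2 := hi
    have hj' : j < n + 2 := hj
    dsimp only at hij
    split_ifs at hij with h1 h2 h3 h4 h5 h6 h7 h8
    · rcases lt_trichotomy i j with h | h | h
      · exact absurd hij (hinj i j h h2)
      · exact h
      · exact absurd hij.symm (hinj j i h h1)
    · exact absurd hij (hvb i h1)
    · omega
    · exact absurd hij.symm (hvb j h5)
    all_goals omega
  · intro i hi
    dsimp only
    split_ifs with h1 h2
    · rcases hmem i h1 with h | h | h
      · exact hAW h
      · exact h ▸ hs
      · exact h ▸ ht
    · exact hb
    · omega
  · intro i hi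
    dsimp only
    rcases lt_trichotomy i n with h | h | h
    · rw [if_pos h.le, if_pos (show i + 1 ≤ n from h)]
      exact (hv i h).1
    · rw [h, if_pos le_rfl, if_neg (by omega), if_pos rfl, hn]
      exact htb
    · have hi' : i = n + 1 := by omega
      rw [hi', if_neg (by omega), if_pos rfl, if_neg (by omega), if_neg (by omega)]
      exact hsb.symm
  · intro i j hij hj h1 h2
    dsimp only
    rw [if_pos (show i ≤ n by omega)]
    by_cases hjn : j ≤ n
    · rw [if_pos hjn]
      exact fun h => hch i j (by omega) hjn ⟨h, hmem i (by omega), hmem j hjn⟩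
    · rw [if_neg hjn, if_pos (by omega)]
      exact hbA' _ (hmid i (by omega) (by omega))

/-- In a graph without holes, every vertex that is not adjacent to all others has a nonneighbour
that is simplicial. -/
theorem exists_simplicial_not_adj [Finite V] (L : SimpleGraph V) (W : Set V) (hW : ¬ HasHole L W)
    (hv : v ∈ W) (hw : ∃ w ∈ W, w ≠ v ∧ ¬ L.Adj v w) :
    ∃ s, IsSimplicialIn L W s ∧ s ≠ v ∧ ¬ L.Adj v s := by
  induction hn : W.ncard using Nat.strong_induction_on generalizing W v with
  | _ n ih =>
  -- Dirac's argument: a maximal connected set `A` containing `v` that leaves some vertex `w₀`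
  -- nonadjacent to it. By maximality its boundary `S` is completely joined to the rest `B`, and
  -- absence of holes makes `S` a clique, so a simplicial vertex of `B` is simplicial in `W`.
  let F : Set (Set V) := {A | v ∈ A ∧ A ⊆ W ∧
    (∀ x ∈ A, Relation.ReflTransGen (fun u w => L.Adj u w ∧ u ∈ A ∧ w ∈ A) v x) ∧
    ∃ w ∈ W, w ∉ A ∧ ∀ a ∈ A, ¬ L.Adj a w}
  have hF : F.Nonempty := by
    obtain ⟨w, hwW, hwv, hadj⟩ := hw
    refine ⟨{v}, rfl, by simpa using hv, ?_, w, hwW, hwv, ?_⟩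
    · rintro x rfl
      exact .refl
    · rintro a rfl
      exact hadj
  obtain ⟨A, ⟨hvA, hAW, hconn, w₀, hw₀, hw₀A, hw₀adj⟩, hmax⟩ :=
    Set.exists_max_image F Set.ncard (Set.toFinite F) hF
  have hsym : ∀ {x y}, Relation.ReflTransGen (fun u w => L.Adj u w ∧ u ∈ A ∧ w ∈ A) x y →
      Relation.ReflTransGen (fun u w => L.Adj u w ∧ u ∈ A ∧ w ∈ A) y x := by
    intro x y h
    induction h with
    | refl => exact .refl
    | tail _ h ih => exact .head ⟨h.1.symm, h.2.2, h.2.1⟩ ih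
  let B : Set V := {w | w ∈ W ∧ w ∉ A ∧ ∀ a ∈ A, ¬ L.Adj a w}
  let S : Set V := {s | s ∈ W ∧ s ∉ A ∧ ∃ a ∈ A, L.Adj a s}
  have hSB : ∀ s ∈ S, ∀ b ∈ B, L.Adj s b := by
    rintro s ⟨hsW, hsA, a, ha, has⟩ b ⟨hbW, hbA, hb⟩
    by_contra hadj
    have hmem : insert s A ∈ F := by
      refine ⟨Or.inr hvA, Set.insert_subset hsW hAW, ?_, b, hbW, ?_, ?_⟩
      · have lift : ∀ x ∈ A, Relation.ReflTransGen
            (fun u w => L.Adj u w ∧ u ∈ insert s A ∧ w ∈ insert s A) v x := fun x hx =>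
          Relation.ReflTransGen.mono (fun _ _ h => ⟨h.1, Or.inr h.2.1, Or.inr h.2.2⟩) _ _
            (hconn x hx)
        rintro x (rfl | hx)
        · exact (lift a ha).tail ⟨has, Or.inr ha, Or.inl rfl⟩
        · exact lift x hx
      · rintro (rfl | h)
        · exact hb a ha has
        · exact hbA h
      · rintro a' (rfl | ha')
        · exact hadj
        · exact hb a' ha'
    have := hmax _ hmem
    rw [Set.ncard_insert_of_notMem hsA (Set.toFinite A)] at this
    omega
  have hSS : ∀ s ∈ S, ∀ t ∈ S, s ≠ t → L.Adj s t := by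
    rintro s hs t ht hst
    obtain ⟨a, ha, has⟩ := hs.2.2
    obtain ⟨a', ha', hat⟩ := ht.2.2
    refine adj_of_not_hasHole hW hAW hs.1 ht.1 hw₀ hw₀A hw₀adj (hSB s hs w₀ ⟨hw₀, hw₀A, hw₀adj⟩)
      (hSB t ht w₀ ⟨hw₀, hw₀A, hw₀adj⟩) hst ?_
    refine .head ⟨has.symm, Or.inr (Or.inl rfl), Or.inl ha⟩ (.tail ?_
      ⟨hat, Or.inl ha', Or.inr (Or.inr rfl)⟩)
    exact Relation.ReflTransGen.mono (fun _ _ h => ⟨h.1, Or.inl h.2.1, Or.inl h.2.2⟩) _ _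
      ((hsym (hconn a ha)).trans (hconn a' ha'))
  have hBW : B ⊆ W := fun _ h => h.1
  obtain ⟨s, hsB, hs⟩ : ∃ s, IsSimplicialIn L B s := by
    by_cases hcomp : ∃ u ∈ B, ∃ w ∈ B, w ≠ u ∧ ¬ L.Adj u w
    · obtain ⟨u, hu, hex⟩ := hcomp
      have hlt : B.ncard < n := by
        rw [← hn]
        exact Set.ncard_lt_ncard ⟨hBW, fun h => (h hv).2.1 hvA⟩ (Set.toFinite W)
      obtain ⟨s, hs, -⟩ := ih _ hlt B (fun h => hW (h.congr hBW fun _ _ _ _ => Iff.rfl)) hu hex rfl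
      exact ⟨s, hs⟩
    · push Not at hcomp
      exact ⟨w₀, ⟨hw₀, hw₀A, hw₀adj⟩, fun x hx y hy _ _ hxy => hcomp x hx y hy hxy.symm⟩
  have split : ∀ {x}, x ∈ W → L.Adj s x → x ∈ B ∨ x ∈ S := by
    intro x hx hsx
    have hxA : x ∉ A := fun h => hsB.2.2 x h hsx.symm
    by_cases h : ∃ a ∈ A, L.Adj a x
    · exact Or.inr ⟨hx, hxA, h⟩
    · push Not at h
      exact Or.inl ⟨hx, hxA, h⟩
  refine ⟨s, ⟨hsB.1, fun x hx y hy hsx hsy hxy => ?_⟩, fun h => hsB.2.1 (h ▸ hvA), hsB.2.2 v hvA⟩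
  rcases split hx hsx with h1 | h1 <;> rcases split hy hsy with h2 | h2
  · exact hs x h1 y h2 hsx hsy hxy
  · exact (hSB y h2 x h1).symm
  · exact hSB x h1 y h2
  · exact hSS x h1 y h2 hxy

theorem exists_simplicial [Finite V] (hW : ¬ HasHole L W) (hne : W.Nonempty) :
    ∃ s, IsSimplicialIn L W s := by
  by_cases h : ∃ u ∈ W, ∃ w ∈ W, w ≠ u ∧ ¬ L.Adj u w
  · obtain ⟨u, hu, hex⟩ := h
    obtain ⟨s, hs, -⟩ := exists_simplicial_not_adj L W hW hu hex
    exact ⟨s, hs⟩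
  · push Not at h
    obtain ⟨s, hs⟩ := hne
    exact ⟨s, hs, fun x hx y hy _ _ hxy => h x hx y hy hxy.symm⟩

/-- This allows vertices to be removed one by one while a chosen edge is kept to the end. -/
theorem exists_simplicial_ne [Finite V] (hW : ¬ HasHole L W) (hx : x ∈ W) (hy : y ∈ W)
    (hxy : L.Adj x y) (hz : ∃ z ∈ W, z ≠ x ∧ z ≠ y) :
    ∃ s, IsSimplicialIn L W s ∧ s ≠ x ∧ s ≠ y := by
  by_cases h1 : ∃ w ∈ W, w ≠ x ∧ ¬ L.Adj x w
  · obtain ⟨s, hs, hsx, hadj⟩ := exists_simplicial_not_adj L W hW hx h1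
    exact ⟨s, hs, hsx, fun h => hadj (h ▸ hxy)⟩
  by_cases h2 : ∃ w ∈ W, w ≠ y ∧ ¬ L.Adj y w
  · obtain ⟨s, hs, hsy, hadj⟩ := exists_simplicial_not_adj L W hW hy h2
    exact ⟨s, hs, fun h => hadj (h ▸ hxy.symm), hsy⟩
  -- Now `x` and `y` are adjacent to everything, so a simplicial vertex of the remaining set is
  -- simplicial in `W`.
  push Not at h1 h2
  obtain ⟨s, hs, hs'⟩ := exists_simplicial (W := {z | z ∈ W ∧ z ≠ x ∧ z ≠ y})
    (fun h => hW (h.congr (fun _ h => h.1) fun _ _ _ _ => Iff.rfl)) hz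
  refine ⟨s, ⟨hs.1, fun u hu w hw hsu hsw huw => ?_⟩, hs.2⟩
  by_cases hux : u = x
  · exact hux ▸ h1 w hw (fun e => huw (hux.trans e.symm))
  by_cases huy : u = y
  · exact huy ▸ h2 w hw (fun e => huw (huy.trans e.symm))
  by_cases hwx : w = x
  · exact hwx ▸ (h1 u hu hux).symm
  by_cases hwy : w = y
  · exact hwy ▸ (h2 u hu huy).symm
  exact hs' u ⟨hu, hux, huy⟩ w ⟨hw, hwx, hwy⟩ hsu hsw huw

end Chordal

/-! ### Lines that are not strong can be directed either way. -/

section Flexible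

variable {G : MixedGraph V} {W : Set V} {s x y : V}

/-- For one vertex, connectedness and covering are trivial; completeness is simpliciality, and the
condition on parents is the absence of flags. -/
theorem isSplittable_singleton
    (hcl : ∀ x ∈ W, ∀ y, G.Line x y → y ∈ W)
    (hpar : ∀ p, ∀ a ∈ W, ∀ b, G.Line a b → G.Arrow p a → G.Arrow p b)
    (hs : IsSimplicialIn G.lineGraph W s) : G.IsSplittable {s} := by
  refine ⟨?_, ?_, ?_, ?_⟩
  · rintro x rfl y rfl
    exact .refl
  · rintro a k k' - rfl rfl h
    exact h
  · rintro a b k - - rfl ha hb hab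
    exact hs.2 a (hcl _ hs.1 a ha.symm) b (hcl _ hs.1 b hb.symm) ha.symm hb.symm hab
  · rintro p a k - rfl h hpa
    exact hpar p a (hcl _ hs.1 a h.symm) _ h hpa

/-- A line in a union of chain components without holes and without flags can be directed. -/
theorem exists_arrow_of_not_hasHole [Finite V] (hG : G.IsChainGraph)
    (hcl : ∀ x ∈ W, ∀ y, G.Line x y → y ∈ W) (hW : ¬ HasHole G.lineGraph W)
    (hpar : ∀ p, ∀ a ∈ W, ∀ b, G.Line a b → G.Arrow p a → G.Arrow p b) (hx : x ∈ W)
    (hxy : G.Line x y) : ∃ H : MixedGraph V, H.IsChainGraph ∧ MarkovEquiv G H ∧ H.Arrow x y := by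
  induction hn : W.ncard using Nat.strong_induction_on generalizing G W with
  | _ n ih =>
  have hy : y ∈ W := hcl x hx y hxy
  by_cases hz : ∃ z ∈ W, z ≠ x ∧ z ≠ y
  -- Splitting off `s` leaves the line `x - y` and the hypotheses intact on `W \ {s}`: the only new
  -- arrows point at `s`.
  · obtain ⟨s, hs, hsx, hsy⟩ := exists_simplicial_ne hW hx hy hxy hz
    have hsp := isSplittable_singleton hcl hpar hs
    have hline : ∀ {u v}, u ≠ s → v ≠ s → ((G.split {s}).Line u v ↔ G.Line u v) := by
      intro u v hu hv
      rw [split_line]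
      simp [hu, hv]
    have hcl' : ∀ u ∈ W \ {s}, ∀ v, (G.split {s}).Line u v → v ∈ W \ {s} := by
      rintro u ⟨hu, hus⟩ v huv
      obtain ⟨h1, h2⟩ := split_line.mp huv
      exact ⟨hcl u hu v h1, fun h => hus (h2.mpr h)⟩
    have hW' : ¬ HasHole (G.split {s}).lineGraph (W \ {s}) := fun h =>
      hW (h.congr Set.sdiff_subset fun u hu v hv => hline hu.2 hv.2)
    have hpar' : ∀ p, ∀ a ∈ W \ {s}, ∀ b, (G.split {s}).Line a b → (G.split {s}).Arrow p a →
        (G.split {s}).Arrow p b := by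
      rintro p a ⟨ha, has⟩ b hab hpa
      have hpa' : G.Arrow p a := (split_arrow.mp hpa).resolve_right fun h => has h.2.2
      exact split_arrow.mpr (Or.inl (hpar p a ha b (split_line.mp hab).1 hpa'))
    obtain ⟨H, hH, hGH, hA⟩ := ih (W \ {s}).ncard
      (hn ▸ Set.ncard_lt_ncard ⟨Set.sdiff_subset, fun h => (h hs.1).2 rfl⟩ (Set.toFinite W))
      (hG.split {s}) hcl' hW' hpar' ⟨hx, hsx.symm⟩ ((hline hsx.symm hsy.symm).mpr hxy) rfl
    exact ⟨H, hH, (hsp.markovEquiv hG).trans hGH, hA⟩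
  -- Only `x` and `y` are left, so splitting off `y` directs the line as wanted.
  · push Not at hz
    have hs : IsSimplicialIn G.lineGraph W y := by
      refine ⟨hy, fun u hu v hv hyu hyv huv => absurd ?_ huv⟩
      have h1 : u = x := by
        by_contra h
        exact hyu.ne (hz u hu h).symm
      have h2 : v = x := by
        by_contra h
        exact hyv.ne (hz v hv h).symm
      rw [h1, h2]
    exact ⟨G.split {y}, hG.split {y}, (isSplittable_singleton hcl hpar hs).markovEquiv hG,
      split_arrow.mpr (Or.inr ⟨hxy, hxy.ne, rfl⟩)⟩

theorem exists_arrow_of_not_strongLine [Finite V] (hG : G.IsChainGraph) (hxy : G.Line x y)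
    (hs : ¬ G.StrongLine x y) :
    ∃ H : MixedGraph V, H.IsChainGraph ∧ MarkovEquiv G H ∧ H.Arrow x y := by
  have hξ : G.component x ∈ G.chainComponents := component_mem_chainComponents
  have hns : G.component x ∉ G.strongComponents := fun h =>
    hs ⟨hxy, _, h, mem_component_self, mem_of_line hξ mem_component_self hxy⟩
  rw [mem_strongComponents_iff hG] at hns
  push Not at hns
  obtain ⟨h1, h2⟩ := hns hξ
  refine exists_arrow_of_not_hasHole hG (fun u hu v h => mem_of_line hξ hu h) h1 ?_
    mem_component_self hxy
  intro p a ha b hab hpa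
  refine hG.arrow_of_parent hξ ha (mem_of_line hξ ha hab) hpa ?_
  by_contra hadj
  exact h2 p a b ⟨hpa, hab, hadj⟩ ha

end Flexible

/-! ### Merging two chain components -/

section Merge

variable {G : MixedGraph V} {σ ξ ζ : Set V} {a b p x y : V}

/-- The graph obtained by replacing every arrow from `σ` to `ξ` by a line. -/
def merge (G : MixedGraph V) (σ ξ : Set V) : MixedGraph V where
  Edge x y := G.Edge x y ∨ (x ∈ ξ ∧ y ∈ σ ∧ G.Edge y x)
  irrefl a h := h.elim (G.irrefl a) fun h => G.irrefl a h.2.2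

/-- The chain components `σ` and `ξ` are not strong, and the parents of `ξ` are those of `σ`
together with a complete subset of `σ`. -/
structure IsMergeable (G : MixedGraph V) (σ ξ : Set V) : Prop where
  left_mem : σ ∈ G.chainComponents
  right_mem : ξ ∈ G.chainComponents
  disjoint : ∀ x ∈ σ, x ∉ ξ
  left_parents : ∀ p, ∀ x ∈ σ, ∀ y ∈ σ, G.Arrow p x → G.Arrow p y
  right_parents : ∀ p, ∀ x ∈ ξ, ∀ y ∈ ξ, G.Arrow p x → G.Arrow p y
  parents : ∀ p, ∀ k ∈ ξ, G.Arrow p k → p ∈ σ ∨ ∀ x ∈ σ, G.Arrow p x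
  parents_of_left : ∀ p, ∀ x ∈ σ, ∀ k ∈ ξ, G.Arrow p x → G.Arrow p k
  complete : ∀ c ∈ σ, ∀ d ∈ σ, ∀ k ∈ ξ, G.Arrow c k → G.Arrow d k → c ≠ d → G.Line c d
  left_not_hasHole : ¬ HasHole G.lineGraph σ
  right_not_hasHole : ¬ HasHole G.lineGraph ξ

namespace IsMergeable

theorem arrow_of_edge (h : G.IsMergeable σ ξ) (hx : x ∈ σ) (hy : y ∈ ξ) (hxy : G.Edge x y) :
    G.Arrow x y :=
  (edge_iff.mp hxy).resolve_left fun hl => h.disjoint x hx (mem_of_line h.right_mem hy hl.symm)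

theorem merge_line (h : G.IsMergeable σ ξ) : (G.merge σ ξ).Line x y ↔
    G.Line x y ∨ (x ∈ σ ∧ y ∈ ξ ∧ G.Arrow x y) ∨ (y ∈ σ ∧ x ∈ ξ ∧ G.Arrow y x) := by
  constructor
  · rintro ⟨h1 | ⟨h1, h2, h3⟩, h4 | ⟨h4, h5, h6⟩⟩
    · exact Or.inl ⟨h1, h4⟩
    · exact Or.inr (Or.inl ⟨h5, h4, h.arrow_of_edge h5 h4 h6⟩)
    · exact Or.inr (Or.inr ⟨h2, h1, h.arrow_of_edge h2 h1 h3⟩)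
    · exact absurd h4 (h.disjoint y h2)
  · rintro (h1 | ⟨h1, h2, h3⟩ | ⟨h1, h2, h3⟩)
    · exact ⟨Or.inl h1.1, Or.inl h1.2⟩
    · exact ⟨Or.inl h3.1, Or.inr ⟨h2, h1, h3.1⟩⟩
    · exact ⟨Or.inr ⟨h2, h1, h3.1⟩, Or.inl h3.1⟩

theorem merge_arrow : (G.merge σ ξ).Arrow x y ↔ G.Arrow x y ∧ ¬ (x ∈ σ ∧ y ∈ ξ) := by
  simp only [Arrow, merge]; tauto

theorem merge_adj : (G.merge σ ξ).Adj x y ↔ G.Adj x y := by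
  simp only [Adj, merge]; tauto

/-- A new closed walk would pass from `ξ` back to `σ`. Entering `ξ` from outside happens through `σ`
or through a common parent of `σ`, so in either case the walk could already be closed in `G`; what
remains are the arrows that the merge has turned into lines. -/
theorem isChainGraph_merge (h : G.IsMergeable σ ξ) (hG : G.IsChainGraph) :
    (G.merge σ ξ).IsChainGraph := by
  have hreach : ∀ u v, (G.merge σ ξ).Reach u v →
      G.Reach u v ∨ ∃ k ∈ ξ, ∃ c ∈ σ, G.Reach u k ∧ G.Reach c v := by
    intro u v huv
    induction huv with
    | refl => exact Or.inl (Reach.refl u)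
    | @tail v w _ hvw ih =>
      rcases hvw with hvw | ⟨hv, hw, -⟩
      · rcases ih with ih | ⟨k, hk, c, hc, h1, h2⟩
        · exact Or.inl (ih.tail hvw)
        · exact Or.inr ⟨k, hk, c, hc, h1, h2.tail hvw⟩
      · rcases ih with ih | ⟨k, hk, c, hc, h1, h2⟩
        · exact Or.inr ⟨v, hv, w, hw, ih, Reach.refl w⟩
        · exact Or.inr ⟨k, hk, w, hw, h1, Reach.refl w⟩
  refine isChainGraph_of_not_reach fun x y hxy hyx => ?_
  obtain ⟨hxy, hnot⟩ := merge_arrow.mp hxy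
  rcases hreach y x hyx with hr | ⟨k, hk, c, hc, hyk, hcx⟩
  · exact hG.not_reach hxy hr
  · have hσ : ∀ {z w}, z ∈ σ → w ∈ σ → G.Reach z w := fun hz hw => reach_of_mem h.left_mem hz hw
    have key : y ∈ ξ := by
      by_contra hy
      have step : ∀ u, G.Reach u k → u ∉ ξ → ∃ q k', k' ∈ ξ ∧ G.Arrow q k' ∧ G.Reach u q := by
        intro u hu huξ
        induction hu using Relation.ReflTransGen.head_induction_on with
        | refl => exact absurd hk huξ
        | @head u w huw hwk ih =>
          by_cases hw : w ∈ ξ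
          · refine ⟨u, w, hw, (edge_iff.mp huw).resolve_left fun hl => ?_, Reach.refl u⟩
            exact huξ (mem_of_line h.right_mem hw hl.symm)
          · obtain ⟨q, k', hk', hq, hwq⟩ := ih hw
            exact ⟨q, k', hk', hq, Relation.ReflTransGen.head huw hwq⟩
      obtain ⟨q, k', hk', hq, hyq⟩ := step y hyk hy
      rcases h.parents q k' hk' hq with hqσ | hqσ
      · exact hG.not_reach hxy (hyq.trans ((hσ hqσ hc).trans hcx))
      · exact hG.not_reach hxy (hyq.trans ((hqσ c hc).reach.trans hcx))
    rcases h.parents x y key hxy with hx | hx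
    · exact hnot ⟨hx, key⟩
    · exact hG.not_reach (hx c hc) hcx

/-- The merged graph is equivalent to `G` because splitting it gives `G` back. -/
theorem split_merge (h : G.IsMergeable σ ξ) : (G.merge σ ξ).split ξ = G := by
  ext x y
  constructor
  · rintro ⟨h1 | ⟨h1, h2, h3⟩, h4⟩
    · exact h1
    · exact absurd ⟨h1, h.disjoint y h2, Or.inl h3⟩ h4
  · intro h1
    refine ⟨Or.inl h1, ?_⟩
    rintro ⟨hx, hy, h2 | ⟨h2, -, -⟩⟩
    · exact hy (mem_of_line h.right_mem hx ⟨h1, h2⟩)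
    · exact hy h2

theorem isSplittable_merge (h : G.IsMergeable σ ξ) (hG : G.IsChainGraph) :
    (G.merge σ ξ).IsSplittable ξ := by
  have arr : ∀ {a k}, a ∉ ξ → k ∈ ξ → (G.merge σ ξ).Line a k → a ∈ σ ∧ G.Arrow a k := by
    intro a k ha hk hl
    rcases h.merge_line.mp hl with h1 | h1 | h1
    · exact absurd (mem_of_line h.right_mem hk h1.symm) ha
    · exact ⟨h1.1, h1.2.2⟩
    · exact absurd h1.2.1 ha
  refine ⟨?_, ?_, ?_, ?_⟩
  · intro x hx y hy
    have := (mem_chainComponents_iff.mp h.right_mem).2.2 x hx y hy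
    clear hy
    induction this with
    | refl => exact .refl
    | tail h1 h2 ih =>
      exact ih.tail ⟨h.merge_line.mpr (Or.inl h2),
        mem_of_line h.right_mem (mem_of_reflTransGen_line h.right_mem hx h1) h2⟩
  · intro a k k' ha hk hk' hl
    obtain ⟨haσ, hak⟩ := arr ha hk hl
    exact h.merge_line.mpr (Or.inr (Or.inl ⟨haσ, hk', h.right_parents a k hk k' hk' hak⟩))
  · intro a b k ha hb hk hak hbk hab
    obtain ⟨haσ, hak⟩ := arr ha hk hak
    obtain ⟨hbσ, hbk⟩ := arr hb hk hbk
    exact h.merge_line.mpr (Or.inl (h.complete a haσ b hbσ k hk hak hbk hab))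
  · intro p a k ha hk hak hpa
    obtain ⟨haσ, hak⟩ := arr ha hk hak
    obtain ⟨hpa, -⟩ := merge_arrow.mp hpa
    refine merge_arrow.mpr ⟨h.parents_of_left p a haσ k hk hpa, fun hp => ?_⟩
    exact hG.parent_notMem h.left_mem haσ hpa hp.1

/-- The merged component is again free of holes and flags, hence not strong, and all other
components keep their lines and parents. -/
theorem unsplittable_merge [Finite V] (h : G.IsMergeable σ ξ) (hG : G.IsChainGraph)
    (hU : ∀ ζ ∈ G.strongComponents, G.Unsplittable ζ) :
    ∀ ζ ∈ (G.merge σ ξ).strongComponents, (G.merge σ ξ).Unsplittable ζ := by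
  intro ζ hζs
  obtain ⟨hζ, hstr⟩ := (mem_strongComponents_iff (h.isChainGraph_merge hG)).mp hζs
  have closed : ∀ {x y}, (x ∈ σ ∨ x ∈ ξ) → (G.merge σ ξ).Line x y → y ∈ σ ∨ y ∈ ξ := by
    intro x y hx hl
    rcases h.merge_line.mp hl with h1 | h1 | h1
    · exact hx.imp (fun hx => mem_of_line h.left_mem hx h1)
        (fun hx => mem_of_line h.right_mem hx h1)
    · exact Or.inr h1.2.1
    · exact Or.inl h1.1
  have line_of : ∀ {x y}, ((x ∈ σ ∧ y ∈ σ) ∨ (x ∈ ξ ∧ y ∈ ξ)) →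
      ((G.merge σ ξ).Line x y ↔ G.Line x y) := by
    intro x y hxy
    rw [h.merge_line]
    refine or_iff_left ?_
    have := h.disjoint x
    have := h.disjoint y
    tauto
  by_cases hmeet : ∃ z ∈ ζ, z ∈ σ ∨ z ∈ ξ
  · exfalso
    obtain ⟨z, hz, hzτ⟩ := hmeet
    have hsub : ∀ x ∈ ζ, x ∈ σ ∨ x ∈ ξ := by
      intro x hx
      have := (mem_chainComponents_iff.mp hζ).2.2 z hz x hx
      clear hx
      induction this with
      | refl => exact hzτ
      | tail _ hl ih => exact closed ih hl
    rcases hstr with hole | ⟨p, x, y, ⟨h1, h2, h3⟩, hx⟩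
    -- A hole has no simplicial vertex. But a simplicial vertex of its part in `ξ` stays simplicial
    -- after adding its neighbours in `σ`, which form a clique and are joined to all of `ξ`.
    · obtain ⟨U, hUζ, hUne, hUs⟩ := hole.exists_subset
      by_cases hUξ : (U ∩ ξ).Nonempty
      · obtain ⟨s, hs, hs'⟩ := exists_simplicial (L := G.lineGraph) (W := U ∩ ξ)
          (fun hh => h.right_not_hasHole (hh.congr Set.inter_subset_right fun _ _ _ _ => Iff.rfl))
          hUξ
        refine hUs s ⟨hs.1, fun x hx y hy hsx hsy hxy => ?_⟩
        have nbr : ∀ {x}, x ∈ U → (G.merge σ ξ).Line s x → x ∈ ξ ∨ (x ∈ σ ∧ G.Arrow x s) := by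
          intro x hx hl
          rcases h.merge_line.mp hl with h1 | h1 | h1
          · exact Or.inl (mem_of_line h.right_mem hs.2 h1)
          · exact Or.inl h1.2.1
          · exact Or.inr ⟨h1.1, h1.2.2⟩
        change (G.merge σ ξ).Line x y
        rcases nbr hx hsx with h1 | ⟨h1, h1'⟩ <;> rcases nbr hy hsy with h2 | ⟨h2, h2'⟩
        · exact (line_of (Or.inr ⟨h1, h2⟩)).mpr (hs' x ⟨hx, h1⟩ y ⟨hy, h2⟩
            ((line_of (Or.inr ⟨hs.2, h1⟩)).mp hsx) ((line_of (Or.inr ⟨hs.2, h2⟩)).mp hsy) hxy)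
        · exact h.merge_line.mpr (Or.inr (Or.inr ⟨h2, h1, h.right_parents y s hs.2 x h1 h2'⟩))
        · exact h.merge_line.mpr (Or.inr (Or.inl ⟨h1, h2, h.right_parents x s hs.2 y h2 h1'⟩))
        · exact h.merge_line.mpr (Or.inl (h.complete x h1 y h2 s hs.2 h1' h2' hxy))
      · have hUσ : U ⊆ σ := fun x hx =>
          (hsub x (hUζ hx)).resolve_right fun hxξ => hUξ ⟨x, hx, hxξ⟩
        obtain ⟨s, hs, hs'⟩ := exists_simplicial (L := G.lineGraph) (W := U)
          (fun hh => h.left_not_hasHole (hh.congr hUσ fun _ _ _ _ => Iff.rfl)) hUne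
        refine hUs s ⟨hs, fun x hx y hy hsx hsy hxy => ?_⟩
        exact (line_of (Or.inl ⟨hUσ hx, hUσ hy⟩)).mpr (hs' x hx y hy
          ((line_of (Or.inl ⟨hUσ hs, hUσ hx⟩)).mp hsx)
          ((line_of (Or.inl ⟨hUσ hs, hUσ hy⟩)).mp hsy) hxy)
    -- A surviving arrow into the merged component comes from a parent of all of `σ`, hence of all
    -- of `ξ`, and cannot start a flag.
    · obtain ⟨hpx, hnot⟩ := merge_arrow.mp h1
      have hall : ∀ w ∈ σ, G.Arrow p w := by
        rcases hsub x hx with hxσ | hxξ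
        · exact fun w hw => h.left_parents p x hxσ w hw hpx
        · exact (h.parents p x hxξ hpx).resolve_left fun hp => hnot ⟨hp, hxξ⟩
      refine h3 (merge_adj.mpr ?_)
      rcases hsub y (mem_of_line hζ hx h2) with hy | hy
      · exact (hall y hy).adj
      · obtain ⟨w, hw⟩ := (mem_chainComponents_iff.mp h.left_mem).1
        exact (h.parents_of_left p w hw y hy (hall w hw)).adj
  · push Not at hmeet
    have hline : ∀ {x y}, x ∈ ζ → ((G.merge σ ξ).Line x y ↔ G.Line x y) := by
      intro x y hx
      rw [h.merge_line]
      have := hmeet x hx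
      tauto
    have hline' : ∀ {x y}, y ∈ ζ → ((G.merge σ ξ).Line x y ↔ G.Line x y) := fun hy =>
      ⟨fun hl => ((hline hy).mp hl.symm).symm, fun hl => ((hline hy).mpr hl.symm).symm⟩
    have harr : ∀ {p x}, x ∈ ζ → ((G.merge σ ξ).Arrow p x ↔ G.Arrow p x) := by
      intro p x hx
      rw [merge_arrow]
      have := hmeet x hx
      tauto
    have hζG : ζ ∈ G.chainComponents := by
      obtain ⟨h1, h2, h3⟩ := mem_chainComponents_iff.mp hζ
      refine mem_chainComponents_iff.mpr ⟨h1, fun x hx y hl => h2 x hx y ((hline hx).mpr hl), ?_⟩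
      intro x hx y hy
      have := h3 x hx y hy
      clear hy
      induction this with
      | refl => exact .refl
      | tail h4 h5 ih => exact ih.tail ((hline (mem_of_reflTransGen_line hζ hx h4)).mp h5)
    have hζGs : ζ ∈ G.strongComponents := by
      refine (mem_strongComponents_iff hG).mpr ⟨hζG, ?_⟩
      rcases hstr with hole | ⟨p, x, y, ⟨h1, h2, h3⟩, hx⟩
      · exact Or.inl (hole.congr subset_rfl fun x hx y _ => hline hx)
      · exact Or.inr ⟨p, x, y, ⟨(harr hx).mp h1, (hline hx).mp h2,
          fun hadj => h3 (merge_adj.mpr hadj)⟩, hx⟩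
    intro κ hκ hne hs
    refine hU ζ hζGs κ hκ hne ⟨?_, ?_, ?_, ?_⟩
    · intro x hx y hy
      exact Relation.ReflTransGen.mono (fun u v huv => ⟨(hline' (hκ.1 huv.2)).mp huv.1, huv.2⟩) _ _
        (hs.connected x hx y hy)
    · intro a k k' ha hk hk' hl
      exact (hline' (hκ.1 hk')).mp (hs.covers a k k' ha hk hk' ((hline' (hκ.1 hk)).mpr hl))
    · intro a b k ha hb hk hak hbk hab
      have haζ : a ∈ ζ := mem_of_line hζG (hκ.1 hk) hak.symm
      exact (hline haζ).mp (hs.complete a b k ha hb hk ((hline' (hκ.1 hk)).mpr hak)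
        ((hline' (hκ.1 hk)).mpr hbk) hab)
    · intro p a k ha hk hak hpa
      have haζ : a ∈ ζ := mem_of_line hζG (hκ.1 hk) hak.symm
      exact (harr (hκ.1 hk)).mp (hs.parents p a k ha hk ((hline' (hκ.1 hk)).mpr hak)
        ((harr haζ).mpr hpa))

end IsMergeable

theorem not_hasHole_of_notMem_strongComponents (hG : G.IsChainGraph) (hξ : ξ ∈ G.chainComponents)
    (hs : ξ ∉ G.strongComponents) : ¬ HasHole G.lineGraph ξ := fun h =>
  hs ((mem_strongComponents_iff hG).mpr ⟨hξ, Or.inl h⟩)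

theorem arrow_of_notMem_strongComponents (hG : G.IsChainGraph) (hξ : ξ ∈ G.chainComponents)
    (hs : ξ ∉ G.strongComponents) (hx : x ∈ ξ) (hy : y ∈ ξ) (hp : G.Arrow p x) : G.Arrow p y := by
  have := (mem_chainComponents_iff.mp hξ).2.2 x hx y hy
  clear hy
  induction this with
  | refl => exact hp
  | @tail u w hu huw ih =>
    have huξ := mem_of_reflTransGen_line hξ hx hu
    refine hG.arrow_of_parent hξ huξ (mem_of_line hξ huξ huw) ih ?_
    by_contra hadj
    exact hs ((mem_strongComponents_iff hG).mpr ⟨hξ, Or.inr ⟨p, u, w, ⟨ih, huw, hadj⟩, huξ⟩⟩)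

theorem exists_strongLine (hs : G.component x ∈ G.strongComponents) :
    ∃ y, G.StrongLine x y := by
  obtain ⟨z, hz, hzx⟩ := hs.2.1.exists_ne x
  rcases Relation.ReflTransGen.cases_head hz with h | ⟨y, hxy, -⟩
  · exact absurd h.symm hzx
  · exact ⟨y, hxy, _, hs, mem_component_self, .single hxy⟩

/-- The chain components of the end points of an arrow that is not well protected can be merged. -/
theorem isMergeable_of_not_wellProtected (hG : G.IsChainGraph) (hab : G.Arrow a b)
    (hn : ¬ G.WellProtected a b) : G.IsMergeable (G.component a) (G.component b) := by
  -- Failure of (v) to (viii) makes both components non-strong. Failure of (ii) and (iii) controls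
  -- the parents of `b`, failure of (i) passes the parents of `a` on to `b`, and failure of (iv)
  -- makes the parents of `b` in the component of `a` complete.
  simp only [WellProtected, hab, true_and, not_or] at hn
  obtain ⟨n1, n2, n3, n4, n5, n6, n7, n8⟩ := hn
  have hσ : G.component a ∈ G.chainComponents := component_mem_chainComponents
  have hξ : G.component b ∈ G.chainComponents := component_mem_chainComponents
  have hσs : G.component a ∉ G.strongComponents := by
    intro hs
    obtain ⟨c, hc⟩ := exists_strongLine hs
    by_cases hcb : G.Adj c b
    · exact n5 ⟨c, hc, arrow_of_adj hcb fun hr => hG.not_reach hab (hr.trans hc.1.symm.reach)⟩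
    · obtain ⟨hl, ζ, hζ, h1, h2⟩ := hc
      exact n6 ⟨c, ⟨hl.symm, ζ, hζ, h2, h1⟩, hcb⟩
  have hξs : G.component b ∉ G.strongComponents := by
    intro hs
    obtain ⟨c, hc⟩ := exists_strongLine hs
    by_cases hac : G.Adj a c
    · exact n8 ⟨c, hc, arrow_of_adj hac fun hr => hG.not_reach hab (hc.1.reach.trans hr)⟩
    · exact n7 ⟨c, hc, hac⟩
  have hσp : ∀ p, ∀ x ∈ G.component a, ∀ y ∈ G.component a, G.Arrow p x → G.Arrow p y :=
    fun p x hx y hy h => arrow_of_notMem_strongComponents hG hσ hσs hx hy h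
  have hξp : ∀ p, ∀ x ∈ G.component b, ∀ y ∈ G.component b, G.Arrow p x → G.Arrow p y :=
    fun p x hx y hy h => arrow_of_notMem_strongComponents hG hξ hξs hx hy h
  have adj_a : ∀ {p}, p ≠ a → G.Arrow p b → G.Adj p a := by
    intro p hpa hpb
    by_contra hadj
    exact n2 ⟨p, hpa.symm, hab, hpb, fun h => hadj h.symm⟩
  refine ⟨hσ, hξ, ?_, hσp, hξp, ?_, ?_, ?_, not_hasHole_of_notMem_strongComponents hG hσ hσs,
    not_hasHole_of_notMem_strongComponents hG hξ hξs⟩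
  · intro x hx hx'
    exact hG.not_reach hab ((reach_of_mem hξ mem_component_self hx').trans
      (reach_of_mem hσ hx mem_component_self))
  · intro p k hk hpk
    have hpb := hξp p k hk b mem_component_self hpk
    by_cases hpa : p = a
    · exact Or.inl (hpa ▸ mem_component_self)
    rcases adj_iff.mp (adj_a hpa hpb) with h | h | h
    · exact Or.inl (.single h.symm)
    · exact Or.inr fun x hx => hσp p a mem_component_self x hx h
    · exact absurd ⟨p, h, hpb⟩ n3
  · intro p x hx k hk hpx
    have hpa := hσp p x hx a mem_component_self hpx
    refine hξp p b mem_component_self k hk (arrow_of_adj ?_ fun hr => ?_)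
    · by_contra hadj
      exact n1 ⟨p, hpa, hadj⟩
    · exact hG.not_reach hpa (hab.reach.trans hr)
  · intro c hc d hd k hk hck hdk hcd
    have hcb := hξp c k hk b mem_component_self hck
    have hdb := hξp d k hk b mem_component_self hdk
    refine hG.line_of_mem hσ hc hd ?_
    by_cases hca : c = a
    · exact hca ▸ (adj_a (fun e => hcd (hca.trans e.symm)) hdb).symm
    by_cases hda : d = a
    · exact hda ▸ adj_a hca hcb
    by_contra hadj
    exact n4 ⟨c, d, hG.line_of_mem hσ mem_component_self hc (adj_a hca hcb).symm,
      hG.line_of_mem hσ mem_component_self hd (adj_a hda hdb).symm, hcd, hcb, hdb, hadj⟩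

end Merge

/-! ### The characterization of AMP essential graphs -/

section Essential

/-- The number of ordered pairs of vertices that are joined by an arrow or a line. -/
noncomputable def edgeCount (G : MixedGraph V) : ℕ := {q : V × V | G.Edge q.1 q.2}.ncard

/-- The conditions of the characterization, with properties S and S' replaced by the equivalent
condition that no part of the component can be split off. -/
structure IsWellProtectedChainGraph (G : MixedGraph V) : Prop where
  chain : G.IsChainGraph
  unsplittable : ∀ ξ ∈ G.strongComponents, G.Unsplittable ξ
  wellProtected : ∀ a b, G.Arrow a b → G.WellProtected a b

variable [Finite V] {G H : MixedGraph V} {a b : V}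

instance : Finite (MixedGraph V) := by
  refine Finite.of_injective (fun G : MixedGraph V => {q : V × V | G.Edge q.1 q.2}) ?_
  intro G H h
  ext a b
  exact Set.ext_iff.mp h (a, b)

theorem edgeCount_lt (h : ∀ x y, G.Edge x y → H.Edge x y) (hH : H.Edge a b) (hG : ¬ G.Edge a b) :
    G.edgeCount < H.edgeCount :=
  Set.ncard_lt_ncard ⟨fun q hq => h q.1 q.2 hq, fun hs => hG (hs (show (a, b) ∈ _ from hH))⟩
    (Set.toFinite _)

/-- A line counts as two ordered pairs and an arrow as one, so every split lowers `edgeCount`; a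
minimal member admits none. -/
theorem exists_unsplittable (hG : G.IsChainGraph) : ∃ H : MixedGraph V, H.IsChainGraph ∧
    MarkovEquiv H G ∧ ∀ ξ ∈ H.chainComponents, H.Unsplittable ξ := by
  obtain ⟨H, ⟨hH, hHG⟩, hmin⟩ := Set.exists_min_image
    {H : MixedGraph V | H.IsChainGraph ∧ MarkovEquiv H G} edgeCount (Set.toFinite _)
    ⟨G, hG, .refl G⟩
  refine ⟨H, hH, hHG, fun ξ hξ κ hκ hne hs => ?_⟩
  obtain ⟨a, -, ha, k, hk, hak⟩ := exists_line_of_ssubset hξ hκ hne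
  have hle := hmin (H.split κ) ⟨hH.split κ, (hs.markovEquiv hH).symm.trans hHG⟩
  have hlt : (H.split κ).edgeCount < H.edgeCount :=
    edgeCount_lt (a := k) (b := a) (fun _ _ h => h.1) hak.2 fun h => h.2 ⟨hk, ha, hak.1⟩
  omega

/-- Merging raises `edgeCount` while preserving the class and the unsplittability of strong
components. The preceding lemma is needed only to start: it shows that the set being maximized over
is nonempty. -/
theorem exists_isWellProtectedChainGraph (hG : G.IsChainGraph) :
    ∃ H : MixedGraph V, MarkovEquiv H G ∧ H.IsWellProtectedChainGraph := by
  obtain ⟨H₀, hH₀, hHG₀, hU₀⟩ := exists_unsplittable hG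
  obtain ⟨H, ⟨hH, hHG, hU⟩, hmax⟩ := Set.exists_max_image {H : MixedGraph V | H.IsChainGraph ∧
    MarkovEquiv H G ∧ ∀ ξ ∈ H.strongComponents, H.Unsplittable ξ} edgeCount (Set.toFinite _)
    ⟨H₀, hH₀, hHG₀, fun ξ hξ => hU₀ ξ hξ.1⟩
  refine ⟨H, hHG, hH, hU, fun a b hab => ?_⟩
  by_contra hn
  have hm := isMergeable_of_not_wellProtected hH hab hn
  have hM := hm.isChainGraph_merge hH
  have hME : MarkovEquiv (H.merge (H.component a) (H.component b)) H := by
    have := (hm.isSplittable_merge hH).markovEquiv hM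
    rwa [hm.split_merge] at this
  have hle := hmax _ ⟨hM, hME.trans hHG, hm.unsplittable_merge hH hU⟩
  have hlt : H.edgeCount < (H.merge (H.component a) (H.component b)).edgeCount :=
    edgeCount_lt (fun _ _ h => Or.inl h)
      (Or.inr ⟨mem_component_self, mem_component_self, hab.1⟩) hab.2
  omega

/-- Three facts decide every edge: arrows are never reversed in the class, strong lines are always
lines, and any other line occurs as an arrow in both directions. -/
theorem IsWellProtectedChainGraph.isEssentialGraphOf (hG : G.IsWellProtectedChainGraph) :
    G.IsEssentialGraphOf G := by
  have hself : G ∈ ampClass G := ⟨hG.chain, .refl G⟩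
  have same : ∀ {H}, H ∈ ampClass G → SameTriplexes G H := fun hH =>
    hH.2.symm.sameTriplexes hG.chain hH.1
  have norev : ∀ {a b H}, H ∈ ampClass G → G.Arrow a b → ¬ H.Arrow b a := fun hH hab =>
    not_arrow_of_wellProtected hG.chain hH.1 (same hH) hG.unsplittable hG.wellProtected hab
  have rigid : ∀ {a b H}, H ∈ ampClass G → G.StrongLine a b → H.Line a b := by
    rintro a b H hH ⟨hl, ξ, hξ, ha, -⟩
    exact (hG.unsplittable ξ hξ).line hG.chain hH.1 (same hH) hξ.1 ha hl
  have flexible : ∀ {a b}, G.Line a b → ¬ G.StrongLine a b → ∃ H ∈ ampClass G, H.Arrow a b := by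
    intro a b hl hs
    obtain ⟨H, hH, hGH, hA⟩ := exists_arrow_of_not_strongLine hG.chain hl hs
    exact ⟨H, ⟨hH, hGH.symm⟩, hA⟩
  have strong_symm : ∀ {a b}, G.StrongLine a b → G.StrongLine b a :=
    fun ⟨hl, ξ, hξ, ha, hb⟩ => ⟨hl.symm, ξ, hξ, hb, ha⟩
  refine ⟨rfl, fun a b => ⟨fun hab => ?_, ?_⟩, fun a b => ⟨fun hl => ?_, ?_⟩⟩
  · exact ⟨⟨G, hself, hab⟩, fun ⟨H, hH, hba⟩ => norev hH hab hba⟩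
  · rintro ⟨⟨H, hH, hab⟩, hno⟩
    rcases adj_iff.mp (((same hH).adj a b).mpr hab.adj) with h | h | h
    · by_cases hs : G.StrongLine a b
      · exact absurd (rigid hH hs).2 hab.2
      · exact absurd (flexible h.symm fun h => hs (strong_symm h)) hno
    · exact h
    · exact absurd ⟨G, hself, h⟩ hno
  · by_cases hs : G.StrongLine a b
    · exact Or.inl fun H hH => rigid hH hs
    · exact Or.inr ⟨flexible hl hs, flexible hl.symm fun h => hs (strong_symm h)⟩
  · rintro (h | ⟨⟨H, hH, hab⟩, ⟨H', hH', hba⟩⟩)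
    · exact h G hself
    · rcases adj_iff.mp (((same hH).adj a b).mpr hab.adj) with h | h | h
      · exact h
      · exact absurd hba (norev hH' h)
      · exact absurd hab (norev hH h)

/-- The arrows and lines of an essential graph are determined by the class alone, so `G` coincides
with the well protected member of the class. -/
theorem isAMPEssentialGraph_iff : G.IsAMPEssentialGraph ↔ G.IsWellProtectedChainGraph := by
  constructor
  · rintro ⟨G₀, hG₀, hG⟩
    obtain ⟨H, hHG, hH⟩ := exists_isWellProtectedChainGraph hG₀
    have hclass : ampClass H = ampClass G₀ := by
      ext K
      exact ⟨fun h => ⟨h.1, h.2.trans hHG⟩, fun h => ⟨h.1, h.2.trans hHG.symm⟩⟩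
    have hess := hH.isEssentialGraphOf
    have hGH : G = H := eq_of_arrow_of_line
      (fun a b => by rw [hG.arrow_iff, hess.arrow_iff, hclass])
      (fun a b => by rw [hG.line_iff, hess.line_iff, hclass])
    exact hGH ▸ hH
  · exact fun hG => ⟨G, hG.chain, hG.isEssentialGraphOf⟩

end Essential

end MixedGraph

theorem theorem5p1 {V : Type*} [Finite V] (G : MixedGraph V) :
    (G.IsAMPEssentialGraph ↔
      G.IsChainGraph ∧
      (∀ ξ ∈ G.strongComponents, G.PropertyS ξ) ∧
      (∀ a b, G.Arrow a b → G.WellProtected a b)) ∧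
    (G.IsAMPEssentialGraph ↔
      G.IsChainGraph ∧
      (∀ ξ ∈ G.strongComponents, G.PropertyS' ξ) ∧
      (∀ a b, G.Arrow a b → G.WellProtected a b)) := by
  rw [MixedGraph.isAMPEssentialGraph_iff]
  constructor
  · constructor
    · exact fun h => ⟨h.chain, fun ξ hξ => (MixedGraph.propertyS_iff h.chain hξ.1).mpr
        (h.unsplittable ξ hξ), h.wellProtected⟩
    · exact fun ⟨h1, h2, h3⟩ => ⟨h1, fun ξ hξ => (MixedGraph.propertyS_iff h1 hξ.1).mp
        (h2 ξ hξ), h3⟩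
  · constructor
    · exact fun h => ⟨h.chain, fun ξ hξ => (MixedGraph.propertyS'_iff h.chain hξ.1).mpr
        (h.unsplittable ξ hξ), h.wellProtected⟩
    · exact fun ⟨h1, h2, h3⟩ => ⟨h1, fun ξ hξ => (MixedGraph.propertyS'_iff h1 hξ.1).mp
        (h2 ξ hξ), h3⟩
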